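/- **Notation.** Let $\mathfrak g$ be the real vector space of complex supermatrices of format $2|1|2$ $$X=\begin{pmatrix}A&\overline R^{\,t}&U\\ Q&B&R\\ T&-\overline Q^{\,t}&-\overline A^{\,t}\end{pmatrix},\qquad A\in\mathfrak{gl}(2;\mathbb C),\quad Q,R\in \mathrm{Mat}_{\mathbb C}(1\times 2),\quad T=\overline T^{\,t},\ U=\overline U^{\,t}\in\mathrm{Mat}_{\mathbb C}(2\times 2),\quad B\in i\mathbb R,\ B=\operatorname{tr}(A-\overline A^{\,t}),$$ graded by $\deg T=-2$, $\deg Q=-1$, $\deg A=\deg B=0$, $\deg R=1$, $\deg U=2$, with parity equal to the degree mod $2$ and with the supercommutator of supermatrices as bracket. It is a $\mathbb Z$-graded real Lie superalgebra. Let $\mathfrak g_-=\mathfrak g_{-2}\oplus\mathfrak g_{-1}$. The *conformal* case is the pair $(\mathfrak g_-,\mathfrak g_0)$; the *reduced* case is the pair $(\mathfrak g_-,\mathfrak g_0')$, where $\mathfrak g'_0\subset\mathfrak g_0$ is given by $A\in\mathfrak{sl}(2;\mathbb C)$, $B=0$. The prolong $\mathfrak g_*=(\mathfrak g_-,\mathfrak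 h)_*$ of a pair $(\mathfrak g_-,\mathfrak h)$, with $\mathfrak h$ acting faithfully on $\mathfrak g_-$ by derivations of degree $0$, is the $\mathbb Z$-graded Lie superalgebra with negative part $\mathfrak g_-$ and component $\mathfrak h$ of degree $0$ in which, for every $k>0$, the map $z\mapsto[z,\cdot\,]$ identifies the component of degree $k$ with the space of all superderivations of degree $k$ of $\mathfrak g_-$ with values in the sum of the components of degree $<k$. $H^2(\mathfrak g_-;\mathfrak g_*)$ denotes the Lie superalgebra cohomology over $\mathbb R$ (cochains of both parities), graded by degree; it is a module over $\mathfrak g_0$, respectively $\mathfrak g_0'$. A *highest weight vector* is a nonzero vector annihilated by all elements with strictly upper triangular $A$ which is an eigenvector of all elements with real diagonal $A$. The space of highest weight vectors of the module is its subspace of vectors annihilated by all elements with strictly upper triangular $A$. $A_{i,j}$, $Q_{1,j}$, $R_{1,j}$, $T_{i,j}$ are the matrix units of the respective blocks (an element of $\mathfrak g$ is named by its independent blocks; thus $zA_{i,j}$ with $z\in\mathbb C$ comes with the corresponding $B$). Put $S=T_{1,2}+T_{2,1}$, $K=i(T_{1,2}-T_{2,1})$. Stars denote the real basis of $\mathfrak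 g_-^*$ dual to the basis $Q_{1,1},iQ_{1,1},Q_{1,2},iQ_{1,2},T_{1,1},T_{2,2},S,K$ of $\mathfrak g_-$. All tensor products are over $\mathbb R$; $X\otimes\omega$ is the cochain $(x,y)\mapsto\omega(x,y)X$. The product $\alpha\wedge\beta$ is $\alpha(x)\beta(y)+\alpha(y)\beta(x)$ if $\alpha,\beta$ are both supported on $\mathfrak g_{-1}$ (so $(\alpha^{\wedge2})(x,y)=2\alpha(x)\alpha(y)$), it is $\alpha(x)\beta(y)-\alpha(y)\beta(x)$ if both are supported on $\mathfrak g_{-2}$, and it is $\alpha(y)\beta(x)-\alpha(x)\beta(y)$ if $\alpha$ is supported on $\mathfrak g_{-1}$ and $\beta$ on $\mathfrak g_{-2}$. **Theorem.** **1) Conformal case.** The prolong $\mathfrak g_*=(\mathfrak g_-,\mathfrak g_0)_*$ is $\mathfrak g$. The following $c^d_j$ are highest weight 2-cocycles of degree $d$; their classes form a basis of the space of highest weight vectors of $H^2(\mathfrak g_-;\mathfrak g_*)$ and generate $H^2(\mathfrak g_-;\mathfrak g_*)$ as a $\mathfrak g_0$-module. In particular, there are none in degrees $1$ and $2$. $$\begin{aligned}c_1^0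 ={}& T_{2,2}\otimes (Q_{1,1}^*)^{\wedge 2}\end{aligned}$$ $$\begin{aligned}c_2^0 ={}& T_{2,2}\otimes (Q_{1,1}^*\wedge (iQ_{1,1})^*)\end{aligned}$$ $$\begin{aligned}c_8^3 ={}& 4Q_{1,2}\otimes (T_{1,1}^*\wedge S^*) + i(A_{1,1}-A_{2,2})\otimes ((iQ_{1,1})^*\wedge T_{1,1}^*) + i(A_{1,1}+A_{2,2})\otimes ((iQ_{1,1})^*\wedge T_{1,1}^*) - 4A_{1,2}\otimes (Q_{1,1}^*\wedge S^*)\\ & + 2A_{1,2}\otimes ((iQ_{1,1})^*\wedge K^*) + 4A_{1,2}\otimes (Q_{1,2}^*\wedge T_{1,1}^*) + 2iA_{1,2}\otimes ((iQ_{1,1})^*\wedge S^*) - 2iR_{1,1}\otimes (Q_{1,1}^*\wedge (iQ_{1,1})^*)\\ & + 2R_{1,1}\otimes ((iQ_{1,1})^*)^{\wedge 2}\end{aligned}$$ $$\begin{aligned}c_9^3 ={}& 4iQ_{1,2}\otimes (T_{1,1}^*\wedge S^*) - i(A_{1,1}-A_{2,2})\otimes (Q_{1,1}^*\wedge T_{1,1}^*)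 - i(A_{1,1}+A_{2,2})\otimes (Q_{1,1}^*\wedge T_{1,1}^*) - 2A_{1,2}\otimes (Q_{1,1}^*\wedge K^*)\\ & - 4A_{1,2}\otimes ((iQ_{1,1})^*\wedge S^*) + 4A_{1,2}\otimes ((iQ_{1,2})^*\wedge T_{1,1}^*) - 2iA_{1,2}\otimes (Q_{1,1}^*\wedge S^*) + 2iR_{1,1}\otimes (Q_{1,1}^*)^{\wedge 2}\\ & - 2R_{1,1}\otimes (Q_{1,1}^*\wedge (iQ_{1,1})^*)\end{aligned}$$ **2) Reduced case.** The prolong of $(\mathfrak g_-,\mathfrak g_0')$ is $\mathfrak g_*=\mathfrak g_-\oplus\mathfrak g_0'$; in particular $\mathfrak g_1=0$. The following $c^d_j$ are highest weight 2-cocycles of degree $d$; their classes form a basis of the space of highest weight vectors of $H^2(\mathfrak g_-;\mathfrak g_*)$ and generate $H^2(\mathfrak g_-;\mathfrak g_*)$ as a $\mathfrak g_0'$-module: $c_1^0$ and $c_2^0$ given by the same formulas as in 1), and $$\begin{aligned}c_3^1 ={}& -Q_{1,1}\otimes (Q_{1,1}^*\wedge (iQ_{1,1})^*) + iQ_{1,1}\otimes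 (Q_{1,1}^*)^{\wedge 2} - Q_{1,2}\otimes (Q_{1,1}^*\wedge (iQ_{1,2})^*) + iQ_{1,2}\otimes (Q_{1,1}^*\wedge Q_{1,2}^*)\end{aligned}$$ $$\begin{aligned}c_4^1 ={}& -Q_{1,1}\otimes ((iQ_{1,1})^*)^{\wedge 2} + iQ_{1,1}\otimes (Q_{1,1}^*\wedge (iQ_{1,1})^*) - Q_{1,2}\otimes ((iQ_{1,1})^*\wedge (iQ_{1,2})^*) + iQ_{1,2}\otimes ((iQ_{1,1})^*\wedge Q_{1,2}^*)\end{aligned}$$ $$\begin{aligned}c_5^2 ={}& -i(A_{1,1}-A_{2,2})\otimes (Q_{1,1}^*)^{\wedge 2} - i(A_{1,1}-A_{2,2})\otimes ((iQ_{1,1})^*)^{\wedge 2} + 2A_{1,2}\otimes (Q_{1,1}^*\wedge (iQ_{1,2})^*) - 2A_{1,2}\otimes ((iQ_{1,1})^*\wedge Q_{1,2}^*)\\ & - 2iA_{1,2}\otimes (Q_{1,1}^*\wedge Q_{1,2}^*) - 2iA_{1,2}\otimes ((iQ_{1,1})^*\wedge (iQ_{1,2})^*) - Q_{1,1}\otimes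 ((iQ_{1,1})^*\wedge T_{1,1}^*) + iQ_{1,1}\otimes (Q_{1,1}^*\wedge T_{1,1}^*)\\ & + 2Q_{1,2}\otimes (Q_{1,1}^*\wedge K^*) + 2Q_{1,2}\otimes ((iQ_{1,1})^*\wedge S^*) - 3Q_{1,2}\otimes ((iQ_{1,2})^*\wedge T_{1,1}^*) - 2iQ_{1,2}\otimes (Q_{1,1}^*\wedge S^*)\\ & + 2iQ_{1,2}\otimes ((iQ_{1,1})^*\wedge K^*) + 3iQ_{1,2}\otimes (Q_{1,2}^*\wedge T_{1,1}^*)\end{aligned}$$ $$\begin{aligned}c_6^2 ={}& (A_{1,1}-A_{2,2})\otimes (Q_{1,1}^*\wedge Q_{1,2}^*) - (A_{1,1}-A_{2,2})\otimes ((iQ_{1,1})^*\wedge (iQ_{1,2})^*) + i(A_{1,1}-A_{2,2})\otimes (Q_{1,1}^*\wedge (iQ_{1,2})^*) + i(A_{1,1}-A_{2,2})\otimes ((iQ_{1,1})^*\wedge Q_{1,2}^*)\\ & + A_{1,2}\otimes (Q_{1,2}^*)^{\wedge 2} - A_{1,2}\otimes ((iQ_{1,2})^*)^{\wedge 2} +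 2iA_{1,2}\otimes (Q_{1,2}^*\wedge (iQ_{1,2})^*) - A_{2,1}\otimes (Q_{1,1}^*)^{\wedge 2}\\ & + A_{2,1}\otimes ((iQ_{1,1})^*)^{\wedge 2} - 2iA_{2,1}\otimes (Q_{1,1}^*\wedge (iQ_{1,1})^*) + Q_{1,1}\otimes (Q_{1,1}^*\wedge S^*) - Q_{1,1}\otimes ((iQ_{1,1})^*\wedge K^*)\\ & - Q_{1,1}\otimes (Q_{1,2}^*\wedge T_{1,1}^*) - iQ_{1,1}\otimes (Q_{1,1}^*\wedge K^*) - iQ_{1,1}\otimes ((iQ_{1,1})^*\wedge S^*) + iQ_{1,1}\otimes ((iQ_{1,2})^*\wedge T_{1,1}^*)\\ & + Q_{1,2}\otimes (Q_{1,1}^*\wedge T_{2,2}^*) - Q_{1,2}\otimes (Q_{1,2}^*\wedge S^*) - Q_{1,2}\otimes ((iQ_{1,2})^*\wedge K^*) - iQ_{1,2}\otimes ((iQ_{1,1})^*\wedge T_{2,2}^*)\\ & - iQ_{1,2}\otimes (Q_{1,2}^*\wedge K^*) + iQ_{1,2}\otimes ((iQ_{1,2})^*\wedge S^*)\end{aligned}$$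 $$\begin{aligned}c_7^2 ={}& -(A_{1,1}-A_{2,2})\otimes (Q_{1,1}^*\wedge (iQ_{1,2})^*) - (A_{1,1}-A_{2,2})\otimes ((iQ_{1,1})^*\wedge Q_{1,2}^*) + i(A_{1,1}-A_{2,2})\otimes (Q_{1,1}^*\wedge Q_{1,2}^*) - i(A_{1,1}-A_{2,2})\otimes ((iQ_{1,1})^*\wedge (iQ_{1,2})^*)\\ & - 2A_{1,2}\otimes (Q_{1,2}^*\wedge (iQ_{1,2})^*) + iA_{1,2}\otimes (Q_{1,2}^*)^{\wedge 2} - iA_{1,2}\otimes ((iQ_{1,2})^*)^{\wedge 2} + 2A_{2,1}\otimes (Q_{1,1}^*\wedge (iQ_{1,1})^*)\\ & - iA_{2,1}\otimes (Q_{1,1}^*)^{\wedge 2} + iA_{2,1}\otimes ((iQ_{1,1})^*)^{\wedge 2} - Q_{1,1}\otimes (Q_{1,1}^*\wedge K^*) - Q_{1,1}\otimes ((iQ_{1,1})^*\wedge S^*)\\ & + Q_{1,1}\otimes ((iQ_{1,2})^*\wedge T_{1,1}^*) - iQ_{1,1}\otimes (Q_{1,1}^*\wedge S^*) + iQ_{1,1}\otimes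 ((iQ_{1,1})^*\wedge K^*) + iQ_{1,1}\otimes (Q_{1,2}^*\wedge T_{1,1}^*)\\ & - Q_{1,2}\otimes ((iQ_{1,1})^*\wedge T_{2,2}^*) - Q_{1,2}\otimes (Q_{1,2}^*\wedge K^*) + Q_{1,2}\otimes ((iQ_{1,2})^*\wedge S^*) - iQ_{1,2}\otimes (Q_{1,1}^*\wedge T_{2,2}^*)\\ & + iQ_{1,2}\otimes (Q_{1,2}^*\wedge S^*) + iQ_{1,2}\otimes ((iQ_{1,2})^*\wedge K^*)\end{aligned}$$ $$\begin{aligned}c_8^3 ={}& -A_{1,2}\otimes (Q_{1,1}^*\wedge K^*) - A_{1,2}\otimes ((iQ_{1,1})^*\wedge S^*) + A_{1,2}\otimes ((iQ_{1,2})^*\wedge T_{1,1}^*) - iA_{1,2}\otimes (Q_{1,1}^*\wedge S^*)\\ & + iA_{1,2}\otimes ((iQ_{1,1})^*\wedge K^*) + iA_{1,2}\otimes (Q_{1,2}^*\wedge T_{1,1}^*) + Q_{1,2}\otimes (T_{1,1}^*\wedge K^*) + iQ_{1,2}\otimes (T_{1,1}^*\wedge S^*)\end{aligned}$$ $$\begin{aligned}c_9^3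 ={}& A_{1,2}\otimes (Q_{1,1}^*\wedge S^*) - A_{1,2}\otimes ((iQ_{1,1})^*\wedge K^*) - A_{1,2}\otimes (Q_{1,2}^*\wedge T_{1,1}^*) - iA_{1,2}\otimes (Q_{1,1}^*\wedge K^*)\\ & - iA_{1,2}\otimes ((iQ_{1,1})^*\wedge S^*) + iA_{1,2}\otimes ((iQ_{1,2})^*\wedge T_{1,1}^*) - Q_{1,2}\otimes (T_{1,1}^*\wedge S^*) + iQ_{1,2}\otimes (T_{1,1}^*\wedge K^*)\end{aligned}$$ -/

import Mathlib

noncomputable section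

namespace MinkowskiSuper

/-! ## Supermatrices of format `2|1|2` and their bracket -/

/-- Rows and columns of supermatrices of format `2|1|2`. -/
abbrev Idx : Type := Fin 2 ⊕ (Fin 1 ⊕ Fin 2)

/-- The number of the block to which an index belongs. -/
def blk : Idx → ℤ
  | .inl _ => 0
  | .inr (.inl _) => 1
  | .inr (.inr _) => 2

/-- The block-diagonal-wise degree of a matrix position: the blocks on the diagonal have degree
`0`, the one in position `(3,1)` has degree `-2`, the one in position `(1,3)` has degree `2`. -/
def eDeg (i j : Idx) : ℤ := blk j - blk i

/-- Complex supermatrices of format `2|1|2`, always regarded as a real vector space. -/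
abbrev SMat : Type := Matrix Idx Idx ℂ

/-- `X` is homogeneous of degree `k`. -/
def HasDeg (k : ℤ) (X : SMat) : Prop := ∀ i j, eDeg i j ≠ k → X i j = 0

/-- `X` is homogeneous of parity `p`; the parity is the degree modulo 2. -/
def HasPar (p : ZMod 2) (X : SMat) : Prop := ∀ i j, ((eDeg i j : ℤ) : ZMod 2) ≠ p → X i j = 0

/-- The component of degree `k` of a supermatrix. -/
def degPart (k : ℤ) (X : SMat) : SMat :=
  Matrix.of fun i j => if eDeg i j = k then X i j else 0

/-- The odd component of a supermatrix. -/
def oddPart : SMat →ₗ[ℝ] SMat where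
  toFun X := Matrix.of fun i j => if ((eDeg i j : ℤ) : ZMod 2) = 1 then X i j else 0
  map_add' X Y := by
    ext i j
    simp only [Matrix.of_apply, Matrix.add_apply]
    split_ifs <;> simp
  map_smul' r X := by
    ext i j
    simp only [Matrix.of_apply, Matrix.smul_apply, RingHom.id_apply]
    split_ifs <;> simp

/-- The Koszul sign `(-1)^{p q}`. -/
def ksgn (p q : ZMod 2) : ℝ := if p = 1 ∧ q = 1 then -1 else 1

/-- The superbracket, `[X, Y] = X Y - (-1)^{p(X) p(Y)} Y X` for homogeneous `X` and `Y`
(see `sb_of_hasPar`). -/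
def sb : SMat →ₗ[ℝ] SMat →ₗ[ℝ] SMat :=
  LinearMap.mk₂ ℝ (fun X Y => X * Y - Y * X + (2 : ℝ) • (oddPart Y * oddPart X))
    (fun X X' Y => by simp only [map_add, mul_add, add_mul, smul_add]; abel)
    (fun r X Y => by
      simp only [map_smul, smul_mul_assoc, mul_smul_comm, smul_add, smul_sub, smul_comm r (2 : ℝ)])
    (fun X Y Y' => by simp only [map_add, mul_add, add_mul, smul_add]; abel)
    (fun r X Y => by
      simp only [map_smul, smul_mul_assoc, mul_smul_comm, smul_add, smul_sub, smul_comm r (2 : ℝ)])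

theorem sb_apply (X Y : SMat) :
    sb X Y = X * Y - Y * X + (2 : ℝ) • (oddPart Y * oddPart X) := rfl

theorem oddPart_of_even {X : SMat} (h : HasPar 0 X) : oddPart X = 0 := by
  ext i j
  simp only [oddPart, LinearMap.coe_mk, AddHom.coe_mk, Matrix.of_apply, Matrix.zero_apply]
  split_ifs with h1
  · exact h i j (by rw [h1]; decide)
  · rfl

theorem oddPart_of_odd {X : SMat} (h : HasPar 1 X) : oddPart X = X := by
  ext i j
  simp only [oddPart, LinearMap.coe_mk, AddHom.coe_mk, Matrix.of_apply]
  split_ifs with h1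
  · rfl
  · exact (h i j h1).symm

theorem sb_of_hasPar {p q : ZMod 2} {X Y : SMat} (hX : HasPar p X) (hY : HasPar q Y) :
    sb X Y = X * Y - ksgn p q • (Y * X) := by
  rw [sb_apply]
  have key : ∀ r : ZMod 2, r = 0 ∨ r = 1 := by decide
  rcases key p with rfl | rfl <;> rcases key q with rfl | rfl <;>
    simp [oddPart_of_even, oddPart_of_odd, hX, hY, ksgn, two_smul]

/-! ## Graded real Lie subsuperalgebras -/

/-- A `ℤ`-graded real Lie subsuperalgebra of the Lie superalgebra of all supermatrices of format
`2|1|2`. -/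
structure GSub where
  carrier : Submodule ℝ SMat
  sb_mem : ∀ X ∈ carrier, ∀ Y ∈ carrier, sb X Y ∈ carrier
  degPart_mem : ∀ X ∈ carrier, ∀ k, degPart k X ∈ carrier

/-- The underlying real vector space of a graded subsuperalgebra. -/
abbrev GSub.Sp (g : GSub) : Type := ↥g.carrier

instance GSub.instSp (g : GSub) : AddCommGroup g.Sp := Submodule.addCommGroup _

/-- The homogeneous component of degree `k`. -/
def piece (g : GSub) (k : ℤ) : Submodule ℝ SMat where
  carrier := {X | X ∈ g.carrier ∧ HasDeg k X}
  add_mem' {X Y} hX hY := ⟨g.carrier.add_mem hX.1 hY.1, fun i j h => by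
    simp [hX.2 i j h, hY.2 i j h]⟩
  zero_mem' := ⟨g.carrier.zero_mem, fun _ _ _ => rfl⟩
  smul_mem' r X hX := ⟨g.carrier.smul_mem r hX.1, fun i j h => by simp [hX.2 i j h]⟩

/-- The negative part `g_-`, the sum of the components of negative degree. -/
def neg (g : GSub) : Submodule ℝ SMat where
  carrier := {X | X ∈ g.carrier ∧ ∀ i j, 0 ≤ eDeg i j → X i j = 0}
  add_mem' {X Y} hX hY := ⟨g.carrier.add_mem hX.1 hY.1, fun i j h => by
    simp [hX.2 i j h, hY.2 i j h]⟩
  zero_mem' := ⟨g.carrier.zero_mem, fun _ _ _ => rfl⟩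
  smul_mem' r X hX := ⟨g.carrier.smul_mem r hX.1, fun i j h => by simp [hX.2 i j h]⟩

theorem eDeg_add (i k j : Idx) : eDeg i k + eDeg k j = eDeg i j := by
  simp only [eDeg]; ring

theorem oddPart_zero_of {X : SMat} {i j : Idx} (h : X i j = 0) : oddPart X i j = 0 := by
  simp [oddPart, h]

theorem mul_entry_zero {X Y : SMat} {i j : Idx} (h : ∀ k, X i k = 0 ∨ Y k j = 0) :
    (X * Y) i j = 0 := by
  rw [Matrix.mul_apply]
  refine Finset.sum_eq_zero fun k _ => ?_
  rcases h k with h | h <;> simp [h]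

theorem sb_entry_zero {X Y : SMat} {i j : Idx} (h1 : ∀ k, X i k = 0 ∨ Y k j = 0)
    (h2 : ∀ k, Y i k = 0 ∨ X k j = 0) : sb X Y i j = 0 := by
  rw [sb_apply]
  have h3 : (oddPart Y * oddPart X) i j = 0 :=
    mul_entry_zero fun k => (h2 k).imp oddPart_zero_of oddPart_zero_of
  simp [mul_entry_zero h1, mul_entry_zero h2, h3]

theorem sb_mem_neg (g : GSub) {X Y : SMat} (hX : X ∈ neg g) (hY : Y ∈ neg g) :
    sb X Y ∈ neg g := by
  refine ⟨g.sb_mem X hX.1 Y hY.1, fun i j h => sb_entry_zero (fun k => ?_) (fun k => ?_)⟩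
  · have e := eDeg_add i k j
    by_cases h1 : 0 ≤ eDeg i k
    · exact .inl (hX.2 i k h1)
    · exact .inr (hY.2 k j (by omega))
  · have e := eDeg_add i k j
    by_cases h1 : 0 ≤ eDeg i k
    · exact .inl (hY.2 i k h1)
    · exact .inr (hX.2 k j (by omega))

theorem sb_zero_mem_neg (g : GSub) {h X : SMat} (hh : h ∈ piece g 0) (hX : X ∈ neg g) :
    sb h X ∈ neg g := by
  refine ⟨g.sb_mem h hh.1 X hX.1, fun i j hij => sb_entry_zero (fun k => ?_) (fun k => ?_)⟩
  · have e := eDeg_add i k j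
    by_cases h1 : eDeg i k = 0
    · exact .inr (hX.2 k j (by omega))
    · exact .inl (hh.2 i k h1)
  · have e := eDeg_add i k j
    by_cases h1 : eDeg k j = 0
    · exact .inl (hX.2 i k (by omega))
    · exact .inr (hh.2 k j h1)

/-- The bracket of the negative part. -/
def nbr (g : GSub) (x y : ↥(neg g)) : ↥(neg g) := ⟨sb x y, sb_mem_neg g x.2 y.2⟩

/-- The adjoint action of `g_0` on `g`. -/
def adG (g : GSub) (h : ↥(piece g 0)) : g.Sp →ₗ[ℝ] g.Sp :=
  (sb (h : SMat)).restrict fun X hX => g.sb_mem h h.2.1 X hX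

/-- The adjoint action of `g_0` on `g_-`. -/
def adN (g : GSub) (h : ↥(piece g 0)) : ↥(neg g) →ₗ[ℝ] ↥(neg g) :=
  (sb (h : SMat)).restrict fun _ hX => sb_zero_mem_neg g h.2 hX

/-! ## The cohomology `H²(g_-; g)` -/

/-- 1-cochains. -/
abbrev C1 (g : GSub) : Type := ↥(neg g) →ₗ[ℝ] g.Sp

/-- Bilinear maps `g_- × g_- → g`. -/
abbrev Bil (g : GSub) : Type := ↥(neg g) →ₗ[ℝ] ↥(neg g) →ₗ[ℝ] g.Sp

instance instBil (g : GSub) : AddCommGroup (Bil g) := LinearMap.addCommGroup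

/-- The differential of a 1-cochain on homogeneous elements `x`, `y` of parities `p`, `q`. As the
values of a cochain are put to the left of its arguments, the signs do not involve the parity of
the cochain; for `f` homogeneous, `[f x, y] - (-1)^{p q} [f y, x]` is the usual
`(-1)^{p(f) p} [x, f y] - (-1)^{(p(f) + p) q} [y, f x]`. -/
def d1 (g : GSub) (f : C1 g) (p q : ZMod 2) (x y : ↥(neg g)) : SMat :=
  sb (f x) y - ksgn p q • sb (f y) x - (f (nbr g x y) : SMat)

/-- An auxiliary term of the differential of a 2-cochain. -/
def dTerm (g : GSub) (c : Bil g) (x y z : ↥(neg g)) : SMat :=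
  sb (c x y) z + (c (nbr g x y) z : SMat)

/-- Minus the differential of a 2-cochain on homogeneous elements `x`, `y`, `z` of parities
`p`, `q`, `r`. -/
def d2 (g : GSub) (c : Bil g) (p q r : ZMod 2) (x y z : ↥(neg g)) : SMat :=
  dTerm g c x y z - ksgn q r • dTerm g c x z y + ksgn p (q + r) • dTerm g c y z x

/-- 2-cochains: the superantisymmetric bilinear maps. -/
def IsCochain (g : GSub) (c : Bil g) : Prop :=
  ∀ (p q : ZMod 2) (x y : ↥(neg g)), HasPar p x → HasPar q y → c x y = -(ksgn p q • c y x)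

/-- 2-cocycles of `g_-` with values in the adjoint module `g` (of all degrees and parities). -/
def Z2 (g : GSub) : Submodule ℝ (Bil g) where
  carrier := {c | IsCochain g c ∧ ∀ (p q r : ZMod 2) (x y z : ↥(neg g)),
    HasPar p x → HasPar q y → HasPar r z → d2 g c p q r x y z = 0}
  add_mem' {c c'} hc hc' := by
    refine ⟨fun p q x y hx hy => ?_, fun p q r x y z hx hy hz => ?_⟩
    · have e := hc.1 p q x y hx hy
      have e' := hc'.1 p q x y hx hy
      simp only [LinearMap.add_apply, e, e', smul_add]
      abel
    · have e := hc.2 p q r x y z hx hy hz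
      have e' := hc'.2 p q r x y z hx hy hz
      rw [← add_zero (0 : SMat)]
      nth_rewrite 1 [← e]
      rw [← e']
      simp only [d2, dTerm, LinearMap.add_apply, Submodule.coe_add, map_add, smul_add]
      abel
  zero_mem' := by
    refine ⟨fun p q x y _ _ => ?_, fun p q r x y z _ _ _ => ?_⟩
    · simp
    · simp [d2, dTerm]
  smul_mem' t c hc := by
    refine ⟨fun p q x y hx hy => ?_, fun p q r x y z hx hy hz => ?_⟩
    · have e := hc.1 p q x y hx hy
      simp only [LinearMap.smul_apply]
      rw [e, smul_neg, smul_comm]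
    · have e := hc.2 p q r x y z hx hy hz
      have e2 : d2 g (t • c) p q r x y z = t • d2 g c p q r x y z := by
        simp only [d2, dTerm, LinearMap.smul_apply, Submodule.coe_smul, map_smul, smul_add,
          smul_sub]
        simp only [smul_comm _ t]
      rw [e2, e, smul_zero]

/-- 2-coboundaries. -/
def B2 (g : GSub) : Submodule ℝ (Bil g) where
  carrier := {c | ∃ f : C1 g, ∀ (p q : ZMod 2) (x y : ↥(neg g)), HasPar p x → HasPar q y →
    (c x y : SMat) = d1 g f p q x y}
  add_mem' := by
    rintro c c' ⟨f, hf⟩ ⟨f', hf'⟩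
    refine ⟨f + f', fun p q x y hx hy => ?_⟩
    simp only [LinearMap.add_apply, Submodule.coe_add, hf p q x y hx hy, hf' p q x y hx hy, d1,
      map_add, smul_add]
    abel
  zero_mem' := ⟨0, fun p q x y _ _ => by simp [d1]⟩
  smul_mem' := by
    rintro t c ⟨f, hf⟩
    refine ⟨t • f, fun p q x y hx hy => ?_⟩
    simp only [LinearMap.smul_apply, Submodule.coe_smul, hf p q x y hx hy, d1, map_smul, smul_sub,
      smul_comm _ t]

/-- The cohomology space `H²(g_-; g)`. -/
abbrev H2 (g : GSub) : Type := ↥(Z2 g) ⧸ (B2 g).submoduleOf (Z2 g)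

/-- The cohomology class of a cocycle. -/
def cls (g : GSub) : ↥(Z2 g) →ₗ[ℝ] H2 g := ((B2 g).submoduleOf (Z2 g)).mkQ

/-! ## The action of `g_0` -/

/-- The action of `g_0` on 2-cochains:
`(h c)(x, y) = [h, c(x, y)] - c([h, x], y) - c(x, [h, y])`; elements of `g_0` are even. -/
def act (g : GSub) (h : ↥(piece g 0)) : Bil g →ₗ[ℝ] Bil g where
  toFun c := c.compr₂ (adG g h) - c.comp (adN g h) - c.compl₂ (adN g h)
  map_add' c c' := by
    ext x y : 2
    simp only [LinearMap.sub_apply, LinearMap.compr₂_apply, LinearMap.comp_apply,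
      LinearMap.compl₂_apply, LinearMap.add_apply, map_add]
    abel
  map_smul' t c := by
    ext x y : 2
    simp only [LinearMap.sub_apply, LinearMap.compr₂_apply, LinearMap.comp_apply,
      LinearMap.compl₂_apply, LinearMap.smul_apply, map_smul, RingHom.id_apply, smul_sub]

theorem act_apply (g : GSub) (h : ↥(piece g 0)) (c : Bil g) (x y : ↥(neg g)) :
    act g h c x y = adG g h (c x y) - c (adN g h x) y - c x (adN g h y) := rfl

theorem even_of_deg_zero {h : SMat} (hh : HasDeg 0 h) : HasPar 0 h := by
  intro i j hij
  refine hh i j fun h0 => hij ?_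
  rw [h0]; simp

theorem sb_even {h : SMat} (hh : HasPar 0 h) (X : SMat) : sb h X = h * X - X * h := by
  rw [sb_apply, oddPart_of_even hh]; simp

theorem hasPar_sb_even {h X : SMat} {p : ZMod 2} (hh : HasPar 0 h) (hX : HasPar p X) :
    HasPar p (sb h X) := by
  intro i j hij
  refine sb_entry_zero (fun k => ?_) (fun k => ?_)
  · by_cases h1 : ((eDeg i k : ℤ) : ZMod 2) = 0
    · refine .inr (hX k j fun h2 => hij ?_)
      rw [← eDeg_add i k j, Int.cast_add, h1, h2, zero_add]
    · exact .inl (hh i k h1)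
  · by_cases h1 : ((eDeg k j : ℤ) : ZMod 2) = 0
    · refine .inl (hX i k fun h2 => hij ?_)
      rw [← eDeg_add i k j, Int.cast_add, h1, h2, add_zero]
    · exact .inr (hh k j h1)

theorem oddPart_even_mul {h : SMat} (hh : HasPar 0 h) (X : SMat) :
    oddPart (h * X) = h * oddPart X := by
  ext i j
  simp only [oddPart, LinearMap.coe_mk, AddHom.coe_mk, Matrix.of_apply, Matrix.mul_apply]
  have key : ∀ k, h i k * (if ((eDeg k j : ℤ) : ZMod 2) = 1 then X k j else 0) =
      if ((eDeg i j : ℤ) : ZMod 2) = 1 then h i k * X k j else 0 := by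
    intro k
    by_cases h1 : ((eDeg i k : ℤ) : ZMod 2) = 0
    · have e : ((eDeg i j : ℤ) : ZMod 2) = ((eDeg k j : ℤ) : ZMod 2) := by
        rw [← eDeg_add i k j, Int.cast_add, h1, zero_add]
      rw [e]; split_ifs <;> simp
    · rw [hh i k h1]; simp
  simp only [key]
  split_ifs <;> simp

theorem oddPart_mul_even {h : SMat} (hh : HasPar 0 h) (X : SMat) :
    oddPart (X * h) = oddPart X * h := by
  ext i j
  simp only [oddPart, LinearMap.coe_mk, AddHom.coe_mk, Matrix.of_apply, Matrix.mul_apply]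
  have key : ∀ k, (if ((eDeg i k : ℤ) : ZMod 2) = 1 then X i k else 0) * h k j =
      if ((eDeg i j : ℤ) : ZMod 2) = 1 then X i k * h k j else 0 := by
    intro k
    by_cases h1 : ((eDeg k j : ℤ) : ZMod 2) = 0
    · have e : ((eDeg i j : ℤ) : ZMod 2) = ((eDeg i k : ℤ) : ZMod 2) := by
        rw [← eDeg_add i k j, Int.cast_add, h1, add_zero]
      rw [e]; split_ifs <;> simp
    · rw [hh k j h1]; simp
  simp only [key]
  split_ifs <;> simp

/-- The Jacobi identity with one even entry. -/
theorem sb_even_sb {h : SMat} (hh : HasPar 0 h) (X Y : SMat) :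
    sb h (sb X Y) = sb (sb h X) Y + sb X (sb h Y) := by
  rw [sb_even hh, sb_even hh X, sb_even hh Y, sb_apply X Y, sb_apply _ Y, sb_apply X]
  simp only [map_sub, oddPart_even_mul hh, oddPart_mul_even hh, mul_add, add_mul, mul_sub, sub_mul,
    smul_mul_assoc, mul_smul_comm, smul_sub, mul_assoc]
  abel

theorem adN_nbr (g : GSub) (h : ↥(piece g 0)) (x y : ↥(neg g)) :
    adN g h (nbr g x y) = nbr g (adN g h x) y + nbr g x (adN g h y) :=
  Subtype.ext (sb_even_sb (even_of_deg_zero h.2.2) _ _)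

theorem hasPar_adN (g : GSub) (h : ↥(piece g 0)) {p : ZMod 2} {x : ↥(neg g)}
    (hx : HasPar p x) : HasPar p (adN g h x) :=
  hasPar_sb_even (even_of_deg_zero h.2.2) hx

theorem dTerm_act (g : GSub) (h : ↥(piece g 0)) (c : Bil g) (x y z : ↥(neg g)) :
    dTerm g (act g h c) x y z = sb (h : SMat) (dTerm g c x y z) - dTerm g c (adN g h x) y z
      - dTerm g c x (adN g h y) z - dTerm g c x y (adN g h z) := by
  have hh := even_of_deg_zero h.2.2
  have e1 : ∀ X : g.Sp, ((adG g h X : g.Sp) : SMat) = sb (h : SMat) X := fun _ => rfl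
  have e2 : ∀ X : ↥(neg g), ((adN g h X : ↥(neg g)) : SMat) = sb (h : SMat) X := fun _ => rfl
  simp only [dTerm, act_apply, adN_nbr, map_add, map_sub, LinearMap.sub_apply,
    LinearMap.add_apply, Submodule.coe_sub, Submodule.coe_add, e1, e2, sb_even_sb hh]
  abel

theorem act_mem_Z2 (g : GSub) (h : ↥(piece g 0)) {c : Bil g} (hc : c ∈ Z2 g) :
    act g h c ∈ Z2 g := by
  refine ⟨fun p q x y hx hy => ?_, fun p q r x y z hx hy hz => ?_⟩
  · rw [act_apply, act_apply, hc.1 p q x y hx hy, hc.1 p q _ y (hasPar_adN g h hx) hy,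
      hc.1 p q x _ hx (hasPar_adN g h hy)]
    simp only [map_neg, map_smul, smul_sub]
    abel
  · have e0 := hc.2 p q r x y z hx hy hz
    have e1 := hc.2 p q r _ y z (hasPar_adN g h hx) hy hz
    have e2 := hc.2 p q r x _ z hx (hasPar_adN g h hy) hz
    have e3 := hc.2 p q r x y _ hx hy (hasPar_adN g h hz)
    have e : d2 g (act g h c) p q r x y z = sb (h : SMat) (d2 g c p q r x y z)
        - d2 g c p q r (adN g h x) y z - d2 g c p q r x (adN g h y) z
        - d2 g c p q r x y (adN g h z) := by
      simp only [d2, dTerm_act, map_add, map_sub, map_smul, smul_sub]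
      abel
    rw [e, e0, e1, e2, e3]; simp

theorem act_mem_B2 (g : GSub) (h : ↥(piece g 0)) {c : Bil g} (hc : c ∈ B2 g) :
    act g h c ∈ B2 g := by
  obtain ⟨f, hf⟩ := hc
  refine ⟨(adG g h).comp f - f.comp (adN g h), fun p q x y hx hy => ?_⟩
  have hh := even_of_deg_zero h.2.2
  have e1 : ∀ X : g.Sp, ((adG g h X : g.Sp) : SMat) = sb (h : SMat) X := fun _ => rfl
  have e2 : ∀ X : ↥(neg g), ((adN g h X : ↥(neg g)) : SMat) = sb (h : SMat) X := fun _ => rfl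
  rw [act_apply, Submodule.coe_sub, Submodule.coe_sub, hf p q _ y (hasPar_adN g h hx) hy,
    hf p q x _ hx (hasPar_adN g h hy), e1, hf p q x y hx hy]
  simp only [d1, LinearMap.sub_apply, LinearMap.comp_apply, Submodule.coe_sub, e1, e2, adN_nbr,
    map_add, map_sub, map_smul, Submodule.coe_add, smul_sub, sb_even_sb hh, smul_add]
  abel

/-- The action of `g_0` on `H²(g_-; g)`. -/
def actH (g : GSub) (h : ↥(piece g 0)) : H2 g →ₗ[ℝ] H2 g :=
  Submodule.mapQ _ _ ((act g h).restrict fun _ hc => act_mem_Z2 g h hc)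
    fun _ hc => act_mem_B2 g h hc

/-! ## Prolongs and highest weight cocycles -/

/-- `g` is the (generalized) Cartan prolong of the pair `(g_-, g_0)`: the algebra `g_0` acts
faithfully on `g_-`, and for every `k > 0` the map `z ↦ [z, ·]` identifies `g_k` with the space of
all superderivations of degree `k` of `g_-` with values in the sum of the `g_i`, `i < k`. -/
def IsProlong (g : GSub) : Prop :=
  (∀ z ∈ piece g 0, (∀ x : ↥(neg g), sb z x = 0) → z = 0) ∧
  ∀ k : ℤ, 0 < k → ∀ f : C1 g,
    (∀ (i : ℤ) (x : ↥(neg g)), HasDeg i x → HasDeg (i + k) (f x)) →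
    (∀ (p q : ZMod 2) (x y : ↥(neg g)), HasPar p x → HasPar q y → d1 g f p q x y = 0) →
    ∃! z : SMat, z ∈ piece g k ∧ ∀ x : ↥(neg g), (f x : SMat) = sb z x

/-- Elements of `g_0` whose block `A` is strictly upper triangular. -/
def IsRaising (h : SMat) : Prop :=
  ∀ a b : Fin 2, ¬ a < b → h (.inl a) (.inl b) = 0

/-- Elements of `g_0` whose block `A` is diagonal with real entries. -/
def IsSplitCartan (h : SMat) : Prop :=
  (∀ a b : Fin 2, a ≠ b → h (.inl a) (.inl b) = 0) ∧ ∀ a : Fin 2, (h (.inl a) (.inl a)).im = 0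

/-- A 2-cochain of degree `d`. -/
def HasCochainDeg (g : GSub) (d : ℤ) (c : Bil g) : Prop :=
  ∀ (i j : ℤ) (x y : ↥(neg g)), HasDeg i x → HasDeg j y → HasDeg (i + j + d) (c x y)

/-- `c` is a highest weight vector: it is nonzero, it is annihilated by the positive root vectors,
and it is a weight vector with respect to the split Cartan subalgebra. -/
def IsHighestWeight (g : GSub) (c : Bil g) : Prop :=
  c ≠ 0 ∧ (∀ h : ↥(piece g 0), IsRaising h → act g h c = 0) ∧
  ∃ w : ↥(piece g 0) →ₗ[ℝ] ℝ, ∀ h : ↥(piece g 0), IsSplitCartan h → act g h c = w h • c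

/-- The space of vectors of `H²(g_-; g)` annihilated by the positive root vectors of `g_0`. -/
def hwSpace (g : GSub) : Submodule ℝ (H2 g) :=
  ⨅ h : {h : ↥(piece g 0) // IsRaising h}, LinearMap.ker (actH g h.1)

/-- The `c i` are highest weight cocycles of degrees `d i`, their classes form a basis of the space
of highest weight vectors of `H²(g_-; g)`, and they generate the `g_0`-module `H²(g_-; g)`. -/
structure RepresentH2 (g : GSub) {n : ℕ} (d : Fin n → ℤ) (c : Fin n → Bil g) : Prop where
  cocycle : ∀ i, c i ∈ Z2 g
  degree : ∀ i, HasCochainDeg g (d i) (c i)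
  highestWeight : ∀ i, IsHighestWeight g (c i)
  linearIndependent : LinearIndependent ℝ fun i => cls g ⟨c i, cocycle i⟩
  span_eq : Submodule.span ℝ (Set.range fun i => cls g ⟨c i, cocycle i⟩) = hwSpace g
  generate : ∀ W : Submodule ℝ (H2 g), (∀ h, ∀ ξ ∈ W, actH g h ξ ∈ W) →
    (∀ i, cls g ⟨c i, cocycle i⟩ ∈ W) → W = ⊤

/-! ## The two superalgebras -/

/-- The supermatrix with rows of blocks `(A, R̄ᵗ, U)`, `(Q, B, R)`, `(T, -Q̄ᵗ, -Āᵗ)`. -/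
def sm (A : Matrix (Fin 2) (Fin 2) ℂ) (B : ℂ) (Q R : Fin 2 → ℂ)
    (T U : Matrix (Fin 2) (Fin 2) ℂ) : SMat :=
  Matrix.of fun i j => match i, j with
    | .inl a, .inl b => A a b
    | .inl a, .inr (.inl _) => star (R a)
    | .inl a, .inr (.inr b) => U a b
    | .inr (.inl _), .inl b => Q b
    | .inr (.inl _), .inr (.inl _) => B
    | .inr (.inl _), .inr (.inr b) => R b
    | .inr (.inr a), .inl b => T a b
    | .inr (.inr a), .inr (.inl _) => -star (Q a)
    | .inr (.inr a), .inr (.inr b) => -star (A b a)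

theorem sm_add (A A' : Matrix (Fin 2) (Fin 2) ℂ) (B B' : ℂ) (Q Q' R R' : Fin 2 → ℂ)
    (T T' U U' : Matrix (Fin 2) (Fin 2) ℂ) :
    sm A B Q R T U + sm A' B' Q' R' T' U' =
      sm (A + A') (B + B') (Q + Q') (R + R') (T + T') (U + U') := by
  ext i j
  rcases i with i | i | i <;> rcases j with j | j | j <;> simp [sm] <;> ring

theorem sm_smul (t : ℝ) (A : Matrix (Fin 2) (Fin 2) ℂ) (B : ℂ) (Q R : Fin 2 → ℂ)
    (T U : Matrix (Fin 2) (Fin 2) ℂ) :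
    t • sm A B Q R T U = sm (t • A) (t • B) (t • Q) (t • R) (t • T) (t • U) := by
  ext i j
  rcases i with i | i | i <;> rcases j with j | j | j <;> simp [sm]

theorem sm_zero : sm 0 0 0 0 0 0 = 0 := by
  ext i j
  rcases i with i | i | i <;> rcases j with j | j | j <;> simp [sm]

theorem oddPart_sm (A : Matrix (Fin 2) (Fin 2) ℂ) (B : ℂ) (Q R : Fin 2 → ℂ)
    (T U : Matrix (Fin 2) (Fin 2) ℂ) : oddPart (sm A B Q R T U) = sm 0 0 Q R 0 0 := by
  have h1 : ((-1 : ℤ) : ZMod 2) = 1 := by decide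
  have h2 : ((2 : ℤ) : ZMod 2) ≠ 1 := by decide
  have h3 : ((-2 : ℤ) : ZMod 2) ≠ 1 := by decide
  have h4 : ((0 : ℤ) : ZMod 2) ≠ 1 := by decide
  have h5 : ((1 : ℤ) : ZMod 2) = 1 := by decide
  ext i j
  rcases i with i | i | i <;> rcases j with j | j | j <;>
    simp only [oddPart, LinearMap.coe_mk, AddHom.coe_mk, Matrix.of_apply, eDeg, blk] <;>
    norm_num [sm] <;> intro h <;> exact absurd h (by decide)

theorem degPart_sm (k : ℤ) (A : Matrix (Fin 2) (Fin 2) ℂ) (B : ℂ) (Q R : Fin 2 → ℂ)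
    (T U : Matrix (Fin 2) (Fin 2) ℂ) : degPart k (sm A B Q R T U) =
      sm (if k = 0 then A else 0) (if k = 0 then B else 0) (if k = -1 then Q else 0)
        (if k = 1 then R else 0) (if k = -2 then T else 0) (if k = 2 then U else 0) := by
  ext i j
  rcases i with i | i | i <;> rcases j with j | j | j <;>
    simp only [degPart, Matrix.of_apply, eDeg, blk, sm, eq_comm (b := k)] <;> norm_num <;>
    split_ifs <;> simp

/-- The supermatrices of the conformal case: `A ∈ gl(2; ℂ)`, the `1 × 1` block `B` is
antihermitian with `tr B = tr (A - Āᵗ)`, and the blocks `T` and `U` are hermitian. -/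
def IsConf (X : SMat) : Prop :=
  ∃ (A : Matrix (Fin 2) (Fin 2) ℂ) (B : ℂ) (Q R : Fin 2 → ℂ) (T U : Matrix (Fin 2) (Fin 2) ℂ),
    star B = -B ∧ B = (A - A.conjTranspose).trace ∧ T.IsHermitian ∧ U.IsHermitian ∧
    X = sm A B Q R T U

/-- The supermatrices of the reduced case: `A ∈ sl(2; ℂ)`, `B = 0`, the block `T` is hermitian,
and there are no components of positive degree. -/
def IsRed (X : SMat) : Prop :=
  ∃ (A : Matrix (Fin 2) (Fin 2) ℂ) (Q : Fin 2 → ℂ) (T : Matrix (Fin 2) (Fin 2) ℂ),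
    A.trace = 0 ∧ T.IsHermitian ∧ X = sm A 0 Q 0 T 0

theorem sb_sm {A A' : Matrix (Fin 2) (Fin 2) ℂ} {B B' : ℂ} {Q Q' R R' : Fin 2 → ℂ}
    {T T' U U' : Matrix (Fin 2) (Fin 2) ℂ} (hB : star B = -B) (hB' : star B' = -B')
    (hT : T.IsHermitian) (hT' : T'.IsHermitian) (hU : U.IsHermitian) (hU' : U'.IsHermitian) :
    sb (sm A B Q R T U) (sm A' B' Q' R' T' U') =
      sm (A * A' - A' * A + U * T' - U' * T
          + Matrix.of fun a b => star (R a) * Q' b + star (R' a) * Q b)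
        (∑ a, (Q a * star (R' a) - R a * star (Q' a) + Q' a * star (R a) - R' a * star (Q a)))
        (fun b => B * Q' b - B' * Q b + ∑ a, (Q a * A' a b - Q' a * A a b + R a * T' a b
          - R' a * T a b))
        (fun b => B * R' b - B' * R b + ∑ a, (Q a * U' a b - Q' a * U a b - R a * star (A' b a)
          + R' a * star (A b a)))
        (T * A' - T' * A - A.conjTranspose * T' + A'.conjTranspose * T
          - Matrix.of fun a b => star (Q a) * Q' b + star (Q' a) * Q b)
        (A * U' - A' * U - U * A'.conjTranspose + U' * A.conjTranspose
          + Matrix.of fun a b => star (R a) * R' b + star (R' a) * R b) := by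
  have eT := fun a b => hT.apply a b
  have eT' := fun a b => hT'.apply a b
  have eU := fun a b => hU.apply a b
  have eU' := fun a b => hU'.apply a b
  simp only [RCLike.star_def] at eT eT' eU eU' hB hB'
  rw [sb_apply, oddPart_sm, oddPart_sm]
  ext i j
  rcases i with i | i | i <;> rcases j with j | j | j <;>
    simp [sm, Matrix.mul_apply, Fintype.sum_sum_type, Fin.sum_univ_two, eT, eT', eU, eU', hB, hB',
      -Matrix.cons_mul] <;> ring

/-- The Lie superalgebra `g_*` of the conformal case. -/
def conf : GSub where
  carrier :=
    { carrier := {X | IsConf X}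
      add_mem' := by
        rintro _ _ ⟨A, B, Q, R, T, U, hB, hA, hT, hU, rfl⟩ ⟨A', B', Q', R', T', U', hB', hA', hT',
          hU', rfl⟩
        refine ⟨_, _, _, _, _, _, ?_, ?_, hT.add hT', hU.add hU', sm_add _ _ _ _ _ _ _ _ _ _ _ _⟩
        · rw [star_add, hB, hB']; ring
        · rw [hA, hA', Matrix.conjTranspose_add]
          simp only [Matrix.trace_sub, Matrix.trace_add]; ring
      zero_mem' := ⟨0, 0, 0, 0, 0, 0, by simp, by simp, Matrix.isHermitian_zero,
        Matrix.isHermitian_zero, sm_zero.symm⟩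
      smul_mem' := by
        rintro t _ ⟨A, B, Q, R, T, U, hB, hA, hT, hU, rfl⟩
        refine ⟨_, _, _, _, _, _, ?_, ?_, ?_, ?_, sm_smul _ _ _ _ _ _ _⟩
        · rw [star_smul, hB]; simp
        · rw [hA]; simp [Matrix.conjTranspose_smul, Matrix.trace_smul, smul_sub]
        · unfold Matrix.IsHermitian at *; rw [Matrix.conjTranspose_smul, hT]; simp
        · unfold Matrix.IsHermitian at *; rw [Matrix.conjTranspose_smul, hU]; simp }
  sb_mem := by
    rintro _ ⟨A, B, Q, R, T, U, hB, hA, hT, hU, rfl⟩ _ ⟨A', B', Q', R', T', U', hB', hA', hT',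
      hU', rfl⟩
    have eT := fun a b => hT.apply a b
    have eT' := fun a b => hT'.apply a b
    have eU := fun a b => hU.apply a b
    have eU' := fun a b => hU'.apply a b
    simp only [RCLike.star_def] at eT eT' eU eU'
    refine ⟨_, _, _, _, _, _, ?_, ?_, ?_, ?_, sb_sm hB hB' hT hT' hU hU'⟩
    · simp [Fin.sum_univ_two]; ring
    · simp [Fin.sum_univ_two, Matrix.trace, Matrix.mul_apply, eT, eT', eU, eU']; ring
    · ext a b
      simp [Fin.sum_univ_two, Matrix.mul_apply, eT, eT', eU, eU']; ring
    · ext a b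
      simp [Fin.sum_univ_two, Matrix.mul_apply, eT, eT', eU, eU']; ring
  degPart_mem := by
    rintro _ ⟨A, B, Q, R, T, U, hB, hA, hT, hU, rfl⟩ k
    refine ⟨_, _, _, _, _, _, ?_, ?_, ?_, ?_, degPart_sm _ _ _ _ _ _ _⟩ <;>
      split_ifs <;> simp_all

/-- The Lie superalgebra `g_*` of the reduced case. -/
def red : GSub where
  carrier :=
    { carrier := {X | IsRed X}
      add_mem' := by
        rintro _ _ ⟨A, Q, T, hA, hT, rfl⟩ ⟨A', Q', T', hA', hT', rfl⟩
        refine ⟨A + A', Q + Q', T + T', ?_, hT.add hT', ?_⟩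
        · rw [Matrix.trace_add, hA, hA', add_zero]
        · rw [sm_add]; simp
      zero_mem' := ⟨0, 0, 0, by simp, Matrix.isHermitian_zero, sm_zero.symm⟩
      smul_mem' := by
        rintro t _ ⟨A, Q, T, hA, hT, rfl⟩
        refine ⟨t • A, t • Q, t • T, ?_, ?_, ?_⟩
        · rw [Matrix.trace_smul, hA, smul_zero]
        · unfold Matrix.IsHermitian at *; rw [Matrix.conjTranspose_smul, hT]; simp
        · rw [sm_smul]; simp }
  sb_mem := by
    rintro _ ⟨A, Q, T, hA, hT, rfl⟩ _ ⟨A', Q', T', hA', hT', rfl⟩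
    have eT := fun a b => hT.apply a b
    have eT' := fun a b => hT'.apply a b
    simp only [RCLike.star_def] at eT eT'
    rw [sb_sm (by simp) (by simp) hT hT' Matrix.isHermitian_zero Matrix.isHermitian_zero]
    refine ⟨A * A' - A' * A, fun b => ∑ a, (Q a * A' a b - Q' a * A a b),
      T * A' - T' * A - A.conjTranspose * T' + A'.conjTranspose * T
        - Matrix.of fun a b => star (Q a) * Q' b + star (Q' a) * Q b, ?_, ?_, ?_⟩
    · simp [Fin.sum_univ_two, Matrix.trace, Matrix.mul_apply]; ring
    · ext a b
      simp [Fin.sum_univ_two, Matrix.mul_apply, eT, eT']; ring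
    · congr 1
      · ext a b; simp
      · simp
      · ext b; simp
      · ext b; simp
      · ext a b; simp
  degPart_mem := by
    rintro _ ⟨A, Q, T, hA, hT, rfl⟩ k
    refine ⟨if k = 0 then A else 0, if k = -1 then Q else 0, if k = -2 then T else 0, ?_, ?_, ?_⟩
    · split_ifs <;> simp [hA]
    · split_ifs <;> simp [hT]
    · rw [degPart_sm]; simp

/-! ## Basis elements and covectors -/

open Complex (I)

/-- `z (A₁₁ - A₂₂)` -/
def mH (z : ℂ) : Matrix (Fin 2) (Fin 2) ℂ := !![z, 0; 0, -z]

/-- `z (A₁₁ + A₂₂)` -/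
def mI (z : ℂ) : Matrix (Fin 2) (Fin 2) ℂ := !![z, 0; 0, z]

/-- `z A₁₂` -/
def mE (z : ℂ) : Matrix (Fin 2) (Fin 2) ℂ := !![0, z; 0, 0]

/-- `z A₂₁` -/
def mF (z : ℂ) : Matrix (Fin 2) (Fin 2) ℂ := !![0, 0; z, 0]

/-- The hermitian matrix unit `T₂₂` -/
def mT22 : Matrix (Fin 2) (Fin 2) ℂ := !![0, 0; 0, 1]

theorem mT22_herm : mT22.IsHermitian := by
  ext i j; fin_cases i <;> fin_cases j <;> simp [mT22]

/-- The element of `g_0` with the given block `A` in the conformal case. -/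
def cA (A : Matrix (Fin 2) (Fin 2) ℂ) : conf.Sp :=
  ⟨sm A (A - A.conjTranspose).trace 0 0 0 0, A, _, 0, 0, 0, 0,
    by simp [Matrix.trace], rfl, Matrix.isHermitian_zero, Matrix.isHermitian_zero, rfl⟩

def cH (z : ℂ) : conf.Sp := cA (mH z)

def cI (z : ℂ) : conf.Sp := cA (mI z)

def cE (z : ℂ) : conf.Sp := cA (mE z)

/-- `z Q_{1,j}` -/
def cQ (j : Fin 2) (z : ℂ) : conf.Sp :=
  ⟨sm 0 0 (Pi.single j z) 0 0 0, 0, 0, _, 0, 0, 0,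
    by simp, by simp, Matrix.isHermitian_zero, Matrix.isHermitian_zero, rfl⟩

/-- `z R_{1,j}` -/
def cR (j : Fin 2) (z : ℂ) : conf.Sp :=
  ⟨sm 0 0 0 (Pi.single j z) 0 0, 0, 0, 0, _, 0, 0,
    by simp, by simp, Matrix.isHermitian_zero, Matrix.isHermitian_zero, rfl⟩

def cT22 : conf.Sp :=
  ⟨sm 0 0 0 0 mT22 0, 0, 0, 0, 0, mT22, 0,
    by simp, by simp, mT22_herm, Matrix.isHermitian_zero, rfl⟩

/-- The element of `g_0` with the given traceless block `A` in the reduced case. -/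
def rA (A : Matrix (Fin 2) (Fin 2) ℂ) (hA : A.trace = 0) : red.Sp :=
  ⟨sm A 0 0 0 0 0, A, 0, 0, hA, Matrix.isHermitian_zero, rfl⟩

def rH (z : ℂ) : red.Sp := rA (mH z) (by simp [mH, Matrix.trace])

def rE (z : ℂ) : red.Sp := rA (mE z) (by simp [mE, Matrix.trace])

def rF (z : ℂ) : red.Sp := rA (mF z) (by simp [mF, Matrix.trace])

/-- `z Q_{1,j}` -/
def rQ (j : Fin 2) (z : ℂ) : red.Sp :=
  ⟨sm 0 0 (Pi.single j z) 0 0 0, 0, _, 0, by simp, Matrix.isHermitian_zero, rfl⟩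

def rT22 : red.Sp := ⟨sm 0 0 0 0 mT22 0, 0, 0, mT22, by simp, mT22_herm, rfl⟩

/-- The real part of an entry of a supermatrix in `g_-`. -/
def entryRe {g : GSub} (i j : Idx) : ↥(neg g) →ₗ[ℝ] ℝ where
  toFun x := ((x : SMat) i j).re
  map_add' x y := by simp
  map_smul' t x := by simp

/-- The imaginary part of an entry of a supermatrix in `g_-`. -/
def entryIm {g : GSub} (i j : Idx) : ↥(neg g) →ₗ[ℝ] ℝ where
  toFun x := ((x : SMat) i j).im
  map_add' x y := by simp
  map_smul' t x := by simp

/-! The basis of covectors on `g_-` dual to the basis `Q_{1,j}`, `i Q_{1,j}`, `T₁₁`, `T₂₂`,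
`T₁₂ + T₂₁`, `i (T₁₂ - T₂₁)` of `g_-`. -/

def q {g : GSub} (j : Fin 2) : ↥(neg g) →ₗ[ℝ] ℝ := entryRe (.inr (.inl 0)) (.inl j)

def iq {g : GSub} (j : Fin 2) : ↥(neg g) →ₗ[ℝ] ℝ := entryIm (.inr (.inl 0)) (.inl j)

def t11 {g : GSub} : ↥(neg g) →ₗ[ℝ] ℝ := entryRe (.inr (.inr 0)) (.inl 0)

def t22 {g : GSub} : ↥(neg g) →ₗ[ℝ] ℝ := entryRe (.inr (.inr 1)) (.inl 1)

def tS {g : GSub} : ↥(neg g) →ₗ[ℝ] ℝ := entryRe (.inr (.inr 0)) (.inl 1)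

def tK {g : GSub} : ↥(neg g) →ₗ[ℝ] ℝ := entryIm (.inr (.inr 0)) (.inl 1)

/-- `(x, y) ↦ α(x) β(y)` -/
def mulForm {g : GSub} (α β : ↥(neg g) →ₗ[ℝ] ℝ) : ↥(neg g) →ₗ[ℝ] ↥(neg g) →ₗ[ℝ] ℝ :=
  (LinearMap.mul ℝ ℝ).compl₁₂ α β

/-! The superexterior products of covectors. The product of two covectors on `g_{-1}` is symmetric,
the others are antisymmetric; for `α` supported on `g_{-1}` and `β` supported on `g_{-2}`
the sign is fixed by `(α ∧ β)(t, q) = α(q) β(t)`, where `q ∈ g_{-1}` and `t ∈ g_{-2}`. -/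

/-- `α ∧ β` for covectors supported on `g_{-1}` -/
def wQQ {g : GSub} (α β : ↥(neg g) →ₗ[ℝ] ℝ) : ↥(neg g) →ₗ[ℝ] ↥(neg g) →ₗ[ℝ] ℝ :=
  mulForm α β + mulForm β α

/-- `α ∧ β` for a covector `α` supported on `g_{-1}` and a covector `β` supported on `g_{-2}` -/
def wQT {g : GSub} (α β : ↥(neg g) →ₗ[ℝ] ℝ) : ↥(neg g) →ₗ[ℝ] ↥(neg g) →ₗ[ℝ] ℝ :=
  mulForm β α - mulForm α β

/-- `α ∧ β` for covectors supported on `g_{-2}` -/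
def wTT {g : GSub} (α β : ↥(neg g) →ₗ[ℝ] ℝ) : ↥(neg g) →ₗ[ℝ] ↥(neg g) →ₗ[ℝ] ℝ :=
  mulForm α β - mulForm β α

/-- `X ⊗ ω`, that is, `(x, y) ↦ ω(x, y) X` -/
def tens {g : GSub} (X : g.Sp) (ω : ↥(neg g) →ₗ[ℝ] ↥(neg g) →ₗ[ℝ] ℝ) : Bil g :=
  ω.compr₂ (LinearMap.toSpanSingleton ℝ g.Sp X)

/-! ## The cocycles -/

def conf1 : Bil conf :=
  tens cT22 (wQQ (q 0) (q 0))

def conf2 : Bil conf :=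
  tens cT22 (wQQ (q 0) (iq 0))

def conf8 : Bil conf :=
  (4 : ℝ) • tens (cQ 1 1) (wTT t11 tS) + tens (cH I) (wQT (iq 0) t11)
    + tens (cI I) (wQT (iq 0) t11) - (4 : ℝ) • tens (cE 1) (wQT (q 0) tS)
    + (2 : ℝ) • tens (cE 1) (wQT (iq 0) tK) + (4 : ℝ) • tens (cE 1) (wQT (q 1) t11)
    + (2 : ℝ) • tens (cE I) (wQT (iq 0) tS) - (2 : ℝ) • tens (cR 0 I) (wQQ (q 0) (iq 0))
    + (2 : ℝ) • tens (cR 0 1) (wQQ (iq 0) (iq 0))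

def conf9 : Bil conf :=
  (4 : ℝ) • tens (cQ 1 I) (wTT t11 tS) - tens (cH I) (wQT (q 0) t11) - tens (cI I) (wQT (q 0) t11)
    - (2 : ℝ) • tens (cE 1) (wQT (q 0) tK) - (4 : ℝ) • tens (cE 1) (wQT (iq 0) tS)
    + (4 : ℝ) • tens (cE 1) (wQT (iq 1) t11) - (2 : ℝ) • tens (cE I) (wQT (q 0) tS)
    + (2 : ℝ) • tens (cR 0 I) (wQQ (q 0) (q 0)) - (2 : ℝ) • tens (cR 0 1) (wQQ (q 0) (iq 0))

def red1 : Bil red :=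
  tens rT22 (wQQ (q 0) (q 0))

def red2 : Bil red :=
  tens rT22 (wQQ (q 0) (iq 0))

def red3 : Bil red :=
  -tens (rQ 0 1) (wQQ (q 0) (iq 0)) + tens (rQ 0 I) (wQQ (q 0) (q 0))
    - tens (rQ 1 1) (wQQ (q 0) (iq 1)) + tens (rQ 1 I) (wQQ (q 0) (q 1))

def red4 : Bil red :=
  -tens (rQ 0 1) (wQQ (iq 0) (iq 0)) + tens (rQ 0 I) (wQQ (q 0) (iq 0))
    - tens (rQ 1 1) (wQQ (iq 0) (iq 1)) + tens (rQ 1 I) (wQQ (iq 0) (q 1))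

def red5 : Bil red :=
  -tens (rH I) (wQQ (q 0) (q 0)) - tens (rH I) (wQQ (iq 0) (iq 0))
    + (2 : ℝ) • tens (rE 1) (wQQ (q 0) (iq 1)) - (2 : ℝ) • tens (rE 1) (wQQ (iq 0) (q 1))
    - (2 : ℝ) • tens (rE I) (wQQ (q 0) (q 1)) - (2 : ℝ) • tens (rE I) (wQQ (iq 0) (iq 1))
    - tens (rQ 0 1) (wQT (iq 0) t11) + tens (rQ 0 I) (wQT (q 0) t11)
    + (2 : ℝ) • tens (rQ 1 1) (wQT (q 0) tK) + (2 : ℝ) • tens (rQ 1 1) (wQT (iq 0) tS)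
    - (3 : ℝ) • tens (rQ 1 1) (wQT (iq 1) t11) - (2 : ℝ) • tens (rQ 1 I) (wQT (q 0) tS)
    + (2 : ℝ) • tens (rQ 1 I) (wQT (iq 0) tK) + (3 : ℝ) • tens (rQ 1 I) (wQT (q 1) t11)

def red6 : Bil red :=
  tens (rH 1) (wQQ (q 0) (q 1)) - tens (rH 1) (wQQ (iq 0) (iq 1)) + tens (rH I) (wQQ (q 0) (iq 1))
    + tens (rH I) (wQQ (iq 0) (q 1)) + tens (rE 1) (wQQ (q 1) (q 1))
    - tens (rE 1) (wQQ (iq 1) (iq 1)) + (2 : ℝ) • tens (rE I) (wQQ (q 1) (iq 1))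
    - tens (rF 1) (wQQ (q 0) (q 0)) + tens (rF 1) (wQQ (iq 0) (iq 0))
    - (2 : ℝ) • tens (rF I) (wQQ (q 0) (iq 0)) + tens (rQ 0 1) (wQT (q 0) tS)
    - tens (rQ 0 1) (wQT (iq 0) tK) - tens (rQ 0 1) (wQT (q 1) t11) - tens (rQ 0 I) (wQT (q 0) tK)
    - tens (rQ 0 I) (wQT (iq 0) tS) + tens (rQ 0 I) (wQT (iq 1) t11)
    + tens (rQ 1 1) (wQT (q 0) t22) - tens (rQ 1 1) (wQT (q 1) tS) - tens (rQ 1 1) (wQT (iq 1) tK)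
    - tens (rQ 1 I) (wQT (iq 0) t22) - tens (rQ 1 I) (wQT (q 1) tK)
    + tens (rQ 1 I) (wQT (iq 1) tS)

def red7 : Bil red :=
  -tens (rH 1) (wQQ (q 0) (iq 1)) - tens (rH 1) (wQQ (iq 0) (q 1)) + tens (rH I) (wQQ (q 0) (q 1))
    - tens (rH I) (wQQ (iq 0) (iq 1)) - (2 : ℝ) • tens (rE 1) (wQQ (q 1) (iq 1))
    + tens (rE I) (wQQ (q 1) (q 1)) - tens (rE I) (wQQ (iq 1) (iq 1))
    + (2 : ℝ) • tens (rF 1) (wQQ (q 0) (iq 0)) - tens (rF I) (wQQ (q 0) (q 0))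
    + tens (rF I) (wQQ (iq 0) (iq 0)) - tens (rQ 0 1) (wQT (q 0) tK)
    - tens (rQ 0 1) (wQT (iq 0) tS) + tens (rQ 0 1) (wQT (iq 1) t11)
    - tens (rQ 0 I) (wQT (q 0) tS) + tens (rQ 0 I) (wQT (iq 0) tK) + tens (rQ 0 I) (wQT (q 1) t11)
    - tens (rQ 1 1) (wQT (iq 0) t22) - tens (rQ 1 1) (wQT (q 1) tK)
    + tens (rQ 1 1) (wQT (iq 1) tS) - tens (rQ 1 I) (wQT (q 0) t22) + tens (rQ 1 I) (wQT (q 1) tS)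
    + tens (rQ 1 I) (wQT (iq 1) tK)

def red8 : Bil red :=
  -tens (rE 1) (wQT (q 0) tK) - tens (rE 1) (wQT (iq 0) tS) + tens (rE 1) (wQT (iq 1) t11)
    - tens (rE I) (wQT (q 0) tS) + tens (rE I) (wQT (iq 0) tK) + tens (rE I) (wQT (q 1) t11)
    + tens (rQ 1 1) (wTT t11 tK) + tens (rQ 1 I) (wTT t11 tS)

def red9 : Bil red :=
  tens (rE 1) (wQT (q 0) tS) - tens (rE 1) (wQT (iq 0) tK) - tens (rE 1) (wQT (q 1) t11)
    - tens (rE I) (wQT (q 0) tK) - tens (rE I) (wQT (iq 0) tS) + tens (rE I) (wQT (iq 1) t11)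
    - tens (rQ 1 1) (wTT t11 tS) + tens (rQ 1 I) (wTT t11 tK)

/-- The cocycles `c₁⁰, c₂⁰, c₈³, c₉³` of the conformal case. -/
def confCocycles : Fin 4 → Bil conf := ![conf1, conf2, conf8, conf9]

/-- The cocycles `c₁⁰, c₂⁰, c₃¹, c₄¹, c₅², c₆², c₇², c₈³, c₉³` of the reduced case. -/
def redCocycles : Fin 9 → Bil red := ![red1, red2, red3, red4, red5, red6, red7, red8, red9]

end MinkowskiSuper

end

noncomputable section

namespace MinkowskiSuper

/-! Cochains with values in a real form extend to complex multilinear maps of supermatrices. In terms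
of matrix units the equations for cocycles, coboundaries and highest weight vectors are integral
linear systems, which are solved by a verified elimination procedure that the kernel evaluates. -/

/-! ## Elimination for integral linear forms

The functions below are evaluated by the kernel. They are written with recursors and in
continuation-passing style, so that all data are evaluated before they are passed on. -/

/-! Everything in the theorem is finite-dimensional real linear algebra whose structure constants
become integers once scalars are extended to `ℂ`. The complexified algebra `gC` consists of the
supermatrices satisfying integral equations on the entries. Matrix units in the positions of
negative degree form a basis of its negative part. The real algebra is the set of fixed points in
`gC` of an antilinear involution `cj` (`mem_gOf`).

A real cochain extends to a complex multilinear map that vanishes on matrix units of nonnegative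
degree (`cx1`, `cx2`), and the differentials and the action of `g_0` extend with it. For fixed
parities, an identity holds on real homogeneous elements exactly when it holds on matrix units
(`mu_of_neg`, `neg_of_mu`). In the other direction, real parts turn complex primitives into real
ones. So if the complexification of `c` is `dF + D`, with `D` in the complex span of a real space
`W` that contains the coboundaries, then `c` lies in `W` (`mem_of_d1mu_add`). All questions can
therefore be decided over `ℂ`, on matrix units.

Over `ℂ` the semisimple part of `g_0` splits into two commuting copies of `sl(2)`, which act on the
first and on the last block. Each listed cocycle becomes a scalar multiple of an integral table of
values on matrix units (`cx2_eq_of_isMultiple`). The assertions about cohomology turn into integral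
linear problems. The cocycle, degree, weight and annihilation conditions are evaluations of linear
forms at the tables (`isHWCocycle`). Independence says that `df + ∑ zᵢ cᵢ = 0` forces all `zᵢ` to
vanish (`checkIndep`). The description of the highest weight space says that a cocycle whose images
under both raising operators are exact has the form `df + ∑ zᵢ cᵢ` (`checkHW`). Generation says that
every cocycle is `df + ∑ z_w w`, where `w` runs over explicit words in the two lowering operators
applied to the tables (`checkSpan`); complete reducibility is not needed.

For the prolong, derivations of degrees 1 to 4 are shown to be inner (`checkInner`), those of higher
degree vanish because all degrees lie between -2 and 2, and uniqueness holds because no nonzero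
element of nonnegative degree commutes with the negative part (`checkTransitive`).

These problems are settled by elimination, which supplies two verdicts: some forms vanish wherever
others do (`implied_spec`), and a system is solvable in some variables for all admissible values of
the rest (`solvable_spec`). Only soundness is proved. Sorting, fuel and the choice of pivots need no
correctness proof, because a failure there could only make a check return `false`. -/

/-- Linear forms with integer coefficients in variables indexed by `ℕ`. -/
abbrev LF : Type := List (ℕ × ℤ)

/-- Evaluates a natural number before passing it on. -/
def forceNat {α : Type} (n : ℕ) (k : ℕ → α) : α :=
  Nat.rec (k 0) (fun m _ => k (Nat.succ m)) n

/-- Evaluates an integer before passing it on. -/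
def forceInt {α : Type} (x : ℤ) (k : ℤ → α) : α :=
  Int.rec (fun n => forceNat n fun n => k (.ofNat n)) (fun n => forceNat n fun n => k (.negSucc n)) x

/-- Whether an integer is zero. -/
def isZero (x : ℤ) : Bool := Int.rec (fun n => Nat.beq n 0) (fun _ => false) x

/-- Adds `x` times the variable `n` to a sorted linear form and passes the result on. -/
def LF.insK {α : Type} (n : ℕ) (x : ℤ) (l : LF) : (LF → α) → α :=
  List.rec (fun k => bif isZero x then k [] else k [(n, x)])
    (fun t l ih k =>
      bif Nat.beq n t.1 then
        forceInt (Int.add x t.2) fun z => bif isZero z then k l else k ((t.1, z) :: l)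
      else bif Nat.ble n t.1 then (bif isZero x then k (t :: l) else k ((n, x) :: t :: l))
      else ih fun l' => k (t :: l')) l

/-- Adds `b` times the second form to the first one and passes the result on. -/
def LF.addK {α : Type} (b : ℤ) (l r : LF) : (LF → α) → α :=
  List.rec (fun l k => k l)
    (fun t _ ih l k => forceNat t.1 fun n => forceInt (Int.mul b t.2) fun z =>
      LF.insK n z l fun l' => ih l' k) r l

/-- Multiplies a form by `a` and passes the result on. -/
def LF.mulK {α : Type} (a : ℤ) (l : LF) : (LF → α) → α :=
  List.rec (fun k => k [])
    (fun t _ ih k => forceInt (Int.mul a t.2) fun z => ih fun l' => k ((t.1, z) :: l')) l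

/-- Finite maps from `ℕ` to linear forms. -/
inductive Trie : Type
  | leaf : Trie
  | node : LF → Trie → Trie → Trie

/-- The form with a given key. -/
def Trie.get (t : Trie) : ℕ → LF :=
  Trie.rec (fun _ => [])
    (fun p _ _ gl gr n => bif Nat.beq n 0 then p
      else bif Nat.beq (Nat.mod n 2) 0 then gl (Nat.div n 2) else gr (Nat.div n 2)) t

/-- Inserts a form and passes the result on. -/
def Trie.insertK {α : Type} (p : LF) (f : ℕ) : Trie → ℕ → (Trie → α) → α :=
  Nat.rec (fun t _ k => k t)
    (fun _ ih t n k => Trie.rec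
      (bif Nat.beq n 0 then k (.node p .leaf .leaf)
        else bif Nat.beq (Nat.mod n 2) 0 then ih .leaf (Nat.div n 2) fun l => k (.node [] l .leaf)
        else ih .leaf (Nat.div n 2) fun r => k (.node [] .leaf r))
      (fun q l r _ _ => bif Nat.beq n 0 then k (.node p l r)
        else bif Nat.beq (Nat.mod n 2) 0 then ih l (Nat.div n 2) fun l => k (.node q l r)
        else ih r (Nat.div n 2) fun r => k (.node q l r)) t) f

/-- Reduces the leading terms of a form by the forms in `t`. -/
def LF.reduceK {α : Type} (t : Trie) (f : ℕ) : LF → (LF → α) → α :=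
  Nat.rec (fun l k => k l)
    (fun _ ih l k => List.rec (k [])
      (fun u l _ => List.rec (k (u :: l))
        (fun w p _ => bif Nat.beq u.1 w.1 && !isZero w.2 then
          LF.mulK w.2 l fun l' => LF.addK (Int.neg u.2) l' p fun l'' => ih l'' k
          else k (u :: l)) (t.get u.1)) l) f

/-- Sorts a form, reduces it and passes the result on. -/
def LF.normK {α : Type} (t : Trie) (r : LF) (k : LF → α) : α :=
  LF.addK 1 [] r fun r => LF.reduceK t 1000 r k

/-- Elimination: adds the forms in the list to `t`. -/
def elimK {α : Type} (rs : List LF) (k : Trie → α) : Trie → α :=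
  List.rec k
    (fun r _ ih t => LF.normK t r fun r => List.rec (ih t)
      (fun u r _ => Trie.insertK (u :: r) 40 t u.1 ih) r) rs

/-- Whether all forms in the list reduce to `0`. -/
def allReduce (t : Trie) (rs : List LF) : Bool :=
  List.rec true (fun r _ ih => LF.normK t r fun r => List.rec ih (fun _ _ _ => false) r) rs

/-- Whether the vanishing of the forms `eqs` implies that of the forms `tgts`. -/
def implied (eqs tgts : List LF) : Bool := elimK eqs (fun t => allReduce t tgts) .leaf

/-- Inserts a form into a list sorted by leading variables and passes the result on. -/
def insertSortedK {α : Type} (n : ℕ) (p : LF) (ps : List LF) : (List LF → α) → α :=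
  List.rec (fun k => k [p])
    (fun q l ih k => List.rec (ih k)
      (fun u _ _ => bif Nat.ble n u.1 then k (p :: q :: l) else ih fun l' => k (q :: l')) q) ps

/-- The forms obtained by elimination whose leading variable is less than `K`, in increasing order
of the leading variables. -/
def pivotsK {α : Type} (K : ℕ) (rs : List LF) (k : List LF → α) : Trie → List LF → α :=
  List.rec (fun _ ps => k ps)
    (fun r _ ih t ps => LF.normK t r fun r => List.rec (ih t ps)
      (fun u r _ => bif Nat.ble K u.1 then ih t ps
        else Trie.insertK (u :: r) 40 t u.1 fun t => insertSortedK u.1 (u :: r) ps (ih t)) r) rs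

/-- Whether the variable `n` does not occur in a form. -/
def LF.free (n : ℕ) (l : LF) : Bool := l.all fun t => !Nat.beq t.1 n

/-- Whether the leading variables of the forms are less than `K`, and do not occur elsewhere in the
form or in the subsequent ones. -/
def triangular (K : ℕ) : List LF → Bool
  | [] => true
  | [] :: _ => false
  | (u :: p) :: ps => !Nat.ble K u.1 && !isZero u.2 && LF.free u.1 p && ps.all (LF.free u.1) &&
      triangular K ps

/-- Whether the system `rows` in the variables less than `K` can be solved for all values of the
other variables which satisfy the equations `eqs`. -/
def solvable (K : ℕ) (eqs rows : List LF) : Bool :=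
  pivotsK K rows (fun ps => triangular K ps && eqs.all (fun r => r.all fun t => Nat.ble K t.1) &&
    implied (ps ++ eqs) rows) .leaf []

/-! ### Soundness -/

/-- The value of a linear form. -/
def LF.ev (v : ℕ → ℂ) : LF → ℂ
  | [] => 0
  | t :: l => (t.2 : ℂ) * v t.1 + LF.ev v l

theorem forceNat_eq {α : Type} (n : ℕ) (k : ℕ → α) : forceNat n k = k n := by
  cases n <;> rfl

theorem forceInt_eq {α : Type} (x : ℤ) (k : ℤ → α) : forceInt x k = k x := by
  cases x <;> simp [forceInt, forceNat_eq]

theorem isZero_iff (x : ℤ) : isZero x = true ↔ x = 0 := by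
  cases x <;> simp [isZero]

/-- The specifications of the functions in continuation-passing style share this form: one result,
independent of the continuation and of its type, receives every continuation. Only the values of the
result are described; that it is sorted is never needed. -/
theorem LF.insK_spec (n : ℕ) (x : ℤ) (l : LF) : ∃ l' : LF,
    (∀ v, LF.ev v l' = x * v n + LF.ev v l) ∧
    ∀ (α : Type) (k : LF → α), LF.insK n x l k = k l' := by
  induction l with
  | nil =>
    by_cases hx : x = 0
    · exact ⟨[], fun v => by simp [LF.ev, hx], fun α k => by simp [LF.insK, (isZero_iff x).2 hx]⟩
    · refine ⟨[(n, x)], fun v => by simp [LF.ev], fun α k => ?_⟩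
      have : isZero x = false := by simpa using mt (isZero_iff x).1 hx
      simp [LF.insK, this]
  | cons t l ih =>
    have e : ∀ (α : Type) (k : LF → α), LF.insK n x (t :: l) k =
        bif Nat.beq n t.1 then
          forceInt (Int.add x t.2) fun z => bif isZero z then k l else k ((t.1, z) :: l)
        else bif Nat.ble n t.1 then (bif isZero x then k (t :: l) else k ((n, x) :: t :: l))
        else LF.insK n x l fun l' => k (t :: l') := fun _ _ => rfl
    simp only [e, forceInt_eq]
    by_cases h1 : n = t.1
    · have h1' : Nat.beq n t.1 = true := by simpa using h1
      have e2 : Int.add x t.2 = x + t.2 := rfl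
      simp only [h1', cond_true, e2]
      by_cases hz : x + t.2 = 0
      · refine ⟨l, fun v => ?_, fun α k => by simp [(isZero_iff _).2 hz]⟩
        have : (x : ℂ) + t.2 = 0 := by exact_mod_cast hz
        simp only [LF.ev, ← h1]
        linear_combination (-v n) * this
      · refine ⟨(t.1, x + t.2) :: l, fun v => ?_, fun α k => ?_⟩
        · simp only [LF.ev, ← h1]; push_cast; ring
        · have : isZero (x + t.2) = false := by simpa using mt (isZero_iff _).1 hz
          simp [this]
    · have h1' : Nat.beq n t.1 = false := Bool.eq_false_iff.2 (by simpa using h1)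
      simp only [h1', cond_false]
      cases Nat.ble n t.1
      · obtain ⟨l', h, h'⟩ := ih
        refine ⟨t :: l', fun v => ?_, fun α k => by simp [h']⟩
        simp only [LF.ev, h]; ring
      · by_cases hx : x = 0
        · exact ⟨t :: l, fun v => by simp [LF.ev, hx], fun α k => by simp [(isZero_iff x).2 hx]⟩
        · refine ⟨(n, x) :: t :: l, fun v => by simp [LF.ev], fun α k => ?_⟩
          have : isZero x = false := by simpa using mt (isZero_iff x).1 hx
          simp [this]

theorem LF.addK_spec (b : ℤ) (l r : LF) : ∃ l' : LF,
    (∀ v, LF.ev v l' = LF.ev v l + b * LF.ev v r) ∧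
    ∀ (α : Type) (k : LF → α), LF.addK b l r k = k l' := by
  induction r generalizing l with
  | nil => exact ⟨l, fun v => by simp [LF.ev], fun α k => rfl⟩
  | cons t r ih =>
    have e : ∀ (α : Type) (k : LF → α), LF.addK b l (t :: r) k =
        forceNat t.1 fun n => forceInt (Int.mul b t.2) fun z =>
          LF.insK n z l fun l' => LF.addK b l' r k := fun _ _ => rfl
    obtain ⟨l₁, h₁, h₁'⟩ := LF.insK_spec t.1 (b * t.2) l
    obtain ⟨l₂, h₂, h₂'⟩ := ih l₁
    refine ⟨l₂, fun v => ?_, fun α k => ?_⟩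
    · rw [h₂, h₁]; simp only [LF.ev]; push_cast; ring
    · rw [e, forceNat_eq, forceInt_eq]
      exact (h₁' _ _).trans (h₂' _ _)

theorem LF.mulK_spec (a : ℤ) (l : LF) : ∃ l' : LF, (∀ v, LF.ev v l' = a * LF.ev v l) ∧
    ∀ (α : Type) (k : LF → α), LF.mulK a l k = k l' := by
  induction l with
  | nil => exact ⟨[], fun v => by simp [LF.ev], fun α k => rfl⟩
  | cons t l ih =>
    have e : ∀ (α : Type) (k : LF → α), LF.mulK a (t :: l) k =
        forceInt (Int.mul a t.2) fun z => LF.mulK a l fun l' => k ((t.1, z) :: l') := fun _ _ => rfl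
    obtain ⟨l', h, h'⟩ := ih
    refine ⟨(t.1, a * t.2) :: l', fun v => ?_, fun α k => ?_⟩
    · simp only [LF.ev, h]; push_cast; ring
    · rw [e, forceInt_eq, h']; rfl

/-- All forms in `t` vanish at `v`. -/
def Trie.Vanish (v : ℕ → ℂ) (t : Trie) : Prop := ∀ n, LF.ev v (t.get n) = 0

theorem Trie.get_node (p : LF) (l r : Trie) (n : ℕ) : (Trie.node p l r).get n =
    bif Nat.beq n 0 then p
    else bif Nat.beq (Nat.mod n 2) 0 then l.get (Nat.div n 2) else r.get (Nat.div n 2) := rfl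

theorem Trie.vanish_leaf (v : ℕ → ℂ) : Trie.leaf.Vanish v := fun _ => rfl

/-- Deliberately weak: every form found afterwards is the new one, an old one or empty. That
preserves vanishing, and it needs neither enough fuel nor the fact that the new form is found under
its key. -/
theorem Trie.insertK_spec (p : LF) (f : ℕ) (t : Trie) (n : ℕ) : ∃ t' : Trie,
    (∀ n', t'.get n' = p ∨ t'.get n' = t.get n' ∨ t'.get n' = []) ∧
    ∀ (α : Type) (k : Trie → α), Trie.insertK p f t n k = k t' := by
  induction f generalizing t n with
  | zero => exact ⟨t, fun _ => .inr (.inl rfl), fun α k => rfl⟩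
  | succ f ih =>
    cases t with
    | leaf =>
      have e : ∀ (α : Type) (k : Trie → α), Trie.insertK p (f + 1) .leaf n k =
          bif Nat.beq n 0 then k (.node p .leaf .leaf)
          else bif Nat.beq (Nat.mod n 2) 0 then
            Trie.insertK p f .leaf (Nat.div n 2) fun l => k (.node [] l .leaf)
          else Trie.insertK p f .leaf (Nat.div n 2) fun r => k (.node [] .leaf r) := fun _ _ => rfl
      simp only [e]
      obtain ⟨t', h, h'⟩ := ih .leaf (Nat.div n 2)
      cases Nat.beq n 0
      · cases Nat.beq (Nat.mod n 2) 0
        · refine ⟨.node [] .leaf t', fun n' => ?_, fun α k => by simp [h']⟩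
          rw [Trie.get_node]
          cases Nat.beq n' 0
          · cases Nat.beq (Nat.mod n' 2) 0
            · exact h _
            · exact .inr (.inl rfl)
          · exact .inr (.inl rfl)
        · refine ⟨.node [] t' .leaf, fun n' => ?_, fun α k => by simp [h']⟩
          rw [Trie.get_node]
          cases Nat.beq n' 0
          · cases Nat.beq (Nat.mod n' 2) 0
            · exact .inr (.inl rfl)
            · exact h _
          · exact .inr (.inl rfl)
      · refine ⟨.node p .leaf .leaf, fun n' => ?_, fun α k => by simp⟩
        rw [Trie.get_node]
        cases Nat.beq n' 0
        · cases Nat.beq (Nat.mod n' 2) 0 <;> exact .inr (.inl rfl)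
        · exact .inl rfl
    | node q l r =>
      have e : ∀ (α : Type) (k : Trie → α), Trie.insertK p (f + 1) (.node q l r) n k =
          bif Nat.beq n 0 then k (.node p l r)
          else bif Nat.beq (Nat.mod n 2) 0 then
            Trie.insertK p f l (Nat.div n 2) fun l => k (.node q l r)
          else Trie.insertK p f r (Nat.div n 2) fun r => k (.node q l r) := fun _ _ => rfl
      simp only [e]
      cases Nat.beq n 0
      · cases Nat.beq (Nat.mod n 2) 0
        · obtain ⟨t', h, h'⟩ := ih r (Nat.div n 2)
          refine ⟨.node q l t', fun n' => ?_, fun α k => by simp [h']⟩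
          rw [Trie.get_node, Trie.get_node]
          cases Nat.beq n' 0
          · cases Nat.beq (Nat.mod n' 2) 0
            · exact h _
            · exact .inr (.inl rfl)
          · exact .inr (.inl rfl)
        · obtain ⟨t', h, h'⟩ := ih l (Nat.div n 2)
          refine ⟨.node q t' r, fun n' => ?_, fun α k => by simp [h']⟩
          rw [Trie.get_node, Trie.get_node]
          cases Nat.beq n' 0
          · cases Nat.beq (Nat.mod n' 2) 0
            · exact .inr (.inl rfl)
            · exact h _
          · exact .inr (.inl rfl)
      · refine ⟨.node p l r, fun n' => ?_, fun α k => by simp⟩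
        rw [Trie.get_node, Trie.get_node]
        cases Nat.beq n' 0
        · exact .inr (.inl rfl)
        · exact .inl rfl

/-- Cancelling a leading term `u` against a pivot with leading term `w` replaces the tail by `w.2`
times itself minus `u.2` times the tail of the pivot. Where the pivots vanish this multiplies the
value by the nonzero integer `w.2`, so vanishing is preserved although the value is not. -/
theorem LF.reduceK_spec (t : Trie) (f : ℕ) (l : LF) : ∃ l' : LF,
    (∀ v, t.Vanish v → (LF.ev v l' = 0 ↔ LF.ev v l = 0)) ∧
    ∀ (α : Type) (k : LF → α), LF.reduceK t f l k = k l' := by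
  induction f generalizing l with
  | zero => exact ⟨l, fun _ _ => Iff.rfl, fun α k => rfl⟩
  | succ f ih =>
    cases l with
    | nil => exact ⟨[], fun _ _ => Iff.rfl, fun α k => rfl⟩
    | cons u l =>
      have e : ∀ (α : Type) (k : LF → α), LF.reduceK t (f + 1) (u :: l) k =
        List.rec (k (u :: l))
        (fun w p _ => bif Nat.beq u.1 w.1 && !isZero w.2 then
          LF.mulK w.2 l fun l' => LF.addK (Int.neg u.2) l' p fun l'' => LF.reduceK t f l'' k
          else k (u :: l)) (t.get u.1) := fun _ _ => rfl
      rcases hg : t.get u.1 with _ | ⟨w, p⟩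
      · exact ⟨u :: l, fun _ _ => Iff.rfl, fun α k => by rw [e, hg]⟩
      · simp only [e, hg]
        by_cases hb : (Nat.beq u.1 w.1 && !isZero w.2) = true
        · obtain ⟨h1, h2⟩ : u.1 = w.1 ∧ w.2 ≠ 0 := by
            simpa [← isZero_iff] using hb
          obtain ⟨l₁, h₁, h₁'⟩ := LF.mulK_spec w.2 l
          obtain ⟨l₂, h₂, h₂'⟩ := LF.addK_spec (Int.neg u.2) l₁ p
          obtain ⟨l₃, h₃, h₃'⟩ := ih l₂
          refine ⟨l₃, fun v hv => ?_, fun α k => ?_⟩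
          · rw [h₃ v hv, h₂, h₁]
            have h4 := hv u.1
            rw [hg] at h4
            simp only [LF.ev] at h4 ⊢
            have h5 : (w.2 : ℂ) ≠ 0 := by exact_mod_cast h2
            have h6 : ((Int.neg u.2 : ℤ) : ℂ) = -u.2 := Int.cast_neg _
            have h7 : (w.2 : ℂ) * LF.ev v l + (Int.neg u.2 : ℤ) * LF.ev v p =
                w.2 * (u.2 * v u.1 + LF.ev v l) := by
              rw [h6, h1]; linear_combination (-(u.2 : ℂ)) * h4
            rw [h7, mul_eq_zero, or_iff_right h5]
          · simp [hb, h₁', h₂', h₃']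
        · exact ⟨u :: l, fun _ _ => Iff.rfl, fun α k => by simp [hb]⟩

theorem LF.normK_spec (t : Trie) (l : LF) : ∃ l' : LF,
    (∀ v, t.Vanish v → (LF.ev v l' = 0 ↔ LF.ev v l = 0)) ∧
    ∀ (α : Type) (k : LF → α), LF.normK t l k = k l' := by
  obtain ⟨l₁, h₁, h₁'⟩ := LF.addK_spec 1 [] l
  obtain ⟨l₂, h₂, h₂'⟩ := LF.reduceK_spec t 1000 l₁
  refine ⟨l₂, fun v hv => ?_, fun α k => ?_⟩
  · rw [h₂ v hv, h₁]; simp [LF.ev]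
  · simp only [LF.normK, h₁', h₂']

theorem elimK_spec (rs : List LF) (t : Trie) : ∃ t' : Trie,
    (∀ v, t.Vanish v → (∀ r ∈ rs, LF.ev v r = 0) → t'.Vanish v) ∧
    ∀ (α : Type) (k : Trie → α), elimK rs k t = k t' := by
  induction rs generalizing t with
  | nil => exact ⟨t, fun _ h _ => h, fun α k => rfl⟩
  | cons r rs ih =>
    have e : ∀ (α : Type) (k : Trie → α), elimK (r :: rs) k t =
        LF.normK t r fun r => List.rec (elimK rs k t)
          (fun u r _ => Trie.insertK (u :: r) 40 t u.1 (elimK rs k)) r := fun _ _ => rfl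
    obtain ⟨r', h₁, h₁'⟩ := LF.normK_spec t r
    simp only [e, h₁']
    cases r' with
    | nil =>
      obtain ⟨t', h₂, h₂'⟩ := ih t
      exact ⟨t', fun v hv hr => h₂ v hv fun r hr' => hr r (List.mem_cons_of_mem _ hr'),
        fun α k => h₂' α k⟩
    | cons u r' =>
      obtain ⟨t₁, h₂, h₂'⟩ := Trie.insertK_spec (u :: r') 40 t u.1
      obtain ⟨t', h₃, h₃'⟩ := ih t₁
      refine ⟨t', fun v hv hr => h₃ v (fun n => ?_) fun r hr' => hr r (List.mem_cons_of_mem _ hr'),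
        fun α k => ?_⟩
      · rcases h₂ n with h | h | h <;> rw [h]
        · exact (h₁ v hv).2 (hr r List.mem_cons_self)
        · exact hv n
        · rfl
      · simp only [h₂', h₃']

theorem allReduce_spec {t : Trie} {rs : List LF} (h : allReduce t rs = true) {v : ℕ → ℂ}
    (hv : t.Vanish v) : ∀ r ∈ rs, LF.ev v r = 0 := by
  induction rs with
  | nil => simp
  | cons r rs ih =>
    have e : allReduce t (r :: rs) = LF.normK t r fun r =>
      List.rec (allReduce t rs) (fun _ _ _ => false) r := rfl
    obtain ⟨r', h₁, h₁'⟩ := LF.normK_spec t r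
    rw [e, h₁'] at h
    cases r' with
    | nil =>
      intro s hs
      rcases List.mem_cons.1 hs with rfl | hs
      · exact (h₁ v hv).1 rfl
      · exact ih h s hs
    | cons u r' => simp at h

theorem implied_spec {eqs tgts : List LF} (h : implied eqs tgts = true) {v : ℕ → ℂ}
    (hv : ∀ r ∈ eqs, LF.ev v r = 0) : ∀ r ∈ tgts, LF.ev v r = 0 := by
  obtain ⟨t, h₁, h₁'⟩ := elimK_spec eqs .leaf
  rw [implied, h₁'] at h
  exact allReduce_spec h (h₁ v (Trie.vanish_leaf v) hv)

/-- Nothing is claimed about the list, here or in `pivotsK_spec`: the pivots are mere candidates,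
and `solvable` tests afterwards all that is required of them. -/
theorem insertSortedK_spec (n : ℕ) (p : LF) (ps : List LF) : ∃ ps' : List LF,
    ∀ (α : Type) (k : List LF → α), insertSortedK n p ps k = k ps' := by
  induction ps with
  | nil => exact ⟨[p], fun α k => rfl⟩
  | cons q ps ih =>
    obtain ⟨ps', h⟩ := ih
    have e : ∀ (α : Type) (k : List LF → α), insertSortedK n p (q :: ps) k =
        List.rec (insertSortedK n p ps k)
        (fun u _ _ => bif Nat.ble n u.1 then k (p :: q :: ps)
          else insertSortedK n p ps fun l' => k (q :: l')) q := fun _ _ => rfl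
    simp only [e]
    cases q with
    | nil => exact ⟨ps', h⟩
    | cons u q =>
      simp only [h]
      cases Nat.ble n u.1
      · exact ⟨_, fun α k => rfl⟩
      · exact ⟨_, fun α k => rfl⟩

theorem pivotsK_spec (K : ℕ) (rs : List LF) (t : Trie) (ps : List LF) : ∃ ps' : List LF,
    ∀ (α : Type) (k : List LF → α), pivotsK K rs k t ps = k ps' := by
  induction rs generalizing t ps with
  | nil => exact ⟨ps, fun α k => rfl⟩
  | cons r rs ih =>
    have e : ∀ (α : Type) (k : List LF → α), pivotsK K (r :: rs) k t ps =
        LF.normK t r fun r => List.rec (pivotsK K rs k t ps)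
      (fun u r _ => bif Nat.ble K u.1 then pivotsK K rs k t ps
        else Trie.insertK (u :: r) 40 t u.1 fun t =>
          insertSortedK u.1 (u :: r) ps (pivotsK K rs k t)) r := fun _ _ => rfl
    obtain ⟨r', -, h₁'⟩ := LF.normK_spec t r
    simp only [e, h₁']
    cases r' with
    | nil => exact ih t ps
    | cons u r' =>
      obtain ⟨t₁, -, h₂'⟩ := Trie.insertK_spec (u :: r') 40 t u.1
      obtain ⟨ps₁, h₃⟩ := insertSortedK_spec u.1 (u :: r') ps
      simp only [h₂', h₃]
      cases Nat.ble K u.1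
      · exact ih t₁ ps₁
      · exact ih t ps

theorem LF.ev_congr {v w : ℕ → ℂ} {l : LF} (h : ∀ t ∈ l, v t.1 = w t.1) :
    LF.ev v l = LF.ev w l := by
  induction l with
  | nil => rfl
  | cons t l ih =>
    simp only [LF.ev]
    rw [h t List.mem_cons_self, ih fun t ht => h t (List.mem_cons_of_mem _ ht)]

theorem LF.ev_update {v : ℕ → ℂ} {n : ℕ} {x : ℂ} {l : LF} (h : LF.free n l = true) :
    LF.ev (Function.update v n x) l = LF.ev v l := by
  refine LF.ev_congr fun t ht => ?_
  have := List.all_eq_true.1 h t ht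
  exact Function.update_of_ne (fun e => by simp [e] at this) _ _

/-- Back substitution from the end of the list: the leading variable of a form does not occur in the
later ones, so it can be adjusted to this form without disturbing them. -/
theorem triangular_spec {K : ℕ} {ps : List LF} (h : triangular K ps = true) (v : ℕ → ℂ) :
    ∃ w : ℕ → ℂ, (∀ n, K ≤ n → w n = v n) ∧ ∀ p ∈ ps, LF.ev w p = 0 := by
  induction ps with
  | nil => exact ⟨v, fun _ _ => rfl, by simp⟩
  | cons p ps ih =>
    cases p with
    | nil => simp [triangular] at h
    | cons u p =>
      simp only [triangular, Bool.and_eq_true] at h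
      obtain ⟨⟨⟨⟨h1, h2⟩, h3⟩, h4⟩, h5⟩ := h
      obtain ⟨w, hw, hw'⟩ := ih h5
      refine ⟨Function.update w u.1 (-LF.ev w p / u.2), fun n hn => ?_, fun q hq => ?_⟩
      · rw [Function.update_of_ne, hw n hn]
        rintro rfl
        rw [Nat.ble_eq_true_of_le hn] at h1
        simp at h1
      · rcases List.mem_cons.1 hq with rfl | hq
        · have : (u.2 : ℂ) ≠ 0 := by
            have : u.2 ≠ 0 := by simpa [← isZero_iff] using h2
            exact_mod_cast this
          simp only [LF.ev, LF.ev_update h3, Function.update_self]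
          field_simp
          ring
        · rw [LF.ev_update (List.all_eq_true.1 h4 q hq), hw' q hq]

/-- The pivots are solved for arbitrary values of the parameters. The equations `eqs` contain
parameters only and so remain true, and the pivots together with `eqs` imply all rows. -/
theorem solvable_spec {K : ℕ} {eqs rows : List LF} (h : solvable K eqs rows = true) (v : ℕ → ℂ)
    (hv : ∀ r ∈ eqs, LF.ev v r = 0) :
    ∃ w : ℕ → ℂ, (∀ n, K ≤ n → w n = v n) ∧ ∀ r ∈ rows, LF.ev w r = 0 := by
  obtain ⟨ps, hps⟩ := pivotsK_spec K rows .leaf []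
  rw [solvable, hps] at h
  simp only [Bool.and_eq_true] at h
  obtain ⟨⟨h1, h2⟩, h3⟩ := h
  obtain ⟨w, hw, hw'⟩ := triangular_spec h1 v
  refine ⟨w, hw, implied_spec h3 fun r hr => ?_⟩
  rcases List.mem_append.1 hr with hr | hr
  · exact hw' r hr
  · rw [← hv r hr]
    refine LF.ev_congr fun t ht => hw _ ?_
    exact Nat.le_of_ble_eq_true (List.all_eq_true.1 (List.all_eq_true.1 h2 r hr) t ht)

/-! ## The complexes in coordinates -/

/-- The rows and columns of supermatrices. -/
inductive Ix : Type
  | u0 | u1 | mid | v0 | v1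
  deriving DecidableEq

/-- The number of an index. -/
def Ix.num : Ix → ℕ
  | .u0 => 0
  | .u1 => 1
  | .mid => 2
  | .v0 => 3
  | .v1 => 4

/-- Equality of indices. -/
def Ix.eq (k l : Ix) : Bool := Nat.beq k.num l.num

/-- The number of the block of an index. -/
def Ix.bl : Ix → ℕ
  | .u0 => 0
  | .u1 => 0
  | .mid => 1
  | .v0 => 2
  | .v1 => 2

/-- Whether a matrix position is odd. -/
def odd : Ix → Ix → Bool
  | .mid, .mid => false
  | .mid, _ => true
  | _, .mid => true
  | _, _ => false

/-- Whether a matrix position is of negative degree. -/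
def low : Ix → Ix → Bool
  | .mid, .u0 => true
  | .mid, .u1 => true
  | .v0, .u0 => true
  | .v0, .u1 => true
  | .v0, .mid => true
  | .v1, .u0 => true
  | .v1, .u1 => true
  | .v1, .mid => true
  | _, _ => false

/-! ### Encoding of brackets, cochains and differentials by linear forms. -/

/-- The sign given by a Boolean. -/
def sgn : Bool → ℤ
  | true => -1
  | false => 1

/-- Exclusive or. -/
def bx : Bool → Bool → Bool
  | true, b => !b
  | false, b => b

/-- Prepends `± X i j` to a linear form, where the entry `X i j` of an element of the complexified
algebra is expressed by the independent entries, which are the variables `f i j`. -/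
def entT (red : Bool) (f : Ix → Ix → ℕ) (s : Bool) (i j : Ix) (acc : LF) : LF :=
  bif red then
    bif Nat.blt i.bl j.bl || (i.eq .mid && j.eq .mid) then acc
    else bif i.eq .u1 && j.eq .u1 then (f .u0 .u0, sgn (!s)) :: acc
    else bif i.eq .v1 && j.eq .v1 then (f .v0 .v0, sgn (!s)) :: acc
    else (f i j, sgn s) :: acc
  else
    bif i.eq .mid && j.eq .mid then
      (f .u0 .u0, sgn s) :: (f .u1 .u1, sgn s) :: (f .v0 .v0, sgn s) :: (f .v1 .v1, sgn s) :: acc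
    else (f i j, sgn s) :: acc

/-- Prepends `±` the entry in position `(i, j)` of the bracket of `X` with the matrix unit in
position `(k, l)`. -/
def brT (X : Bool → Ix → Ix → LF → LF) (s : Bool) (k l i j : Ix) (acc : LF) : LF :=
  bif j.eq l then
    X s i k (bif i.eq k then X (bx s (!(odd l j && odd k l))) l j acc else acc)
  else bif i.eq k then X (bx s (!(odd l j && odd k l))) l j acc else acc

/-- Prepends `±` the value of a linear map with values `G` at the matrix units at the bracket of two
of them. -/
def cbrT (G : Bool → Ix → Ix → LF → LF) (s : Bool) (k l m n : Ix) (acc : LF) : LF :=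
  bif l.eq m then
    G s k n (bif n.eq k then G (bx s (!(odd k l && odd m n))) m l acc else acc)
  else bif n.eq k then G (bx s (!(odd k l && odd m n))) m l acc else acc

/-- The number of the variable for an entry of a value of a 1-cochain. -/
def fcode (o : ℕ) (k l i j : Ix) : ℕ :=
  Nat.add o (Nat.add (Nat.mul (Nat.add (Nat.mul (Nat.add (Nat.mul k.num 5) l.num) 5) i.num) 5)
    j.num)

/-- The number of a matrix position. -/
def rank (k l : Ix) : ℕ := Nat.add (Nat.mul k.num 5) l.num

/-- The number of the variable for an entry of a value of a 2-cochain. -/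
def ccode (o : ℕ) (k l m n i j : Ix) : ℕ :=
  Nat.add (Nat.mul (rank k l) 625) (fcode o m n i j)

/-- Prepends `±` an entry of a value of a 1-cochain. -/
def fT (red : Bool) (o : ℕ) (k l : Ix) (s : Bool) (i j : Ix) (acc : LF) : LF :=
  bif low k l then entT red (fcode o k l) s i j acc else acc

/-- Prepends `±` an entry of a value of a 1-cochain of degree `d`. -/
def fdT (red : Bool) (d o : ℕ) (k l : Ix) (s : Bool) (i j : Ix) (acc : LF) : LF :=
  bif Nat.beq (Nat.add j.bl k.bl) (Nat.add (Nat.add i.bl l.bl) d) then fT red o k l s i j acc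
  else acc

/-- Prepends `±` an entry of a value of a 2-cochain. -/
def cT (red : Bool) (o : ℕ) (k l m n : Ix) (s : Bool) (i j : Ix) (acc : LF) : LF :=
  bif low k l && low m n then
    bif Nat.ble (rank m n) (rank k l) then
      bif Nat.beq (rank m n) (rank k l) then
        bif odd k l then entT red (ccode o k l m n) s i j acc else acc
      else entT red (ccode o m n k l) (bx s (!(odd k l && odd m n))) i j acc
    else entT red (ccode o k l m n) s i j acc
  else acc

/-- Prepends `±` an entry of a value of the differential of a 1-cochain. -/
def d1T (F : Ix → Ix → Bool → Ix → Ix → LF → LF) (k l m n : Ix) (s : Bool) (i j : Ix)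
    (acc : LF) : LF :=
  brT (F k l) s m n i j
    (brT (F m n) (bx s (!(odd k l && odd m n))) k l i j
      (cbrT (fun s a b => F a b s i j) (!s) k l m n acc))

/-- Prepends `±` an entry of an auxiliary term of the differential of a 2-cochain. -/
def dTT (red : Bool) (o : ℕ) (k l m n p q : Ix) (s : Bool) (i j : Ix) (acc : LF) : LF :=
  brT (cT red o k l m n) s p q i j (cbrT (fun s a b => cT red o a b p q s i j) s k l m n acc)

/-- An entry of a value of the differential of a 2-cochain. -/
def d2T (red : Bool) (o : ℕ) (k l m n p q i j : Ix) : LF :=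
  dTT red o k l m n p q false i j
    (dTT red o k l p q m n (!(odd m n && odd p q)) i j
      (dTT red o m n p q k l (odd k l && bx (odd m n) (odd p q)) i j []))

/-- Prepends `±` an entry of a value of the image of a 2-cochain under the matrix unit in the even
position `(P, Q)`. -/
def actT (red : Bool) (o : ℕ) (P Q k l m n : Ix) (s : Bool) (i j : Ix) (acc : LF) : LF :=
  (fun acc => bif i.eq P then cT red o k l m n s Q j acc else acc)
    ((fun acc => bif j.eq Q then cT red o k l m n (!s) i P acc else acc)
      (cbrT (fun s a b => cT red o a b m n s i j) (!s) P Q k l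
        (cbrT (fun s a b => cT red o k l a b s i j) (!s) P Q m n acc)))

/-! ### Enumeration of positions and of the cocycle equations. -/

/-- Concatenates the lists for all positions of negative degree. -/
def forLow {α : Type} (f : Ix → Ix → List α) : List α :=
  f .mid .u0 ++ (f .mid .u1 ++ (f .v0 .u0 ++ (f .v0 .u1 ++ (f .v0 .mid ++ (f .v1 .u0 ++
    (f .v1 .u1 ++ f .v1 .mid))))))

/-- Concatenates the lists for the odd positions of negative degree. -/
def forOdd {α : Type} (f : Ix → Ix → List α) : List α :=
  f .mid .u0 ++ (f .mid .u1 ++ (f .v0 .mid ++ f .v1 .mid))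

/-- Concatenates the lists for all indices. -/
def forIx {α : Type} (f : Ix → List α) : List α :=
  f .u0 ++ (f .u1 ++ (f .mid ++ (f .v0 ++ f .v1)))

/-- Whether an entry of the elements of the complexified algebra is one of the independent ones. -/
def indep (red : Bool) (i j : Ix) : Bool :=
  bif red then !(Nat.blt i.bl j.bl || i.eq .mid && j.eq .mid || i.eq .u1 && j.eq .u1 ||
    i.eq .v1 && j.eq .v1)
  else !(i.eq .mid && j.eq .mid)

/-- Concatenates the lists for all independent entries. -/
def forEnt {α : Type} (red : Bool) (f : Ix → Ix → List α) : List α :=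
  forIx fun i => forIx fun j => bif indep red i j then f i j else []

/-- Equations of 2-cocycles, for triples containing at least two odd elements. -/
def d2rows (red : Bool) (o : ℕ) : List LF :=
  forOdd fun k l => forOdd fun m n => bif Nat.ble (rank k l) (rank m n) then
    forLow fun p q => bif !(odd p q) || Nat.ble (rank m n) (rank p q) then
      forEnt red fun i j => [d2T red o k l m n p q i j] else [] else []

/-- The list of all values of `g` at pairs of basis elements and all independent entries. -/
def pairs {α : Type} (red : Bool) (g : Ix → Ix → Ix → Ix → Ix → Ix → α) : List α :=
  forLow fun k l => forLow fun m n => bif Nat.ble (rank k l) (rank m n) then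
    forEnt red fun i j => [g k l m n i j] else []

/-! ### Integral tables and words in the lowering operators. -/

/-- The coefficient of a variable. -/
def look (T : LF) (n : ℕ) : ℤ :=
  List.rec 0 (fun t _ ih => bif Nat.beq t.1 n then Int.add t.2 ih else ih) T

/-- The value of a linear form at a table of integers. -/
def evZ (T : LF) (l : LF) : ℤ :=
  List.rec 0 (fun t _ ih => Int.add (Int.mul t.2 (look T t.1)) ih) l

/-- Whether an entry of a value at a pair belongs to the part of degree `d` of a cochain. -/
def degOk (d : ℕ) (k l m n i j : Ix) : Bool :=
  Nat.beq (Nat.add j.bl (Nat.add k.bl m.bl)) (Nat.add d (Nat.add i.bl (Nat.add l.bl n.bl)))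

/-- Evaluates a table and passes it on. -/
def tabK {α : Type} (l : List (ℕ × ℤ)) (k : LF → α) : α := LF.addK 1 [] l k

/-- The image of a table of degree `d` under the matrix unit in position `(P, Q)`. -/
def actTab (red : Bool) (d : ℕ) (P Q : Ix) (T : LF) : LF :=
  forLow fun k l => forLow fun m n => bif Nat.ble (rank k l) (rank m n) then
    forEnt red fun i j => bif degOk d k l m n i j then
      [(ccode 0 k l m n i j, evZ T (actT red 0 P Q k l m n false i j []))] else [] else []

/-- Binary trees, which describe words in two operators. -/
inductive Word : Type
  | nil : Word
  | node : Word → Word → Word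

/-- A power of the first operator. -/
def Word.chain : ℕ → Word
  | 0 => .node .nil .nil
  | n + 1 => .node (Word.chain n) .nil

/-- Applies words in the lowering operators to a table and passes on the list of the results. -/
def wordsK {α : Type} (red : Bool) (d : ℕ) (w : Word) :
    LF → List (ℕ × LF) → (List (ℕ × LF) → α) → α :=
  Word.rec (fun _ ws k => k ws)
    (fun _ _ ih₁ ih₂ T ws k => tabK T fun T =>
      ih₁ (actTab red d .u1 .u0 T) ((d, T) :: ws) fun ws =>
        ih₂ (actTab red d .v0 .v1 T) ws k) w

/-- Applies words in the lowering operators to tables and passes on the list of the results. -/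
def allWordsK {α : Type} (red : Bool) (l : List (ℕ × LF × Word)) :
    List (ℕ × LF) → (List (ℕ × LF) → α) → α :=
  List.rec (fun ws k => k ws)
    (fun t _ ih ws k => wordsK red t.1 t.2.2 t.2.1 ws fun ws => ih ws k) l

/-- The linear combination of the values of tables with the variables from `o` on as
coefficients. -/
def combT (red : Bool) (k l m n i j : Ix) (ws : List (ℕ × LF)) : ℕ → LF :=
  List.rec (fun _ => [])
    (fun w _ ih o => bif degOk w.1 k l m n i j then
      (o, evZ w.2 (cT red 0 k l m n false i j [])) :: ih (Nat.add o 1) else ih (Nat.add o 1)) ws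

/-! ### The linear systems and the checks. -/

/-- The equations `d f + ∑ z_w w = c` for a 1-cochain `f`, with tables `w` and a 2-cochain `c`. -/
def spanRows (red : Bool) (ws : List (ℕ × LF)) : List LF :=
  pairs red fun k l m n i j => d1T (fT red 0) k l m n false i j
    (cT red 2000 k l m n true i j (combT red k l m n i j ws 625))

/-- The equations `d f + ∑ z_w w = 0` for a 1-cochain `f`, with tables `w`. -/
def relRows (red : Bool) (ws : List (ℕ × LF)) : List LF :=
  pairs red fun k l m n i j => d1T (fT red 0) k l m n false i j (combT red k l m n i j ws 625)

/-- The equations `e c = d g` for a matrix unit `e` in position `(P, Q)`. -/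
def actRows (red : Bool) (o : ℕ) (P Q : Ix) : List LF :=
  pairs red fun k l m n i j => d1T (fT red o) k l m n true i j
    (actT red 2000 P Q k l m n false i j [])

/-- Whether the cocycles are generated by the given words modulo coboundaries. -/
def checkSpan (red : Bool) (l : List (ℕ × LF × Word)) : Bool :=
  allWordsK red l [] fun ws => solvable 700 (d2rows red 2000) (spanRows red ws)

/-- Whether the classes annihilated by the raising operators are spanned by the given tables. -/
def checkHW (red : Bool) (ws : List (ℕ × LF)) : Bool :=
  solvable 700 (actRows red 700 .u0 .u1 ++ (actRows red 1325 .v1 .v0 ++ d2rows red 2000))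
    (spanRows red ws)

/-- Whether the tables are linearly independent modulo coboundaries. -/
def checkIndep (red : Bool) (ws : List (ℕ × LF)) : Bool :=
  implied (relRows red ws) ((List.range ws.length).map fun i => [(625 + i, 1)])

/-- Whether derivations of degree `d` are inner. -/
def checkInner (red : Bool) (d : ℕ) : Bool :=
  solvable 25 (pairs red fun k l m n i j => d1T (fdT red d 25) k l m n false i j [])
    (forLow fun k l => forIx fun i => forIx fun j => [brT (fun s i j acc =>
      bif Nat.beq j.bl (Nat.add i.bl d) then entT red rank s i j acc else acc) false k l i j
        (fdT red d 25 k l true i j [])])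

/-- Whether the elements of nonnegative degree which commute with the negative part vanish. -/
def checkTransitive (red : Bool) : Bool :=
  implied
    (forLow fun k l => forIx fun i => forIx fun j => [brT (fun s i j acc =>
      bif Nat.ble i.bl j.bl then entT red rank s i j acc else acc) false k l i j []])
    (forEnt red fun i j => bif Nat.ble i.bl j.bl then [[(rank i j, 1)]] else [])

open Complex (I)

/-! ## Matrix units and the meaning of the linear forms -/

/-- The index of a supermatrix. -/
def Ix.toIdx : Ix → Idx
  | .u0 => .inl 0
  | .u1 => .inl 1
  | .mid => .inr (.inl 0)
  | .v0 => .inr (.inr 0)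
  | .v1 => .inr (.inr 1)

theorem Ix.toIdx_inj {k l : Ix} : k.toIdx = l.toIdx ↔ k = l := by
  cases k <;> cases l <;> simp [Ix.toIdx]

theorem Ix.exists_toIdx (i : Idx) : ∃ k : Ix, k.toIdx = i := by
  rcases i with i | i | i
  · fin_cases i
    exacts [⟨.u0, rfl⟩, ⟨.u1, rfl⟩]
  · fin_cases i
    exact ⟨.mid, rfl⟩
  · fin_cases i
    exacts [⟨.v0, rfl⟩, ⟨.v1, rfl⟩]

theorem Ix.eq_eq (k l : Ix) : k.eq l = decide (k = l) := by
  cases k <;> cases l <;> rfl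

/-- The matrix units. -/
def mu (k l : Ix) : SMat := Matrix.single k.toIdx l.toIdx 1

/-- The entries of a supermatrix. -/
def SMat.at (X : SMat) (i j : Ix) : ℂ := X i.toIdx j.toIdx

theorem at_ext {X Y : SMat} (h : ∀ i j, SMat.at X i j = SMat.at Y i j) : X = Y := by
  ext i j
  obtain ⟨k, rfl⟩ := Ix.exists_toIdx i
  obtain ⟨l, rfl⟩ := Ix.exists_toIdx j
  exact h k l

theorem at_add (X Y : SMat) (i j : Ix) : SMat.at (X + Y) i j = SMat.at X i j + SMat.at Y i j := rfl
theorem at_sub (X Y : SMat) (i j : Ix) : SMat.at (X - Y) i j = SMat.at X i j - SMat.at Y i j := rfl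
theorem at_neg (X : SMat) (i j : Ix) : SMat.at (-X) i j = -SMat.at X i j := rfl
theorem at_zero (i j : Ix) : SMat.at 0 i j = 0 := rfl
theorem at_smul (z : ℂ) (X : SMat) (i j : Ix) : SMat.at (z • X) i j = z * SMat.at X i j := rfl

theorem at_mu (k l i j : Ix) : SMat.at (mu k l) i j = if i = k ∧ j = l then 1 else 0 := by
  simp only [SMat.at, mu, Matrix.single_apply, Ix.toIdx_inj, eq_comm]

theorem blk_toIdx (k : Ix) : blk k.toIdx = k.bl := by cases k <;> rfl

theorem odd_iff (k l : Ix) : ((eDeg k.toIdx l.toIdx : ℤ) : ZMod 2) = 1 ↔ odd k l = true := by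
  cases k <;> cases l <;> decide

/-- The parity of a matrix position. -/
def par (k l : Ix) : ZMod 2 := bif odd k l then 1 else 0

theorem par_eq (k l : Ix) : ((eDeg k.toIdx l.toIdx : ℤ) : ZMod 2) = par k l := by
  cases k <;> cases l <;> decide

theorem ksgn_cond : ∀ a b : Bool, ksgn (bif a then 1 else 0) (bif b then 1 else 0) = sgn (a && b) := by
  intro a b
  cases a <;> cases b <;> simp [ksgn, sgn]

theorem ksgn_par (k l m n : Ix) : ksgn (par k l) (par m n) = sgn (odd k l && odd m n) :=
  ksgn_cond _ _

theorem ksgn_par_add (k l m n p q : Ix) : ksgn (par k l) (par m n + par p q) =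
    sgn (odd k l && bx (odd m n) (odd p q)) := by
  have h : ∀ a b : Bool, ((bif a then 1 else 0 : ZMod 2) + bif b then 1 else 0) =
      bif bx a b then 1 else 0 := by decide
  rw [par, par, par, h, ksgn_cond]

theorem sgn_bx (a b : Bool) : ((sgn (bx a b) : ℤ) : ℂ) = sgn a * sgn b := by
  cases a <;> cases b <;> simp [sgn, bx]

theorem sgn_not (a : Bool) : ((sgn (!a) : ℤ) : ℂ) = -sgn a := by
  cases a <;> simp [sgn]

theorem sgn_mul_self (a : Bool) : ((sgn a : ℤ) : ℂ) * sgn a = 1 := by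
  cases a <;> simp [sgn]

theorem at_oddPart (X : SMat) (i j : Ix) :
    SMat.at (oddPart X) i j = if odd i j = true then SMat.at X i j else 0 := by
  simp only [SMat.at, oddPart, LinearMap.coe_mk, AddHom.coe_mk, Matrix.of_apply, odd_iff]

/-- The superbracket is complex bilinear. -/
def sbC : SMat →ₗ[ℂ] SMat →ₗ[ℂ] SMat :=
  LinearMap.mk₂ ℂ (fun X Y => sb X Y) (fun X X' Y => by simp)
    (fun z X Y => by
      have h : oddPart (z • X) = z • oddPart X := by
        refine at_ext fun i j => ?_
        simp only [at_oddPart, at_smul]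
        split_ifs <;> simp
      simp only [sb_apply, h, smul_mul_assoc, mul_smul_comm, smul_add, smul_sub,
        smul_comm z (2 : ℝ)])
    (fun X Y Y' => by simp)
    (fun z X Y => by
      have h : oddPart (z • Y) = z • oddPart Y := by
        refine at_ext fun i j => ?_
        simp only [at_oddPart, at_smul]
        split_ifs <;> simp
      simp only [sb_apply, h, smul_mul_assoc, mul_smul_comm, smul_add, smul_sub,
        smul_comm z (2 : ℝ)])

theorem sbC_apply (X Y : SMat) : sbC X Y = sb X Y := rfl

theorem at_mul_mu (X : SMat) (k l i j : Ix) :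
    SMat.at (X * mu k l) i j = if j = l then SMat.at X i k else 0 := by
  simp only [SMat.at, mu, Matrix.mul_apply, Matrix.single_apply, mul_ite, mul_one, mul_zero]
  by_cases h : j = l
  · simp [h]
  · have h' : ¬ l.toIdx = j.toIdx := fun e => h (Ix.toIdx_inj.1 e).symm
    simp [h, h']

theorem at_mu_mul (X : SMat) (k l i j : Ix) :
    SMat.at (mu k l * X) i j = if i = k then SMat.at X l j else 0 := by
  simp only [SMat.at, mu, Matrix.mul_apply, Matrix.single_apply, ite_mul, one_mul, zero_mul]
  by_cases h : i = k
  · simp [h]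
  · have h' : ¬ k.toIdx = i.toIdx := fun e => h (Ix.toIdx_inj.1 e).symm
    simp [h, h']

theorem oddPart_mu (k l : Ix) : oddPart (mu k l) = if odd k l = true then mu k l else 0 := by
  refine at_ext fun i j => ?_
  rw [at_oddPart, at_mu]
  by_cases h : i = k ∧ j = l
  · obtain ⟨rfl, rfl⟩ := h
    by_cases h : odd i j = true <;> simp [h, at_mu, at_zero]
  · rw [if_neg h, ite_self]
    by_cases h2 : odd k l = true <;> simp [h2, at_mu, at_zero, h]

/-- The entry of `X` that left multiplication by the matrix unit moves to `(i, j)` is the one at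
`(l, j)`. Its parity determines the sign, so the formula also holds for inhomogeneous `X`. -/
theorem at_sb_mu (X : SMat) (k l i j : Ix) : SMat.at (sbC X (mu k l)) i j =
    (if j = l then SMat.at X i k else 0) +
      if i = k then (sgn (!(odd l j && odd k l)) : ℂ) * SMat.at X l j else 0 := by
  have h2 : ∀ Y : SMat, SMat.at ((2 : ℝ) • Y) i j = 2 * SMat.at Y i j := fun Y => by
    simp [SMat.at]
  rw [sbC_apply, sb_apply, at_add, at_sub, at_mul_mu, at_mu_mul, h2, oddPart_mu]
  by_cases h : i = k
  · cases h3 : odd k l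
    · simp [h, at_zero, sgn, sub_eq_add_neg]
    · simp only [h, if_true, at_mu_mul, at_oddPart]
      cases odd l j
      · simp [sgn, sub_eq_add_neg]
      · simp [sgn]
        ring
  · split_ifs <;> simp [at_mu_mul, h, at_zero]

theorem sb_mu_mu (k l m n : Ix) : sbC (mu k l) (mu m n) =
    (if l = m then mu k n else 0) +
      if n = k then (sgn (!(odd k l && odd m n)) : ℂ) • mu m l else 0 := by
  refine at_ext fun i j => ?_
  rw [at_sb_mu, at_add]
  congr 1
  · by_cases h : l = m
    · subst h; by_cases h2 : j = n <;> simp [at_mu, h2]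
    · have : ¬ m = l := fun e => h e.symm
      simp [at_mu, h, this, at_zero]
  · by_cases h : n = k
    · subst h
      by_cases h2 : i = m
      · by_cases h3 : j = l
        · subst h2 h3; simp [at_mu, at_smul]
        · simp [at_mu, at_smul, h3]
      · simp [at_mu, at_smul, h2]
    · simp [at_mu, at_zero, h]

/-! ### Correctness of the encodings. -/

/-- `X` prepends `±` the numbers `x i j` to a linear form. -/
def Emits (v : ℕ → ℂ) (X : Bool → Ix → Ix → LF → LF) (x : Ix → Ix → ℂ) : Prop :=
  ∀ s i j acc, LF.ev v (X s i j acc) = sgn s * x i j + LF.ev v acc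

theorem Emits.brT {v : ℕ → ℂ} {X : Bool → Ix → Ix → LF → LF} {x : SMat}
    (h : Emits v X (SMat.at x)) (k l : Ix) :
    Emits v (fun s i j acc => brT X s k l i j acc) (SMat.at (sbC x (mu k l))) := by
  intro s i j acc
  simp only [MinkowskiSuper.brT, at_sb_mu, Ix.eq_eq]
  by_cases h1 : j = l <;> by_cases h2 : i = k <;>
    simp only [h1, h2, decide_true, decide_false, cond_true, cond_false, if_true, if_false, h _ _ _ _,
      sgn_bx] <;> ring

theorem Emits.cbrT {v : ℕ → ℂ} {G : Bool → Ix → Ix → LF → LF} {g : SMat →ₗ[ℂ] ℂ}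
    (h : Emits v G fun a b => g (mu a b)) (s : Bool) (k l m n : Ix) (acc : LF) :
    LF.ev v (cbrT G s k l m n acc) = sgn s * g (sbC (mu k l) (mu m n)) + LF.ev v acc := by
  simp only [MinkowskiSuper.cbrT, sb_mu_mu, Ix.eq_eq]
  by_cases h1 : l = m <;> by_cases h2 : n = k <;>
    simp only [h1, h2, decide_true, decide_false, cond_true, cond_false, if_true, if_false, h _ _ _ _,
      sgn_bx, map_add, map_smul, map_zero, smul_eq_mul] <;> ring

/-- The entry of a supermatrix as a linear functional. -/
def atL (i j : Ix) : SMat →ₗ[ℂ] ℂ where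
  toFun X := SMat.at X i j
  map_add' _ _ := rfl
  map_smul' _ _ := rfl

theorem atL_apply (i j : Ix) (X : SMat) : atL i j X = SMat.at X i j := rfl

/-- Complex 1-cochains. -/
abbrev CC1 : Type := SMat →ₗ[ℂ] SMat

/-- Complex bilinear maps. -/
abbrev CC2 : Type := SMat →ₗ[ℂ] SMat →ₗ[ℂ] SMat

/-- The differential of a complex 1-cochain, where `ε` is the sign for `X` and `Y`. -/
def d1C (F : CC1) (ε : ℂ) (X Y : SMat) : SMat :=
  sbC (F X) Y - ε • sbC (F Y) X - F (sbC X Y)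

/-- The summand of the differential of a complex 2-cochain in which `Z` is the last argument. -/
def dTC (C : CC2) (X Y Z : SMat) : SMat := sbC (C X Y) Z + C (sbC X Y) Z

/-- Minus the differential of a complex 2-cochain, where `ε` and `ε'` are signs for the arguments. -/
def d2C (C : CC2) (ε ε' : ℂ) (X Y Z : SMat) : SMat :=
  dTC C X Y Z - ε • dTC C X Z Y + ε' • dTC C Y Z X

/-- The action of `h` on complex 2-cochains. -/
def actC (h : SMat) (C : CC2) (X Y : SMat) : SMat :=
  sbC h (C X Y) - C (sbC h X) Y - C X (sbC h Y)

/-- Correctness is relative to an arbitrary encoding of the values of `f`. Hence it serves general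
1-cochains (`fT`) as well as homogeneous ones with fewer variables (`fdT`). -/
theorem emits_d1T {v : ℕ → ℂ} {F : Ix → Ix → Bool → Ix → Ix → LF → LF} {f : CC1}
    (h : ∀ k l, Emits v (F k l) (SMat.at (f (mu k l)))) (k l m n : Ix) :
    Emits v (d1T F k l m n)
      (SMat.at (d1C f (sgn (odd k l && odd m n)) (mu k l) (mu m n))) := by
  intro s i j acc
  -- In the term with the bracket inside `f` the entry is fixed and the argument varies, so the same
  -- encoding is read as a linear functional of the argument.
  have h3 : Emits v (fun s a b => F a b s i j) fun a b => (atL i j ∘ₗ f) (mu a b) :=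
    fun s a b acc => h a b s i j acc
  rw [d1T, (h k l).brT m n, (h m n).brT k l, h3.cbrT, sgn_bx, sgn_not, sgn_not, d1C, at_sub, at_sub,
    at_smul, LinearMap.comp_apply, atL_apply]
  ring

theorem emits_d2T {red : Bool} {o : ℕ} {v : ℕ → ℂ} {C : CC2}
    (h : ∀ k l m n, Emits v (cT red o k l m n) (SMat.at (C (mu k l) (mu m n))))
    (k l m n p q i j : Ix) :
    LF.ev v (d2T red o k l m n p q i j) =
      SMat.at (d2C C (sgn (odd m n && odd p q)) (sgn (odd k l && bx (odd m n) (odd p q)))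
        (mu k l) (mu m n) (mu p q)) i j := by
  have key : ∀ (k l m n p q : Ix) s i j acc, LF.ev v (dTT red o k l m n p q s i j acc) =
      sgn s * SMat.at (dTC C (mu k l) (mu m n) (mu p q)) i j + LF.ev v acc := by
    intro k l m n p q s i j acc
    have h3 : Emits v (fun s a b => cT red o a b p q s i j)
        fun a b => (atL i j ∘ₗ C.flip (mu p q)) (mu a b) :=
      fun s a b acc => h a b p q s i j acc
    rw [dTT, (h k l m n).brT p q, h3.cbrT, dTC, at_add, LinearMap.comp_apply, atL_apply,
      LinearMap.flip_apply]
    ring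
  rw [d2T, key, key, key, sgn_not, d2C, at_add, at_sub, at_smul, at_smul]
  simp [sgn, LF.ev]
  ring

theorem at_sb_mu_left (X : SMat) (P Q i j : Ix) (h : odd P Q = false) :
    SMat.at (sbC (mu P Q) X) i j =
      (if i = P then SMat.at X Q j else 0) - if j = Q then SMat.at X i P else 0 := by
  rw [sbC_apply, sb_apply, oddPart_mu, h]
  simp [at_sub, at_mul_mu, at_mu_mul]

theorem emits_actT {red : Bool} {o : ℕ} {v : ℕ → ℂ} {C : CC2}
    (h : ∀ k l m n, Emits v (cT red o k l m n) (SMat.at (C (mu k l) (mu m n)))) {P Q : Ix}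
    (hPQ : odd P Q = false) (k l m n : Ix) :
    Emits v (actT red o P Q k l m n) (SMat.at (actC (mu P Q) C (mu k l) (mu m n))) := by
  intro s i j acc
  have h3 : Emits v (fun s a b => cT red o a b m n s i j)
      fun a b => (atL i j ∘ₗ C.flip (mu m n)) (mu a b) := fun s a b acc => h a b m n s i j acc
  have h4 : Emits v (fun s a b => cT red o k l a b s i j)
      fun a b => (atL i j ∘ₗ C (mu k l)) (mu a b) := fun s a b acc => h k l a b s i j acc
  have e : SMat.at (actC (mu P Q) C (mu k l) (mu m n)) i j =
      ((if i = P then SMat.at (C (mu k l) (mu m n)) Q j else 0)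
        - if j = Q then SMat.at (C (mu k l) (mu m n)) i P else 0)
      - (atL i j ∘ₗ C.flip (mu m n)) (sbC (mu P Q) (mu k l))
      - (atL i j ∘ₗ C (mu k l)) (sbC (mu P Q) (mu m n)) := by
    rw [← at_sb_mu_left _ _ _ _ _ hPQ]
    rfl
  have e5 : ∀ acc, LF.ev v (bif i.eq P then cT red o k l m n s Q j acc else acc) =
      sgn s * (if i = P then SMat.at (C (mu k l) (mu m n)) Q j else 0) + LF.ev v acc := by
    intro acc
    rw [Ix.eq_eq]
    by_cases h1 : i = P
    · simp [h1, h k l m n s Q j]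
    · simp [h1]
  have e6 : ∀ acc, LF.ev v (bif j.eq Q then cT red o k l m n (!s) i P acc else acc) =
      -sgn s * (if j = Q then SMat.at (C (mu k l) (mu m n)) i P else 0) + LF.ev v acc := by
    intro acc
    rw [Ix.eq_eq]
    by_cases h1 : j = Q
    · simp [h1, h k l m n (!s) i P, sgn_not]
    · simp [h1]
  rw [actT, e, e5, e6, h3.cbrT, h4.cbrT, sgn_not]
  ring

/-! ## Complex cochains and their coordinates -/

instance : Fintype Ix :=
  ⟨{.u0, .u1, .mid, .v0, .v1}, fun k => by cases k <;> simp⟩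

/-- The index with the given image. -/
def Ix.ofIdx : Idx → Ix
  | .inl 0 => .u0
  | .inl 1 => .u1
  | .inr (.inl _) => .mid
  | .inr (.inr 0) => .v0
  | .inr (.inr 1) => .v1

theorem Ix.ofIdx_toIdx (k : Ix) : Ix.ofIdx k.toIdx = k := by cases k <;> rfl

/-- The supermatrix with given entries. -/
def ofAt (x : Ix → Ix → ℂ) : SMat := Matrix.of fun i j => x (Ix.ofIdx i) (Ix.ofIdx j)

theorem at_ofAt (x : Ix → Ix → ℂ) : SMat.at (ofAt x) = x := by
  funext i j
  simp [SMat.at, ofAt, Ix.ofIdx_toIdx]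

theorem at_sum {ι : Type*} (s : Finset ι) (f : ι → SMat) (i j : Ix) :
    SMat.at (∑ a ∈ s, f a) i j = ∑ a ∈ s, SMat.at (f a) i j :=
  map_sum (atL i j) f s

/-- The linear map with given values at the matrix units. -/
def linExt {M : Type*} [AddCommGroup M] [Module ℂ M] (A : Ix → Ix → M) : SMat →ₗ[ℂ] M :=
  ∑ k, ∑ l, (atL k l).smulRight (A k l)

section
variable {M : Type*} [AddCommGroup M] [Module ℂ M]

theorem linExt_apply (A : Ix → Ix → M) (X : SMat) :
    linExt A X = ∑ k, ∑ l, SMat.at X k l • A k l := by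
  simp [linExt, LinearMap.sum_apply, atL_apply]

theorem linExt_mu (A : Ix → Ix → M) (k l : Ix) : linExt A (mu k l) = A k l := by
  rw [linExt_apply, Finset.sum_eq_single k, Finset.sum_eq_single l]
  · simp [at_mu]
  · intro b _ h; simp [at_mu, h]
  · simp
  · intro b _ h; simp [at_mu, h]
  · simp

theorem eq_sum_mu (X : SMat) : X = ∑ k, ∑ l, SMat.at X k l • mu k l := by
  refine at_ext fun i j => ?_
  rw [at_sum, Finset.sum_eq_single i, at_sum, Finset.sum_eq_single j]
  · simp [at_smul, at_mu]
  · intro b _ h; simp [at_smul, at_mu, h.symm]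
  · simp
  · intro b _ h
    rw [at_sum]
    exact Finset.sum_eq_zero fun l _ => by simp [at_smul, at_mu, h.symm]
  · simp

theorem hom_ext_mu {T T' : SMat →ₗ[ℂ] M} (h : ∀ k l, T (mu k l) = T' (mu k l)) : T = T' := by
  ext X : 1
  rw [eq_sum_mu X]
  simp only [map_sum, map_smul, h]

theorem hom₂_ext_mu {T T' : SMat →ₗ[ℂ] SMat →ₗ[ℂ] M}
    (h : ∀ k l m n, T (mu k l) (mu m n) = T' (mu k l) (mu m n)) : T = T' :=
  hom_ext_mu fun k l => hom_ext_mu fun m n => h k l m n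

end

/-! ### The complexified algebras and the spaces of complex cochains. -/

/-- The entries of the elements of the complexified algebra, in terms of the independent ones. -/
def fill (r : Bool) (x : Ix → Ix → ℂ) (i j : Ix) : ℂ :=
  bif r then
    bif Nat.blt i.bl j.bl || (i.eq .mid && j.eq .mid) then 0
    else bif i.eq .u1 && j.eq .u1 then -x .u0 .u0
    else bif i.eq .v1 && j.eq .v1 then -x .v0 .v0
    else x i j
  else
    bif i.eq .mid && j.eq .mid then x .u0 .u0 + x .u1 .u1 + x .v0 .v0 + x .v1 .v1
    else x i j

theorem emits_entT (r : Bool) (f : Ix → Ix → ℕ) (v : ℕ → ℂ) :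
    Emits v (entT r f) (fill r fun i j => v (f i j)) := by
  intro s i j acc
  cases r
  · simp only [entT, fill, cond_false]
    cases i.eq .mid && j.eq .mid <;> simp only [cond_false, cond_true, LF.ev]
    ring
  · simp only [entT, fill, cond_true]
    cases Nat.blt i.bl j.bl || (i.eq .mid && j.eq .mid) <;> simp only [cond_false, cond_true]
    · cases i.eq .u1 && j.eq .u1 <;> simp only [cond_false, cond_true]
      · cases i.eq .v1 && j.eq .v1 <;> simp only [cond_false, cond_true, LF.ev, sgn_not]
        ring
      · simp only [LF.ev, sgn_not]
        ring
    · ring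

theorem fill_of_indep {r : Bool} {i j : Ix} (h : indep r i j = true) (x : Ix → Ix → ℂ) :
    fill r x i j = x i j := by
  cases r <;> cases i <;> cases j <;> first | rfl | exact absurd h (by decide)

theorem fill_congr {r : Bool} {x y : Ix → Ix → ℂ} (h : ∀ i j, indep r i j = true → x i j = y i j) :
    fill r x = fill r y := by
  funext i j
  by_cases hi : indep r i j = true
  · rw [fill_of_indep hi, fill_of_indep hi, h i j hi]
  · cases r
    · simp only [fill, h .u0 .u0 rfl, h .u1 .u1 rfl, h .v0 .v0 rfl, h .v1 .v1 rfl]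
      cases i <;> cases j <;> first | rfl | exact absurd rfl hi
    · simp only [fill, h .u0 .u0 rfl, h .v0 .v0 rfl]
      cases i <;> cases j <;> first | rfl | exact absurd rfl hi

theorem fill_fill (r : Bool) (x : Ix → Ix → ℂ) : fill r (fill r x) = fill r x :=
  fill_congr fun _ _ h => fill_of_indep h x

theorem fill_add (r : Bool) (x y : Ix → Ix → ℂ) (i j : Ix) :
    fill r (fun i j => x i j + y i j) i j = fill r x i j + fill r y i j := by
  cases r <;> simp only [fill, cond_true, cond_false]
  · cases i.eq .mid && j.eq .mid <;> simp only [cond_true, cond_false]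
    ring
  · cases Nat.blt i.bl j.bl || (i.eq .mid && j.eq .mid) <;> cases i.eq .u1 && j.eq .u1 <;>
      cases i.eq .v1 && j.eq .v1 <;> simp only [cond_true, cond_false] <;> ring

theorem fill_smul (r : Bool) (z : ℂ) (x : Ix → Ix → ℂ) (i j : Ix) :
    fill r (fun i j => z * x i j) i j = z * fill r x i j := by
  cases r <;> simp only [fill, cond_true, cond_false]
  · cases i.eq .mid && j.eq .mid <;> simp only [cond_true, cond_false]
    ring
  · cases Nat.blt i.bl j.bl || (i.eq .mid && j.eq .mid) <;> cases i.eq .u1 && j.eq .u1 <;>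
      cases i.eq .v1 && j.eq .v1 <;> simp only [cond_true, cond_false] <;> ring

/-- The complexified algebras. -/
def gC (r : Bool) : Submodule ℂ SMat where
  carrier := {X | ∀ i j, SMat.at X i j = fill r (SMat.at X) i j}
  add_mem' {X Y} hX hY i j := by
    have e : SMat.at (X + Y) = fun i j => SMat.at X i j + SMat.at Y i j := rfl
    rw [e, fill_add, ← hX, ← hY]
  zero_mem' i j := by
    have e : SMat.at 0 = fun i j => 0 * SMat.at 0 i j := by funext i j; rw [zero_mul]; rfl
    rw [e, fill_smul]
    simp
  smul_mem' z X hX i j := by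
    have e : SMat.at (z • X) = fun i j => z * SMat.at X i j := rfl
    rw [e, fill_smul, ← hX]

theorem ofAt_mem_gC {r : Bool} {x : Ix → Ix → ℂ} (h : fill r x = x) : ofAt x ∈ gC r := by
  intro i j
  rw [at_ofAt, h]

theorem gC_ext {r : Bool} {X Y : SMat} (hX : X ∈ gC r) (hY : Y ∈ gC r)
    (h : ∀ i j, indep r i j = true → SMat.at X i j = SMat.at Y i j) : X = Y :=
  at_ext fun i j => by rw [hX, hY, fill_congr h]

/-- The complex 1-cochains. -/
def coch1 (r : Bool) : Submodule ℂ CC1 where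
  carrier := {F | ∀ k l, (low k l = false → F (mu k l) = 0) ∧ F (mu k l) ∈ gC r}
  add_mem' {F G} hF hG k l := ⟨fun h => by
    rw [LinearMap.add_apply, (hF k l).1 h, (hG k l).1 h, add_zero], add_mem (hF k l).2 (hG k l).2⟩
  zero_mem' k l := ⟨fun _ => rfl, zero_mem _⟩
  smul_mem' z F hF k l := ⟨fun h => by
    rw [LinearMap.smul_apply, (hF k l).1 h, smul_zero], (gC r).smul_mem z (hF k l).2⟩

/-- The complex 2-cochains. -/
def coch (r : Bool) : Submodule ℂ CC2 where
  carrier := {C | ∀ k l m n, (low k l = false → C (mu k l) (mu m n) = 0) ∧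
    C (mu m n) (mu k l) = -((sgn (odd k l && odd m n) : ℂ) • C (mu k l) (mu m n)) ∧
    C (mu k l) (mu m n) ∈ gC r}
  add_mem' {C D} hC hD k l m n := by
    refine ⟨fun h => ?_, ?_, add_mem (hC k l m n).2.2 (hD k l m n).2.2⟩
    · rw [LinearMap.add_apply, LinearMap.add_apply, (hC k l m n).1 h, (hD k l m n).1 h, add_zero]
    · simp only [LinearMap.add_apply, (hC k l m n).2.1, (hD k l m n).2.1, smul_add]
      abel
  zero_mem' k l m n := ⟨fun _ => rfl, by simp, zero_mem _⟩
  smul_mem' z C hC k l m n := by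
    refine ⟨fun h => ?_, ?_, (gC r).smul_mem z (hC k l m n).2.2⟩
    · rw [LinearMap.smul_apply, LinearMap.smul_apply, (hC k l m n).1 h, smul_zero]
    · simp only [LinearMap.smul_apply, (hC k l m n).2.1, smul_neg, smul_comm z]

theorem coch_right {r : Bool} {C : CC2} (hC : C ∈ coch r) {k l m n : Ix} (h : low m n = false) :
    C (mu k l) (mu m n) = 0 := by
  rw [(hC m n k l).2.1, (hC m n k l).1 h, smul_zero, neg_zero]

theorem Ix.num_lt (k : Ix) : k.num < 5 := by cases k <;> decide

theorem Ix.num_inj {k l : Ix} (h : k.num = l.num) : k = l := by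
  cases k <;> cases l <;> first | rfl | exact absurd h (by decide)

theorem rank_eq (k l : Ix) : rank k l = k.num * 5 + l.num := rfl

theorem rank_inj {k l m n : Ix} (h : rank k l = rank m n) : k = m ∧ l = n := by
  have h1 := l.num_lt
  have h2 := n.num_lt
  rw [rank_eq, rank_eq] at h
  exact ⟨Ix.num_inj (by omega), Ix.num_inj (by omega)⟩

/-! ### Coordinates of complex cochains. -/

/-- Whether a position in the table of a 2-cochain is one of the independent ones. -/
def canon (r : Bool) (k l m n i j : Ix) : Prop :=
  low k l = true ∧ low m n = true ∧ rank k l ≤ rank m n ∧ indep r i j = true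

/-- Superantisymmetry leaves only pairs ordered by rank, and the equations of `gC` leave only the
independent entries. -/
theorem coch_ext {r : Bool} {C D : CC2} (hC : C ∈ coch r) (hD : D ∈ coch r)
    (h : ∀ k l m n i j, canon r k l m n i j →
      SMat.at (C (mu k l) (mu m n)) i j = SMat.at (D (mu k l) (mu m n)) i j) : C = D := by
  have key : ∀ k l m n, low k l = true → low m n = true → rank k l ≤ rank m n →
      C (mu k l) (mu m n) = D (mu k l) (mu m n) := fun k l m n h1 h2 h3 =>
    gC_ext (hC k l m n).2.2 (hD k l m n).2.2 fun i j h4 => h k l m n i j ⟨h1, h2, h3, h4⟩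
  refine hom₂_ext_mu fun k l m n => ?_
  cases h1 : low k l
  · rw [(hC k l m n).1 h1, (hD k l m n).1 h1]
  cases h2 : low m n
  · rw [coch_right hC h2, coch_right hD h2]
  rcases le_total (rank k l) (rank m n) with h3 | h3
  · exact key k l m n h1 h2 h3
  · rw [(hC m n k l).2.1, (hD m n k l).2.1, key m n k l h2 h1 h3]

/-- The entries of the values of the 1-cochain given by a valuation. -/
def fval (r : Bool) (o : ℕ) (v : ℕ → ℂ) (k l i j : Ix) : ℂ :=
  bif low k l then fill r (fun i j => v (fcode o k l i j)) i j else 0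

/-- The entries of the values of the 2-cochain given by a valuation. -/
def cval (r : Bool) (o : ℕ) (v : ℕ → ℂ) (k l m n i j : Ix) : ℂ :=
  bif low k l && low m n then
    bif Nat.ble (rank m n) (rank k l) then
      bif Nat.beq (rank m n) (rank k l) then
        bif odd k l then fill r (fun i j => v (ccode o k l m n i j)) i j else 0
      else sgn (!(odd k l && odd m n)) * fill r (fun i j => v (ccode o m n k l i j)) i j
    else fill r (fun i j => v (ccode o k l m n i j)) i j
  else 0

/-- The 1-cochain given by a valuation. -/
def mkF (r : Bool) (o : ℕ) (v : ℕ → ℂ) : CC1 := linExt fun k l => ofAt (fval r o v k l)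

/-- The 2-cochain given by a valuation. -/
def mkC (r : Bool) (o : ℕ) (v : ℕ → ℂ) : CC2 :=
  linExt fun k l => linExt fun m n => ofAt (cval r o v k l m n)

theorem at_mkF (r : Bool) (o : ℕ) (v : ℕ → ℂ) (k l : Ix) :
    SMat.at (mkF r o v (mu k l)) = fval r o v k l := by
  rw [mkF, linExt_mu, at_ofAt]

theorem at_mkC (r : Bool) (o : ℕ) (v : ℕ → ℂ) (k l m n : Ix) :
    SMat.at (mkC r o v (mu k l) (mu m n)) = cval r o v k l m n := by
  rw [mkC, linExt_mu, linExt_mu, at_ofAt]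

theorem emits_fT (r : Bool) (o : ℕ) (v : ℕ → ℂ) (k l : Ix) :
    Emits v (fT r o k l) (SMat.at (mkF r o v (mu k l))) := by
  intro s i j acc
  rw [at_mkF, fT, fval]
  cases low k l
  · simp
  · simp [emits_entT r _ v s i j acc]

theorem emits_cT (r : Bool) (o : ℕ) (v : ℕ → ℂ) (k l m n : Ix) :
    Emits v (cT r o k l m n) (SMat.at (mkC r o v (mu k l) (mu m n))) := by
  intro s i j acc
  rw [at_mkC, cT, cval]
  cases low k l && low m n <;> simp only [cond_false, cond_true, mul_zero, zero_add]
  cases Nat.ble (rank m n) (rank k l) <;> simp only [cond_false, cond_true]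
  · exact emits_entT r _ v s i j acc
  cases Nat.beq (rank m n) (rank k l) <;> simp only [cond_false, cond_true]
  · rw [emits_entT r _ v _ i j acc, sgn_bx, mul_assoc]
  cases odd k l <;> simp only [cond_false, cond_true, mul_zero, zero_add]
  exact emits_entT r _ v s i j acc

theorem fill_zero (r : Bool) : fill r (fun _ _ => 0) = fun _ _ => 0 := by
  have e : (fun _ _ => 0 : Ix → Ix → ℂ) = fun _ _ => 0 * 0 := by simp
  funext i j
  rw [e, fill_smul, zero_mul]

theorem mkF_mem (r : Bool) (o : ℕ) (v : ℕ → ℂ) : mkF r o v ∈ coch1 r := by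
  intro k l
  rw [mkF, linExt_mu]
  have e : fval r o v k l = if low k l then fill r (fun i j => v (fcode o k l i j))
      else fun _ _ => 0 := by
    funext i j
    rw [fval]
    cases low k l <;> rfl
  refine ⟨fun h => at_ext fun i j => ?_, ofAt_mem_gC ?_⟩
  · rw [at_ofAt, e, h]; rfl
  · rw [e]
    split_ifs
    · exact fill_fill _ _
    · exact fill_zero r

theorem mkC_mem (r : Bool) (o : ℕ) (v : ℕ → ℂ) : mkC r o v ∈ coch r := by
  intro k l m n
  rw [mkC, linExt_mu, linExt_mu, linExt_mu, linExt_mu]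
  refine ⟨fun h => at_ext fun i j => ?_, at_ext fun i j => ?_, ofAt_mem_gC ?_⟩
  · rw [at_ofAt, cval, h]; rfl
  · rw [at_neg, at_smul, at_ofAt, at_ofAt, cval, cval, Bool.and_comm (low m n),
      Bool.and_comm (odd m n)]
    cases low k l && low m n
    · simp
    rcases lt_trichotomy (rank k l) (rank m n) with h | h | h
    · have h1 : Nat.ble (rank m n) (rank k l) = false := by
        rw [← Bool.not_eq_true, Nat.ble_eq]; omega
      have h2 : Nat.ble (rank k l) (rank m n) = true := by
        rw [Nat.ble_eq]; omega
      have h3 : Nat.beq (rank k l) (rank m n) = false := by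
        rw [← Bool.not_eq_true, Nat.beq_eq]; omega
      simp only [h1, h2, h3, cond_true, cond_false, sgn_not]
      ring
    · obtain ⟨rfl, rfl⟩ := rank_inj h
      have h1 : Nat.ble (rank k l) (rank k l) = true := by rw [Nat.ble_eq]
      have h2 : Nat.beq (rank k l) (rank k l) = true := by rw [Nat.beq_eq]
      simp only [h1, h2, cond_true]
      cases odd k l <;> simp [sgn]
    · have h1 : Nat.ble (rank k l) (rank m n) = false := by
        rw [← Bool.not_eq_true, Nat.ble_eq]; omega
      have h2 : Nat.ble (rank m n) (rank k l) = true := by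
        rw [Nat.ble_eq]; omega
      have h3 : Nat.beq (rank m n) (rank k l) = false := by
        rw [← Bool.not_eq_true, Nat.beq_eq]; omega
      simp only [h1, h2, h3, cond_true, cond_false, sgn_not]
      linear_combination -(fill r (fun i j => v (ccode o m n k l i j)) i j) *
        sgn_mul_self (odd k l && odd m n)
  -- The case distinctions in `cval` do not depend on the entry, so it suffices that each branch is
  -- fixed by `fill`.
  · have e : ∀ (b : Bool) (x y : Ix → Ix → ℂ), fill r x = x → fill r y = y →
        fill r (fun i j => bif b then x i j else y i j) = fun i j => bif b then x i j else y i j := by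
      intro b x y hx hy
      cases b
      exacts [hy, hx]
    refine e _ _ _ (e _ _ _ (e _ _ _ (e _ _ _ (fill_fill _ _) (fill_zero r)) ?_) (fill_fill _ _))
      (fill_zero r)
    funext i j
    rw [fill_smul, fill_fill]

/-- The only canonical coordinates that `mkC` discards are those of a pair of equal even positions,
where superantisymmetry forces the value 0. -/
theorem at_mkC_of_canon {r : Bool} {k l m n i j : Ix} (h : canon r k l m n i j) (o : ℕ)
    (v : ℕ → ℂ) : SMat.at (mkC r o v (mu k l) (mu m n)) i j =
      bif Nat.beq (rank m n) (rank k l) && !(odd k l) then 0 else v (ccode o k l m n i j) := by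
  obtain ⟨h1, h2, h3, h4⟩ := h
  rw [at_mkC, cval, h1, h2]
  simp only [Bool.and_self, cond_true, fill_of_indep h4]
  cases h5 : Nat.beq (rank m n) (rank k l)
  · have h6 : Nat.ble (rank m n) (rank k l) = false := by
      rw [← Bool.not_eq_true, Nat.ble_eq]
      have := Nat.ne_of_beq_eq_false h5
      omega
    simp [h6]
  · have h6 : Nat.ble (rank m n) (rank k l) = true := by
      rw [Nat.ble_eq, Nat.eq_of_beq_eq_true h5]
    cases odd k l <;> simp [h6]

/-- A 2-cochain is determined by a valuation. -/
theorem eq_mkC {r : Bool} {o : ℕ} {v : ℕ → ℂ} {C : CC2} (hC : C ∈ coch r)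
    (hv : ∀ k l m n i j, canon r k l m n i j →
      v (ccode o k l m n i j) = SMat.at (C (mu k l) (mu m n)) i j) : C = mkC r o v := by
  refine coch_ext hC (mkC_mem r o v) fun k l m n i j h => ?_
  rw [at_mkC_of_canon h, hv k l m n i j h]
  cases h5 : Nat.beq (rank m n) (rank k l) && !(odd k l)
  · rfl
  · simp only [Bool.and_eq_true, Bool.not_eq_true'] at h5
    obtain ⟨rfl, rfl⟩ := rank_inj (Nat.eq_of_beq_eq_true h5.1)
    -- On a pair of equal even positions superantisymmetry reads `X = -X`.
    have e := (hC m n m n).2.1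
    rw [h5.2] at e
    simp only [sgn, Bool.and_self, Int.cast_one, one_smul] at e
    exact self_eq_neg.1 (congrArg (fun X : SMat => SMat.at X i j) e)

theorem eq_mkF {r : Bool} {o : ℕ} {v : ℕ → ℂ} {F : CC1} (hF : F ∈ coch1 r)
    (hv : ∀ k l i j, low k l = true → indep r i j = true →
      v (fcode o k l i j) = SMat.at (F (mu k l)) i j) : F = mkF r o v := by
  refine hom_ext_mu fun k l => ?_
  cases h : low k l
  · rw [(hF k l).1 h, (mkF_mem r o v k l).1 h]
  · refine gC_ext (hF k l).2 (mkF_mem r o v k l).2 fun i j hi => ?_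
    rw [at_mkF, fval, h, cond_true, fill_of_indep hi, hv k l i j h hi]

/-! ### Lists over positions -/

theorem forLow_forall {α : Type} {f : Ix → Ix → List α} {P : α → Prop}
    (h : ∀ k l, low k l = true → ∀ a ∈ f k l, P a) : ∀ a ∈ forLow f, P a := by
  intro a ha
  simp only [forLow, List.mem_append] at ha
  rcases ha with ha | ha | ha | ha | ha | ha | ha | ha <;> exact h _ _ rfl a ha

theorem forOdd_forall {α : Type} {f : Ix → Ix → List α} {P : α → Prop}
    (h : ∀ k l, low k l = true → ∀ a ∈ f k l, P a) : ∀ a ∈ forOdd f, P a := by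
  intro a ha
  simp only [forOdd, List.mem_append] at ha
  rcases ha with ha | ha | ha | ha <;> exact h _ _ rfl a ha

theorem forEnt_forall {α : Type} {r : Bool} {f : Ix → Ix → List α} {P : α → Prop}
    (h : ∀ i j, ∀ a ∈ f i j, P a) : ∀ a ∈ forEnt r f, P a := by
  have key : ∀ i j, ∀ a ∈ (bif indep r i j then f i j else []), P a := by
    intro i j a ha
    cases hi : indep r i j
    · simp [hi] at ha
    · rw [hi] at ha
      exact h i j a ha
  intro a ha
  simp only [forEnt, forIx, List.mem_append] at ha
  rcases ha with (h | h | h | h | h) | (h | h | h | h | h) | (h | h | h | h | h) |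
    (h | h | h | h | h) | (h | h | h | h | h) <;> exact key _ _ a h

theorem mem_forLow {α : Type} {f : Ix → Ix → List α} {k l : Ix} (h : low k l = true) {a : α}
    (ha : a ∈ f k l) : a ∈ forLow f := by
  simp only [forLow, List.mem_append]
  cases k <;> cases l <;> first | (exact absurd h (by decide)) | tauto

theorem mem_forIx {α : Type} {f : Ix → List α} {k : Ix} {a : α} (ha : a ∈ f k) :
    a ∈ forIx f := by
  simp only [forIx, List.mem_append]
  cases k <;> tauto

theorem mem_forEnt {α : Type} {r : Bool} {f : Ix → Ix → List α} {i j : Ix}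
    (h : indep r i j = true) {a : α} (ha : a ∈ f i j) : a ∈ forEnt r f :=
  mem_forIx (k := i) (mem_forIx (k := j) (by rw [h]; exact ha))

theorem mem_pairs {α : Type} {r : Bool} {g : Ix → Ix → Ix → Ix → Ix → Ix → α} {k l m n i j : Ix}
    (h : canon r k l m n i j) : g k l m n i j ∈ pairs r g := by
  obtain ⟨h1, h2, h3, h4⟩ := h
  refine mem_forLow h1 (mem_forLow h2 ?_)
  rw [show Nat.ble (rank k l) (rank m n) = true by rw [Nat.ble_eq]; exact h3]
  exact mem_forEnt h4 (List.mem_singleton.2 rfl)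

theorem pairs_forall {α : Type} {r : Bool} {g : Ix → Ix → Ix → Ix → Ix → Ix → α} {P : α → Prop}
    (h : ∀ k l m n i j, low k l = true → low m n = true → P (g k l m n i j)) :
    ∀ a ∈ pairs r g, P a := by
  refine forLow_forall fun k l hk => forLow_forall fun m n hm => ?_
  cases Nat.ble (rank k l) (rank m n)
  · simp
  · exact forEnt_forall fun i j a ha => by
      rw [List.mem_singleton.1 ha]
      exact h k l m n i j hk hm

/-! ## The real forms -/

/-- The two superalgebras. -/
def gOf : Bool → GSub
  | false => conf
  | true => red

/-- The transposition of the indices of the supermatrices in the real forms. -/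
def Ix.flip : Ix → Ix
  | .u0 => .v0
  | .u1 => .v1
  | .mid => .mid
  | .v0 => .u0
  | .v1 => .u1

/-- The signs of the conjugation. -/
def csgn : Ix → Ix → Bool
  | .mid, .v0 => false
  | .mid, .v1 => false
  | .mid, _ => true
  | .u0, .u0 => true
  | .u0, .u1 => true
  | .u1, .u0 => true
  | .u1, .u1 => true
  | .v0, .mid => true
  | .v0, .v0 => true
  | .v0, .v1 => true
  | .v1, .mid => true
  | .v1, .v0 => true
  | .v1, .v1 => true
  | _, _ => false

/-- The conjugation whose fixed points are the elements of the real forms. -/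
def cj : SMat →ₛₗ[starRingEnd ℂ] SMat where
  toFun X := ofAt fun i j => sgn (csgn i j) * star (SMat.at X j.flip i.flip)
  map_add' X Y := at_ext fun i j => by
    simp only [at_ofAt, at_add, star_add, mul_add]
  map_smul' z X := at_ext fun i j => by
    simp only [at_ofAt, at_smul, star_mul', RCLike.star_def]
    ring

theorem at_cj (X : SMat) (i j : Ix) :
    SMat.at (cj X) i j = sgn (csgn i j) * star (SMat.at X j.flip i.flip) :=
  congrFun (congrFun (at_ofAt fun i j => sgn (csgn i j) * star (SMat.at X j.flip i.flip)) i) j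

theorem Ix.flip_flip (k : Ix) : k.flip.flip = k := by cases k <;> rfl

theorem csgn_flip (i j : Ix) : csgn j.flip i.flip = csgn i j := by
  cases i <;> cases j <;> rfl

theorem star_sgn (b : Bool) : star ((sgn b : ℤ) : ℂ) = sgn b := by
  cases b <;> simp [sgn]

theorem cj_cj (X : SMat) : cj (cj X) = X := by
  refine at_ext fun i j => ?_
  rw [at_cj, at_cj, csgn_flip, star_mul', star_star, star_sgn, ← mul_assoc, sgn_mul_self, one_mul,
    Ix.flip_flip, Ix.flip_flip]

/-- This is the relation between `B` and the trace of `A` minus its conjugate transpose, written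
with the diagonal of the last block. In the complexification that block is independent of `A`. -/
theorem mem_gC_false {X : SMat} : X ∈ gC false ↔ SMat.at X .mid .mid =
    SMat.at X .u0 .u0 + SMat.at X .u1 .u1 + SMat.at X .v0 .v0 + SMat.at X .v1 .v1 := by
  refine ⟨fun h => h .mid .mid, fun h i j => ?_⟩
  cases i <;> cases j <;> first | rfl | exact h

theorem mem_gC_true {X : SMat} : X ∈ gC true ↔ (∀ i j : Ix, i.bl < j.bl → SMat.at X i j = 0) ∧
    SMat.at X .mid .mid = 0 ∧ SMat.at X .u1 .u1 = -SMat.at X .u0 .u0 ∧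
    SMat.at X .v1 .v1 = -SMat.at X .v0 .v0 := by
  constructor
  · intro h
    refine ⟨fun i j hij => ?_, h .mid .mid, h .u1 .u1, h .v1 .v1⟩
    have e : Nat.blt i.bl j.bl = true := by rw [Nat.blt_eq]; exact hij
    rw [h, fill, e]
    rfl
  · rintro ⟨h1, h2, h3, h4⟩ i j
    cases i <;> cases j <;>
      first | rfl | exact h2 | exact h3 | exact h4 | exact h1 _ _ (by decide)

theorem cj_mem {r : Bool} {X : SMat} (hX : X ∈ gC r) : cj X ∈ gC r := by
  cases r
  · rw [mem_gC_false] at hX ⊢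
    simp [at_cj, Ix.flip, csgn, sgn, hX]
    ring
  · rw [mem_gC_true] at hX ⊢
    obtain ⟨h1, h2, h3, h4⟩ := hX
    refine ⟨fun i j hij => ?_, ?_⟩
    · rw [at_cj, h1 j.flip i.flip]
      · simp
      · revert hij
        cases i <;> cases j <;> decide
    · simp [at_cj, Ix.flip, csgn, sgn, h2, h3, h4]

/-- The involution maps the blocks `T`, `U` and `B` to themselves, where its fixed point equations
say that `T` and `U` are hermitian and `B` is antihermitian. It interchanges the remaining blocks in
pairs, so one block of each pair determines the other. -/
theorem mem_conf (X : SMat) : X ∈ conf.carrier ↔ X ∈ gC false ∧ cj X = X := by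
  constructor
  · rintro ⟨A, B, Q, R, T, U, hB, hA, hT, hU, rfl⟩
    have eT := fun a b => hT.apply a b
    have eU := fun a b => hU.apply a b
    simp only [RCLike.star_def] at eT eU hB
    refine ⟨fun i j => ?_, at_ext fun i j => ?_⟩
    · cases i <;> cases j <;> first
        | rfl
        | (simp [fill, SMat.at, sm, Ix.toIdx, Ix.eq, Ix.num, hA, Matrix.trace]; ring)
    · rw [at_cj]
      cases i <;> cases j <;>
        simp [SMat.at, sm, Ix.toIdx, Ix.flip, csgn, sgn, eT, eU, hB]
  · rintro ⟨h1, h2⟩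
    have h3 : ∀ i j, sgn (csgn i j) * star (SMat.at X j.flip i.flip) = SMat.at X i j :=
      fun i j => by rw [← at_cj, h2]
    rw [mem_gC_false] at h1
    have h4 := fun i j => (h3 i j).symm
    simp only [SMat.at] at h1 h4
    refine ⟨Matrix.of fun a b => X (.inl a) (.inl b), SMat.at X .mid .mid, fun a => X (.inr (.inl 0)) (.inl a),
      fun a => X (.inr (.inl 0)) (.inr (.inr a)), Matrix.of fun a b => X (.inr (.inr a)) (.inl b),
      Matrix.of fun a b => X (.inl a) (.inr (.inr b)), ?_, ?_, ?_, ?_, ?_⟩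
    · have := h4 .mid .mid
      simp [Ix.toIdx, Ix.flip, csgn, sgn] at this
      simp [SMat.at, Ix.toIdx]
      linear_combination this
    · have e0 := h4 .v0 .v0
      have e1 := h4 .v1 .v1
      simp [Ix.toIdx, Ix.flip, csgn, sgn] at h1 e0 e1
      simp [SMat.at, Ix.toIdx, Matrix.trace, h1, e0, e1]
      ring
    · ext a b
      have e0 := h4 .v0 .u0
      have e1 := h4 .v0 .u1
      have e2 := h4 .v1 .u0
      have e3 := h4 .v1 .u1
      simp [Ix.toIdx, Ix.flip, csgn, sgn] at e0 e1 e2 e3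
      fin_cases a <;> fin_cases b <;>
        simp only [Matrix.conjTranspose_apply, Matrix.of_apply, RCLike.star_def]
      exacts [e0.symm, e1.symm, e2.symm, e3.symm]
    · ext a b
      have e0 := h4 .u0 .v0
      have e1 := h4 .u0 .v1
      have e2 := h4 .u1 .v0
      have e3 := h4 .u1 .v1
      simp [Ix.toIdx, Ix.flip, csgn, sgn] at e0 e1 e2 e3
      fin_cases a <;> fin_cases b <;>
        simp only [Matrix.conjTranspose_apply, Matrix.of_apply, RCLike.star_def]
      exacts [e0.symm, e1.symm, e2.symm, e3.symm]
    · refine at_ext fun i j => ?_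
      have e := h4 i j
      revert e
      cases i <;> cases j <;> simp [Ix.toIdx, Ix.flip, csgn, sgn, SMat.at, sm]

theorem mem_red (X : SMat) : X ∈ red.carrier ↔ X ∈ gC true ∧ cj X = X := by
  rw [mem_gC_true]
  constructor
  · rintro ⟨A, Q, T, hA, hT, rfl⟩
    have eT := fun a b => hT.apply a b
    simp only [RCLike.star_def] at eT
    have e : A 1 1 = -A 0 0 := by
      rw [Matrix.trace_fin_two] at hA
      linear_combination hA
    refine ⟨⟨fun i j hij => ?_, ?_, ?_, ?_⟩, at_ext fun i j => ?_⟩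
    · revert hij
      cases i <;> cases j <;> simp [Ix.bl, SMat.at, sm, Ix.toIdx]
    · simp [SMat.at, sm, Ix.toIdx]
    · simp [SMat.at, sm, Ix.toIdx, e]
    · simp [SMat.at, sm, Ix.toIdx, e]
    · rw [at_cj]
      cases i <;> cases j <;>
        simp [SMat.at, sm, Ix.toIdx, Ix.flip, csgn, sgn, eT]
  · rintro ⟨⟨h0, h1, h2, -⟩, h3⟩
    have h4 : ∀ i j, SMat.at X i j = sgn (csgn i j) * star (SMat.at X j.flip i.flip) :=
      fun i j => by rw [← at_cj, h3]
    simp only [SMat.at] at h0 h1 h2 h4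
    refine ⟨Matrix.of fun a b => X (.inl a) (.inl b), fun a => X (.inr (.inl 0)) (.inl a),
      Matrix.of fun a b => X (.inr (.inr a)) (.inl b), ?_, ?_, ?_⟩
    · simp [Ix.toIdx] at h2
      simp [Matrix.trace, h2]
    · ext a b
      have e0 := h4 .v0 .u0
      have e1 := h4 .v0 .u1
      have e2 := h4 .v1 .u0
      have e3 := h4 .v1 .u1
      simp [Ix.toIdx, Ix.flip, csgn, sgn] at e0 e1 e2 e3
      fin_cases a <;> fin_cases b <;>
        simp only [Matrix.conjTranspose_apply, Matrix.of_apply, RCLike.star_def]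
      exacts [e0.symm, e1.symm, e2.symm, e3.symm]
    · refine at_ext fun i j => ?_
      have e := h4 i j
      have e' := h0 i j
      revert e e'
      cases i <;> cases j <;> simp [Ix.toIdx, Ix.flip, csgn, sgn, SMat.at, sm, Ix.bl]
      exact fun _ => h1

theorem mem_gOf {r : Bool} {X : SMat} : X ∈ (gOf r).carrier ↔ X ∈ gC r ∧ cj X = X := by
  cases r
  exacts [mem_conf X, mem_red X]

theorem real_smul_eq (t : ℝ) (X : SMat) : t • X = (t : ℂ) • X := by
  ext i j
  simp

theorem cj_real_smul (t : ℝ) (X : SMat) : cj (t • X) = t • cj X := by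
  rw [real_smul_eq, real_smul_eq, map_smulₛₗ, Complex.conj_ofReal]

theorem smul_mem_gC {r : Bool} (t : ℝ) {X : SMat} (hX : X ∈ gC r) : t • X ∈ gC r := by
  rw [real_smul_eq]
  exact (gC r).smul_mem _ hX

/-! ### Real parts with respect to the conjugation. -/

/-- The real part of a supermatrix with respect to the conjugation. -/
def rp : SMat →ₗ[ℝ] SMat where
  toFun X := (1 / 2 : ℝ) • (X + cj X)
  map_add' X Y := by
    rw [map_add, ← smul_add]
    congr 1
    abel
  map_smul' t X := by
    rw [cj_real_smul, ← smul_add, smul_comm, RingHom.id_apply]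

theorem rp_apply (X : SMat) : rp X = (1 / 2 : ℝ) • (X + cj X) := rfl

theorem rp_mem {r : Bool} {X : SMat} (hX : X ∈ gC r) : rp X ∈ (gOf r).carrier := by
  refine mem_gOf.2 ⟨smul_mem_gC _ (add_mem hX (cj_mem hX)), ?_⟩
  rw [rp_apply, cj_real_smul, map_add, cj_cj, add_comm]

theorem rp_of_cj {X : SMat} (hX : cj X = X) : rp X = X := by
  rw [rp_apply, hX, ← two_smul ℝ X, smul_smul]
  norm_num

theorem rp_I_smul {X : SMat} (hX : cj X = X) : rp (I • X) = 0 := by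
  rw [rp_apply, map_smulₛₗ, hX, Complex.conj_I, neg_smul, add_neg_cancel, smul_zero]

theorem rp_smul {X : SMat} (hX : cj X = X) (z : ℂ) : rp (z • X) = z.re • X := by
  have e : z • X = z.re • X + z.im • (I • X) := by
    rw [real_smul_eq, real_smul_eq, smul_smul, ← add_smul, Complex.re_add_im]
  rw [e, map_add, map_smul, map_smul, rp_I_smul hX, rp_of_cj hX, smul_zero, add_zero]

/-- By antilinearity of `cj`, the element `rp (-(I • X))` is `(X - cj X) / (2i)`, the imaginary part
of `X`. -/
theorem rp_decomp (X : SMat) : X = rp X + I • rp (-(I • X)) := by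
  rw [rp_apply, rp_apply, map_neg, map_smulₛₗ, Complex.conj_I, real_smul_eq, real_smul_eq]
  refine at_ext fun i j => ?_
  simp only [at_add, at_smul, at_neg]
  push_cast
  linear_combination (1 / 2 : ℂ) * (SMat.at X i j - SMat.at (cj X) i j) * Complex.I_mul_I

theorem cj_of_mem {r : Bool} {X : SMat} (hX : X ∈ (gOf r).carrier) : cj X = X := (mem_gOf.1 hX).2

theorem gC_of_mem {r : Bool} {X : SMat} (hX : X ∈ (gOf r).carrier) : X ∈ gC r := (mem_gOf.1 hX).1

/-- Closedness is inherited from the real algebra: after splitting both arguments into real and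
imaginary parts, only brackets of real elements remain. -/
theorem sbC_mem {r : Bool} {X Y : SMat} (hX : X ∈ gC r) (hY : Y ∈ gC r) : sbC X Y ∈ gC r := by
  have h1 := rp_mem hX
  have h2 := rp_mem (neg_mem ((gC r).smul_mem I hX))
  have h3 := rp_mem hY
  have h4 := rp_mem (neg_mem ((gC r).smul_mem I hY))
  have key := fun X hX Y hY => gC_of_mem ((gOf r).sb_mem X hX Y hY)
  rw [rp_decomp X, rp_decomp Y]
  simp only [map_add, map_smul, LinearMap.add_apply, LinearMap.smul_apply, sbC_apply]
  exact add_mem (add_mem (key _ h1 _ h3) ((gC r).smul_mem _ (key _ h2 _ h3)))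
    ((gC r).smul_mem _ (add_mem (key _ h1 _ h4) ((gC r).smul_mem _ (key _ h2 _ h4))))

theorem rp_sbC {r : Bool} {X Y : SMat} (hX : X ∈ gC r) (hY : Y ∈ (gOf r).carrier) :
    rp (sbC X Y) = sb (rp X) Y := by
  have h1 := (gOf r).sb_mem _ (rp_mem hX) _ hY
  have h2 := (gOf r).sb_mem _ (rp_mem (neg_mem ((gC r).smul_mem I hX))) _ hY
  conv_lhs => rw [rp_decomp X]
  rw [map_add, map_smul, LinearMap.add_apply, LinearMap.smul_apply, map_add, sbC_apply, sbC_apply,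
    rp_of_cj (cj_of_mem h1), rp_I_smul (cj_of_mem h2), add_zero]

/-- The projection to the complexified algebra which keeps the independent entries. -/
def fillP (r : Bool) : SMat →ₗ[ℂ] SMat where
  toFun X := ofAt (fill r (SMat.at X))
  map_add' X Y := at_ext fun i j => by
    rw [at_add, at_ofAt, at_ofAt, at_ofAt, ← fill_add]
    rfl
  map_smul' z X := at_ext fun i j => by
    rw [RingHom.id_apply, at_smul, at_ofAt, at_ofAt, ← fill_smul]
    rfl

theorem fillP_mem (r : Bool) (X : SMat) : fillP r X ∈ gC r := ofAt_mem_gC (fill_fill r _)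

theorem fillP_of_mem {r : Bool} {X : SMat} (hX : X ∈ gC r) : fillP r X = X :=
  at_ext fun i j => (congrFun (congrFun (at_ofAt _) i) j).trans (hX i j).symm

/-- The real part of an element of the complexified algebra. -/
def pr (r : Bool) : SMat →ₗ[ℝ] (gOf r).Sp :=
  (rp ∘ₗ (fillP r).restrictScalars ℝ).codRestrict _ fun X => rp_mem (fillP_mem r X)

theorem coe_pr {r : Bool} {X : SMat} (hX : X ∈ gC r) : (pr r X : SMat) = rp X :=
  congrArg rp (fillP_of_mem hX)

/-! ### The negative part -/

/-- The projection to the positions of negative degree. -/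
def lowP : SMat →ₗ[ℂ] SMat where
  toFun X := ofAt fun i j => if low i j then SMat.at X i j else 0
  map_add' X Y := at_ext fun i j => by
    simp only [at_add, at_ofAt]
    split_ifs <;> simp
  map_smul' z X := at_ext fun i j => by
    simp only [RingHom.id_apply, at_smul, at_ofAt]
    split_ifs <;> simp

theorem at_lowP (X : SMat) (i j : Ix) :
    SMat.at (lowP X) i j = if low i j then SMat.at X i j else 0 :=
  congrFun (congrFun (at_ofAt fun i j => if low i j then SMat.at X i j else 0) i) j

theorem low_iff (i j : Ix) : low i j = true ↔ eDeg i.toIdx j.toIdx < 0 := by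
  cases i <;> cases j <;> decide

theorem low_flip (i j : Ix) : low j.flip i.flip = low i j := by
  cases i <;> cases j <;> rfl

theorem eDeg_flip (i j : Ix) : eDeg j.flip.toIdx i.flip.toIdx = eDeg i.toIdx j.toIdx := by
  cases i <;> cases j <;> rfl

theorem par_flip (i j : Ix) : par j.flip i.flip = par i j := by
  cases i <;> cases j <;> rfl

theorem lowP_lowP (X : SMat) : lowP (lowP X) = lowP X := at_ext fun i j => by
  rw [at_lowP, at_lowP]
  split_ifs <;> rfl

/-- The defining equations of `gC` do not restrict the entries of negative degree, so both algebras
have the same complexified negative part. -/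
theorem lowP_mem (r : Bool) (X : SMat) : lowP X ∈ gC r := by
  intro i j
  cases r <;> cases i <;> cases j <;> first | rfl | simp [fill, at_lowP, low, Ix.eq, Ix.num]

theorem lowP_mu (k l : Ix) : lowP (mu k l) = if low k l then mu k l else 0 := at_ext fun i j => by
  rw [at_lowP, at_mu]
  by_cases h : i = k ∧ j = l
  · obtain ⟨rfl, rfl⟩ := h
    cases low i j <;> simp [at_mu, at_zero]
  · cases low k l <;> simp [at_mu, at_zero, h]

theorem rp_lowP (X : SMat) : rp (lowP X) = lowP (rp X) := by
  have e : cj (lowP X) = lowP (cj X) := at_ext fun i j => by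
    rw [at_cj, at_lowP, at_lowP, low_flip, at_cj]
    split_ifs <;> simp
  rw [rp_apply, rp_apply, e, real_smul_eq, real_smul_eq, map_smul, map_add]

theorem mem_neg {r : Bool} {X : SMat} :
    X ∈ neg (gOf r) ↔ X ∈ (gOf r).carrier ∧ lowP X = X := by
  refine and_congr_right fun _ => ⟨fun h => at_ext fun i j => ?_, fun h i j hij => ?_⟩
  · rw [at_lowP]
    split_ifs with h1
    · rfl
    · rw [low_iff] at h1
      exact (h _ _ (not_lt.1 h1)).symm
  · obtain ⟨k, rfl⟩ := Ix.exists_toIdx i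
    obtain ⟨l, rfl⟩ := Ix.exists_toIdx j
    have e : SMat.at (lowP X) k l = X k.toIdx l.toIdx := by rw [h]; rfl
    rw [← e, at_lowP, if_neg]
    rw [low_iff]
    omega

/-- The negative part of the real part. -/
def pn (r : Bool) : SMat →ₗ[ℝ] ↥(neg (gOf r)) :=
  (rp ∘ₗ lowP.restrictScalars ℝ).codRestrict _ fun X =>
    mem_neg.2 ⟨rp_mem (lowP_mem r X), by
      rw [LinearMap.comp_apply, LinearMap.restrictScalars_apply, rp_lowP, lowP_lowP]⟩

theorem coe_pn (r : Bool) (X : SMat) : (pn r X : SMat) = rp (lowP X) := rfl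

theorem pn_lowP (r : Bool) (X : SMat) : pn r (lowP X) = pn r X :=
  Subtype.ext (by rw [coe_pn, coe_pn, lowP_lowP])

theorem cj_neg {r : Bool} (x : ↥(neg (gOf r))) : cj (x : SMat) = x := cj_of_mem x.2.1

theorem lowP_neg {r : Bool} (x : ↥(neg (gOf r))) : lowP (x : SMat) = x := (mem_neg.1 x.2).2

theorem pn_neg {r : Bool} (x : ↥(neg (gOf r))) : pn r (x : SMat) = x :=
  Subtype.ext (by rw [coe_pn, lowP_neg, rp_of_cj (cj_neg x)])

theorem pn_I_smul {r : Bool} (x : ↥(neg (gOf r))) : pn r (-(I • (x : SMat))) = 0 :=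
  Subtype.ext (by
    rw [coe_pn, map_neg, map_smul, lowP_neg, map_neg, rp_I_smul (cj_neg x), neg_zero]; rfl)

theorem pn_decomp (r : Bool) (X : SMat) :
    lowP X = pn r X + I • (pn r (-(I • X)) : SMat) := by
  rw [coe_pn, coe_pn, map_neg, map_smul]
  exact rp_decomp _

/-! ### Passage between real elements and matrix units. -/

section
variable {r : Bool} {M : Type*} [AddCommGroup M] [Module ℂ M]

theorem eq_on_lowP {T T' : SMat →ₗ[ℂ] M} (h : ∀ x : ↥(neg (gOf r)), T x = T' x) (X : SMat) :
    T (lowP X) = T' (lowP X) := by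
  rw [pn_decomp r X, map_add, map_add, map_smul, map_smul, h, h]

theorem eq_of_eq_neg {T T' : SMat →ₗ[ℂ] M} (hT : ∀ X, T (lowP X) = T X)
    (hT' : ∀ X, T' (lowP X) = T' X) (h : ∀ x : ↥(neg (gOf r)), T x = T' x) : T = T' := by
  ext X : 1
  rw [← hT, ← hT', eq_on_lowP h]

/-- A matrix unit of negative degree is `a + I • b` with `a` and `b` real and supported at its
position and at the flipped one. The support condition `P` stands for a parity or a degree, both of
which are invariant under the flip. -/
theorem mu_of_neg {T : SMat →ₗ[ℂ] M} {P : Ix → Ix → Prop}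
    (h : ∀ x : ↥(neg (gOf r)), (∀ i j, ¬ P i j → SMat.at (x : SMat) i j = 0) → T x = 0)
    {k l : Ix} (hl : low k l = true) (hP : P k l) (hP' : P l.flip k.flip) : T (mu k l) = 0 := by
  -- The values `z = 1` and `z = -I` give the real and the imaginary part of the matrix unit.
  have key : ∀ z : ℂ, T (pn r (z • mu k l)) = 0 := by
    intro z
    refine h _ fun i j hij => ?_
    rw [coe_pn, map_smul, lowP_mu, if_pos hl, rp_apply, real_smul_eq, at_smul, at_add, at_cj,
      at_smul, at_smul, at_mu, at_mu, if_neg, if_neg]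
    · simp
    · rintro ⟨rfl, rfl⟩
      rw [Ix.flip_flip, Ix.flip_flip] at hP'
      exact hij hP'
    · rintro ⟨rfl, rfl⟩
      exact hij hP
  have e := pn_decomp r (mu k l)
  rw [lowP_mu, if_pos hl] at e
  have e1 := key 1
  have e2 := key (-I)
  rw [one_smul] at e1
  rw [neg_smul] at e2
  rw [e, map_add, map_smul, e1, e2, smul_zero, add_zero]

theorem neg_of_mu {T : SMat →ₗ[ℂ] M} {P : Ix → Ix → Prop}
    (h : ∀ k l, low k l = true → P k l → T (mu k l) = 0) (x : ↥(neg (gOf r)))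
    (hx : ∀ i j, ¬ P i j → SMat.at (x : SMat) i j = 0) : T x = 0 := by
  rw [eq_sum_mu (x : SMat), map_sum]
  refine Finset.sum_eq_zero fun k _ => ?_
  rw [map_sum]
  refine Finset.sum_eq_zero fun l _ => ?_
  rw [map_smul]
  by_cases h1 : P k l
  · cases h2 : low k l
    · rw [← lowP_neg x, at_lowP, h2]
      simp
    · rw [h k l h2 h1, smul_zero]
  · rw [hx k l h1, zero_smul]

theorem hasPar_iff {p : ZMod 2} {X : SMat} :
    HasPar p X ↔ ∀ i j, ¬ par i j = p → SMat.at X i j = 0 := by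
  refine ⟨fun h i j hij => h _ _ (by rwa [par_eq]), fun h i j hij => ?_⟩
  obtain ⟨k, rfl⟩ := Ix.exists_toIdx i
  obtain ⟨l, rfl⟩ := Ix.exists_toIdx j
  exact h k l (by rwa [← par_eq])

theorem hasDeg_iff {d : ℤ} {X : SMat} :
    HasDeg d X ↔ ∀ i j : Ix, ¬ eDeg i.toIdx j.toIdx = d → SMat.at X i j = 0 := by
  refine ⟨fun h i j hij => h _ _ hij, fun h i j hij => ?_⟩
  obtain ⟨k, rfl⟩ := Ix.exists_toIdx i
  obtain ⟨l, rfl⟩ := Ix.exists_toIdx j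
  exact h k l hij

theorem mu_of_par {p : ZMod 2} {T : SMat →ₗ[ℂ] M}
    (h : ∀ x : ↥(neg (gOf r)), HasPar p (x : SMat) → T x = 0) {k l : Ix} (hl : low k l = true)
    (hp : par k l = p) : T (mu k l) = 0 :=
  mu_of_neg (P := fun i j => par i j = p) (fun x hx => h x (hasPar_iff.2 hx)) hl hp
    (by rwa [par_flip])

theorem par_of_mu {p : ZMod 2} {T : SMat →ₗ[ℂ] M}
    (h : ∀ k l, low k l = true → par k l = p → T (mu k l) = 0) (x : ↥(neg (gOf r)))
    (hx : HasPar p (x : SMat)) : T x = 0 :=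
  neg_of_mu h x (hasPar_iff.1 hx)

/-- With one argument fixed the other one can be treated by the linear case. The parities are
prescribed because the signs in the superidentities depend on them, and only for fixed signs are the
identities multilinear. -/
theorem mu₂_of_par {p q : ZMod 2} {T : SMat →ₗ[ℂ] SMat →ₗ[ℂ] M}
    (h : ∀ x y : ↥(neg (gOf r)), HasPar p (x : SMat) → HasPar q (y : SMat) → T x y = 0)
    {k l m n : Ix} (hl : low k l = true) (hm : low m n = true) (hp : par k l = p)
    (hq : par m n = q) : T (mu k l) (mu m n) = 0 :=
  mu_of_par (r := r) (T := T (mu k l)) (fun y hy =>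
    mu_of_par (r := r) (T := T.flip y) (fun x hx => h x y hx hy) hl hp) hm hq

theorem par₂_of_mu {p q : ZMod 2} {T : SMat →ₗ[ℂ] SMat →ₗ[ℂ] M}
    (h : ∀ k l m n, low k l = true → low m n = true → par k l = p → par m n = q →
      T (mu k l) (mu m n) = 0) (x y : ↥(neg (gOf r)))
    (hx : HasPar p (x : SMat)) (hy : HasPar q (y : SMat)) : T x y = 0 :=
  par_of_mu (T := T x) (fun m n hm hq =>
    par_of_mu (T := T.flip (mu m n)) (fun k l hl hp => h k l m n hl hm hp hq) x hx) y hy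

end

/-! ### Complexification of cochains -/

section
variable {r : Bool} {V : Type*} [AddCommGroup V] [Module ℂ V] [Module ℝ V] [IsScalarTower ℝ ℂ V]

/-- The complexification of a linear map on the negative part. -/
def cxL (f : ↥(neg (gOf r)) →ₗ[ℝ] V) : SMat →ₗ[ℂ] V where
  toFun X := f (pn r X) + I • f (pn r (-(I • X)))
  map_add' X Y := by
    simp only [map_add, smul_add, neg_add]
    abel
  map_smul' z X := by
    have e : z • X = z.re • X + z.im • (I • X) := by
      rw [real_smul_eq, real_smul_eq, smul_smul, ← add_smul, Complex.re_add_im]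
    have e1 : I • z • X = z.re • (I • X) - z.im • X := by
      rw [e, smul_add, smul_comm I z.re, smul_comm I z.im, smul_smul I I, Complex.I_mul_I]
      simp [sub_eq_add_neg]
    have e2 : z • f (pn r (I • X)) = z.re • f (pn r (I • X)) + z.im • I • f (pn r (I • X)) := by
      conv_lhs => rw [← Complex.re_add_im z]
      rw [add_smul, mul_smul, ← algebraMap_smul ℂ z.re, ← algebraMap_smul ℂ z.im]
      rfl
    have e3 : z • f (pn r X) = z.re • f (pn r X) + z.im • I • f (pn r X) := by
      conv_lhs => rw [← Complex.re_add_im z]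
      rw [add_smul, mul_smul, ← algebraMap_smul ℂ z.re, ← algebraMap_smul ℂ z.im]
      rfl
    have e4 : ∀ (t : ℝ) (v : V), I • t • v = t • I • v := fun t v => by
      rw [← algebraMap_smul ℂ t, ← algebraMap_smul ℂ t, smul_comm]
    have e5 : ∀ v : V, I • I • v = -v := fun v => by
      rw [smul_smul, Complex.I_mul_I, neg_smul, one_smul]
    rw [e1, e]
    simp only [map_neg, map_add, map_sub, map_smul, RingHom.id_apply, smul_add, smul_neg,
      smul_comm z I, e2, e3, smul_sub, e4, e5]
    abel

theorem cxL_apply (f : ↥(neg (gOf r)) →ₗ[ℝ] V) (X : SMat) :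
    cxL f X = f (pn r X) + I • f (pn r (-(I • X))) := rfl

theorem cxL_neg (f : ↥(neg (gOf r)) →ₗ[ℝ] V) (x : ↥(neg (gOf r))) : cxL f x = f x := by
  rw [cxL_apply, pn_neg, pn_I_smul, map_zero, smul_zero, add_zero]

theorem cxL_lowP (f : ↥(neg (gOf r)) →ₗ[ℝ] V) (X : SMat) : cxL f (lowP X) = cxL f X := by
  have e : -(I • lowP X) = lowP (-(I • X)) := by rw [map_neg, map_smul]
  rw [cxL_apply, cxL_apply, e, pn_lowP, pn_lowP]

end

variable {r : Bool}

instance : AddCommGroup CC2 := LinearMap.addCommGroup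

/-- The complexification of a 1-cochain. -/
def cx1 (f : C1 (gOf r)) : CC1 := cxL ((gOf r).carrier.subtype ∘ₗ f)

/-- The complexification of a bilinear map in the second argument. -/
def cxR (c : Bil (gOf r)) : ↥(neg (gOf r)) →ₗ[ℝ] CC1 where
  toFun x := cx1 (c x)
  map_add' x y := eq_of_eq_neg (r := r) (cxL_lowP _)
    (fun X => by
      rw [LinearMap.add_apply, LinearMap.add_apply, cx1, cx1, cxL_lowP, cxL_lowP]) fun z => by
      rw [LinearMap.add_apply, cx1, cx1, cx1, cxL_neg, cxL_neg, cxL_neg, map_add]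
      rfl
  map_smul' t x := eq_of_eq_neg (r := r) (cxL_lowP _)
    (fun X => by
      rw [RingHom.id_apply, LinearMap.smul_apply, LinearMap.smul_apply, cx1, cxL_lowP]) fun z => by
      rw [RingHom.id_apply, LinearMap.smul_apply, cx1, cx1, cxL_neg, cxL_neg, map_smul]
      rfl

/-- The complexification of a bilinear map. -/
def cx2 (c : Bil (gOf r)) : CC2 := cxL (cxR c)

theorem cx1_neg (f : C1 (gOf r)) (x : ↥(neg (gOf r))) : cx1 f x = f x := cxL_neg _ x

theorem cx1_lowP (f : C1 (gOf r)) (X : SMat) : cx1 f (lowP X) = cx1 f X := cxL_lowP _ X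

theorem cx1_mem_gC (f : C1 (gOf r)) (X : SMat) : cx1 f X ∈ gC r :=
  add_mem (gC_of_mem (f _).2) ((gC r).smul_mem _ (gC_of_mem (f _).2))

theorem cx1_mem (f : C1 (gOf r)) : cx1 f ∈ coch1 r := fun k l =>
  ⟨fun h => by rw [← cx1_lowP, lowP_mu, h, if_neg Bool.false_ne_true, map_zero], cx1_mem_gC f _⟩

theorem cx2_neg (c : Bil (gOf r)) (x y : ↥(neg (gOf r))) : cx2 c x y = c x y := by
  rw [cx2, cxL_neg]
  exact cx1_neg _ y

theorem cx2_lowP (c : Bil (gOf r)) (X : SMat) : cx2 c (lowP X) = cx2 c X := cxL_lowP _ X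

theorem cx2_lowP_right (c : Bil (gOf r)) (X Y : SMat) : cx2 c X (lowP Y) = cx2 c X Y :=
  congrArg₂ (fun Y Z => Y + I • Z) (cx1_lowP _ Y) (cx1_lowP _ Y)

theorem cx2_mem_gC (c : Bil (gOf r)) (X Y : SMat) : cx2 c X Y ∈ gC r :=
  add_mem (cx1_mem_gC (c (pn r X)) Y)
    ((gC r).smul_mem _ (cx1_mem_gC (c (pn r (-(I • X)))) Y))

/-- Maps that factor through the negative part are determined by their values on real pairs, because
the real negative part spans the complex one. -/
theorem cx2_ext {C D : CC2} (hC : ∀ X, C (lowP X) = C X) (hC' : ∀ X Y, C X (lowP Y) = C X Y)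
    (hD : ∀ X, D (lowP X) = D X) (hD' : ∀ X Y, D X (lowP Y) = D X Y)
    (h : ∀ x y : ↥(neg (gOf r)), C x y = D x y) : C = D :=
  eq_of_eq_neg hC hD fun x => eq_of_eq_neg (hC' x) (hD' x) (h x)

theorem cx2_add (c c' : Bil (gOf r)) : cx2 (c + c') = cx2 c + cx2 c' :=
  cx2_ext (r := r) (cx2_lowP _) (cx2_lowP_right _)
    (fun X => congrArg₂ (· + ·) (cx2_lowP _ X) (cx2_lowP _ X))
    (fun X Y => congrArg₂ (· + ·) (cx2_lowP_right _ X Y) (cx2_lowP_right _ X Y))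
    fun x y => by
      rw [LinearMap.add_apply, LinearMap.add_apply, cx2_neg, cx2_neg, cx2_neg]
      rfl

theorem cx2_smul (t : ℝ) (c : Bil (gOf r)) : cx2 (t • c) = (t : ℂ) • cx2 c :=
  cx2_ext (r := r) (cx2_lowP _) (cx2_lowP_right _)
    (fun X => congrArg ((t : ℂ) • ·) (cx2_lowP _ X))
    (fun X Y => congrArg ((t : ℂ) • ·) (cx2_lowP_right _ X Y))
    fun x y => by
      rw [LinearMap.smul_apply, LinearMap.smul_apply, cx2_neg, cx2_neg, ← real_smul_eq]
      rfl

theorem ksgn_smul (p q : ZMod 2) (X : SMat) : ksgn p q • X = ((ksgn p q : ℝ) : ℂ) • X :=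
  real_smul_eq _ _

theorem coe_ksgn_par (k l m n : Ix) :
    ((ksgn (par k l) (par m n) : ℝ) : ℂ) = sgn (odd k l && odd m n) := by
  rw [ksgn_par]
  simp

theorem cx2_mem {c : Bil (gOf r)} (hc : IsCochain (gOf r) c) : cx2 c ∈ coch r := by
  intro k l m n
  have h0 : ∀ k l m n, low k l = false → cx2 c (mu k l) (mu m n) = 0 := fun k l m n h => by
    rw [← cx2_lowP, lowP_mu, h, if_neg Bool.false_ne_true, map_zero, LinearMap.zero_apply]
  have h1 : ∀ k l m n, low m n = false → cx2 c (mu k l) (mu m n) = 0 := fun k l m n h => by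
    rw [← cx2_lowP_right, lowP_mu, h, if_neg Bool.false_ne_true, map_zero]
  refine ⟨h0 k l m n, ?_, cx2_mem_gC _ _ _⟩
  cases h2 : low k l
  · rw [h0 k l m n h2, h1 m n k l h2, smul_zero, neg_zero]
  cases h3 : low m n
  · rw [h0 m n k l h3, h1 k l m n h3, smul_zero, neg_zero]
  -- For fixed parities the defect of superantisymmetry is a complex bilinear map, which vanishes on
  -- real elements of these parities.
  have key := mu₂_of_par (r := r)
    (T := (cx2 c).flip + (sgn (odd k l && odd m n) : ℂ) • cx2 c) (k := k) (l := l)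
    (m := m) (n := n) (fun x y hx hy => by
      have e : c y x = -(ksgn (par m n) (par k l) • c x y) := hc _ _ y x hy hx
      rw [LinearMap.add_apply, LinearMap.add_apply, LinearMap.flip_apply, LinearMap.smul_apply,
        LinearMap.smul_apply, cx2_neg, cx2_neg, e, Submodule.coe_neg, Submodule.coe_smul, ksgn_smul,
        coe_ksgn_par, Bool.and_comm, neg_add_cancel]) h2 h3 rfl rfl
  exact eq_neg_of_add_eq_zero_left key

theorem isCochain_of_mem {c : Bil (gOf r)} (hc : cx2 c ∈ coch r) : IsCochain (gOf r) c := by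
  intro p q x y hx hy
  have key := par₂_of_mu (r := r) (T := cx2 c + ((ksgn p q : ℝ) : ℂ) • (cx2 c).flip)
    (fun k l m n _ _ hp hq => by
      rw [LinearMap.add_apply, LinearMap.add_apply, LinearMap.smul_apply, LinearMap.smul_apply,
        LinearMap.flip_apply, (hc m n k l).2.1, ← hp, ← hq, coe_ksgn_par, Bool.and_comm,
        neg_add_cancel]) x y hx hy
  rw [LinearMap.add_apply, LinearMap.add_apply, LinearMap.smul_apply, LinearMap.smul_apply,
    LinearMap.flip_apply, cx2_neg, cx2_neg, ← ksgn_smul] at key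
  exact Subtype.ext (eq_neg_of_add_eq_zero_left key)

/-! ### Differentials -/

/-- The differential of a complex 1-cochain as a bilinear map. -/
def d1L (F : CC1) (ε : ℂ) : CC2 := sbC.comp F - ε • (sbC.comp F).flip - sbC.compr₂ F

theorem d1L_apply (F : CC1) (ε : ℂ) (X Y : SMat) : d1L F ε X Y = d1C F ε X Y := rfl

/-- An auxiliary term of the differential of a complex 2-cochain as a trilinear map. -/
def dTL (C : CC2) : SMat →ₗ[ℂ] CC2 := C.compr₂ sbC + sbC.compr₂ C

/-- The exchange of the arguments. -/
def flipL : CC2 →ₗ[ℂ] CC2 := (LinearMap.lflip : CC2 ≃ₗ[ℂ] CC2)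

/-- Minus the differential of a complex 2-cochain as a trilinear map. -/
def d2L (C : CC2) (ε ε' : ℂ) : SMat →ₗ[ℂ] CC2 :=
  dTL C - ε • (flipL ∘ₗ dTL C) + ε' • (flipL ∘ₗ dTL C).flip

theorem d2L_apply (C : CC2) (ε ε' : ℂ) (X Y Z : SMat) : d2L C ε ε' X Y Z = d2C C ε ε' X Y Z := rfl

theorem d1C_neg (f : C1 (gOf r)) (p q : ZMod 2) (x y : ↥(neg (gOf r))) :
    d1C (cx1 f) (ksgn p q : ℝ) x y = d1 (gOf r) f p q x y := by
  rw [d1C, d1, cx1_neg, cx1_neg, ← ksgn_smul]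
  exact congrArg _ (cx1_neg f (nbr (gOf r) x y))

theorem dTC_neg (c : Bil (gOf r)) (x y z : ↥(neg (gOf r))) :
    dTC (cx2 c) x y z = dTerm (gOf r) c x y z := by
  rw [dTC, dTerm, cx2_neg]
  exact congrArg _ (cx2_neg c (nbr (gOf r) x y) z)

theorem d2C_neg (c : Bil (gOf r)) (p q s : ZMod 2) (x y z : ↥(neg (gOf r))) :
    d2C (cx2 c) (ksgn q s : ℝ) (ksgn p (q + s) : ℝ) x y z = d2 (gOf r) c p q s x y z := by
  rw [d2C, d2, dTC_neg, dTC_neg, dTC_neg, ksgn_smul, ksgn_smul]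

/-- The signs in the differential of a 2-cochain at matrix units. -/
abbrev d2mu (C : CC2) (k l m n p q : Ix) : SMat :=
  d2C C (sgn (odd m n && odd p q)) (sgn (odd k l && bx (odd m n) (odd p q)))
        (mu k l) (mu m n) (mu p q)

/-- The differential of a 1-cochain at matrix units. -/
abbrev d1mu (F : CC1) (k l m n : Ix) : SMat :=
  d1C F (sgn (odd k l && odd m n)) (mu k l) (mu m n)

theorem coe_ksgn_par_add (k l m n p q : Ix) :
    ((ksgn (par k l) (par m n + par p q) : ℝ) : ℂ) =
      sgn (odd k l && bx (odd m n) (odd p q)) := by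
  rw [ksgn_par_add]
  simp

/-- Once the parities are fixed, the differential is a trilinear map with constant signs. It
vanishes on real elements of these parities, hence on matrix units. -/
theorem d2mu_of_mem_Z2 {c : Bil (gOf r)} (hc : c ∈ Z2 (gOf r)) {k l m n p q : Ix}
    (hk : low k l = true) (hm : low m n = true) (hp : low p q = true) :
    d2mu (cx2 c) k l m n p q = 0 := by
  rw [d2mu, ← coe_ksgn_par, ← coe_ksgn_par_add, ← d2L_apply]
  generalize hL : d2L (cx2 c) _ _ = L
  have hL' : ∀ x y z : ↥(neg (gOf r)), HasPar (par k l) (x : SMat) → HasPar (par m n) (y : SMat) →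
      HasPar (par p q) (z : SMat) → L x y z = 0 := fun x y z hx hy hz => by
    rw [← hL, d2L_apply, d2C_neg]
    exact hc.2 _ _ _ x y z hx hy hz
  refine mu₂_of_par (r := r) (T := L (mu k l)) (fun y z hy hz => ?_) hm hp rfl rfl
  have key := mu_of_par (r := r) (T := (L.flip y).flip z) (fun x hx => hL' x y z hx hy hz) hk rfl
  exact key

theorem mem_Z2_of_d2mu {c : Bil (gOf r)} (hc : cx2 c ∈ coch r)
    (h : ∀ k l m n p q, low k l = true → low m n = true → low p q = true →
      d2mu (cx2 c) k l m n p q = 0) : c ∈ Z2 (gOf r) := by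
  refine ⟨isCochain_of_mem hc, fun p q s x y z hx hy hz => ?_⟩
  rw [← d2C_neg, ← d2L_apply]
  generalize hL : d2L (cx2 c) _ _ = L
  have hL' : ∀ k l m n m' n', low k l = true → low m n = true → low m' n' = true →
      par k l = p → par m n = q → par m' n' = s → L (mu k l) (mu m n) (mu m' n') = 0 := by
    intro k l m n m' n' hk hm hm' hp hq hs
    rw [← hL, d2L_apply, ← hp, ← hq, ← hs, coe_ksgn_par, coe_ksgn_par_add]
    exact h k l m n m' n' hk hm hm'
  refine par₂_of_mu (r := r) (T := L x) (fun m n m' n' hm hm' hq hs => ?_) y z hy hz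
  have key := par_of_mu (r := r) (T := (L.flip (mu m n)).flip (mu m' n'))
    (fun k l hk hp => hL' k l m n m' n' hk hm hm' hp hq hs) x hx
  exact key

theorem exists_d1mu_of_mem_B2 {c : Bil (gOf r)} (hc : c ∈ B2 (gOf r)) : ∃ F ∈ coch1 r,
    ∀ k l m n, low k l = true → low m n = true → cx2 c (mu k l) (mu m n) = d1mu F k l m n := by
  obtain ⟨f, hf⟩ := hc
  refine ⟨cx1 f, cx1_mem f, fun k l m n hk hm => ?_⟩
  rw [d1mu, ← coe_ksgn_par]
  refine sub_eq_zero.1 (mu₂_of_par (r := r) (T := cx2 c - d1L (cx1 f) _) (fun x y hx hy => ?_)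
    hk hm rfl rfl)
  rw [LinearMap.sub_apply, LinearMap.sub_apply, d1L_apply, d1C_neg, cx2_neg, hf _ _ x y hx hy,
    sub_self]

/-! ### Real parts -/

/-- The real part of a complex 1-cochain. -/
def re1 (r : Bool) (F : CC1) : C1 (gOf r) :=
  pr r ∘ₗ F.restrictScalars ℝ ∘ₗ (neg (gOf r)).subtype

/-- The real part of a complex bilinear map. -/
def re2 (r : Bool) : CC2 →ₗ[ℝ] Bil (gOf r) where
  toFun C := LinearMap.mk₂ ℝ (fun x y => pr r (C x y)) (fun x x' y => by simp)
    (fun t x y => by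
      rw [Submodule.coe_smul, real_smul_eq, map_smul, LinearMap.smul_apply, ← real_smul_eq, map_smul]) (fun x y y' => by simp)
    (fun t x y => by
      rw [Submodule.coe_smul, real_smul_eq, map_smul, ← real_smul_eq, map_smul])
  map_add' C D := by
    ext x y : 2
    exact map_add (pr r) _ _
  map_smul' t C := by
    ext x y : 2
    exact map_smul (pr r) t _

theorem re2_apply (C : CC2) (x y : ↥(neg (gOf r))) : re2 r C x y = pr r (C x y) := rfl

/-- A complex multiple of a complexified cochain has as its real part a real multiple of the same
cochain. This keeps real parts of complex combinations inside real subspaces. -/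
theorem re2_smul_cx2 (z : ℂ) (c : Bil (gOf r)) : re2 r (z • cx2 c) = z.re • c := by
  ext x y : 2
  refine Subtype.ext ?_
  rw [re2_apply, LinearMap.smul_apply, LinearMap.smul_apply, cx2_neg,
    coe_pr ((gC r).smul_mem z (gC_of_mem (c x y).2)), rp_smul (cj_of_mem (c x y).2)]
  rfl

theorem coch1_mem_gC {F : CC1} (hF : F ∈ coch1 r) (X : SMat) : F X ∈ gC r := by
  rw [eq_sum_mu X, map_sum]
  refine sum_mem fun k _ => ?_
  rw [map_sum]
  refine sum_mem fun l _ => ?_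
  rw [map_smul]
  exact (gC r).smul_mem _ (hF k l).2

theorem coe_re1 {F : CC1} (hF : F ∈ coch1 r) (x : ↥(neg (gOf r))) :
    (re1 r F x : SMat) = rp (F x) := coe_pr (coch1_mem_gC hF _)

/-- The arguments are real, so bracketing with them commutes with taking real parts (`rp_sbC`), and
the signs are real. -/
theorem d1_re1 {F : CC1} (hF : F ∈ coch1 r) (p q : ZMod 2) (x y : ↥(neg (gOf r))) :
    d1 (gOf r) (re1 r F) p q x y = rp (d1C F (ksgn p q : ℝ) x y) := by
  have e : (re1 r F (nbr (gOf r) x y) : SMat) = rp (F (sbC x y)) := coe_re1 hF _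
  rw [d1, d1C, coe_re1 hF, coe_re1 hF, e, map_sub, map_sub, ← ksgn_smul, map_smul,
    rp_sbC (coch1_mem_gC hF _) y.2.1, rp_sbC (coch1_mem_gC hF _) x.2.1]

/-- The complex span of the complexifications of real bilinear maps. -/
def cxSpan (W : Submodule ℝ (Bil (gOf r))) : Submodule ℂ CC2 := Submodule.span ℂ (cx2 '' (W : Set (Bil (gOf r))))

theorem re2_mem_of_mem_cxSpan {W : Submodule ℝ (Bil (gOf r))} {D : CC2} (hD : D ∈ cxSpan W) :
    re2 r D ∈ W := by
  -- The assertion is strengthened to all complex multiples of `D`, because the real part does not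
  -- commute with complex scalars in the induction.
  have key : ∀ z : ℂ, re2 r (z • D) ∈ W := by
    induction hD using Submodule.span_induction with
    | mem D h =>
      obtain ⟨c, hc, rfl⟩ := h
      intro z
      rw [re2_smul_cx2]
      exact W.smul_mem _ hc
    | zero => intro z; rw [smul_zero, map_zero]; exact W.zero_mem
    | add D D' _ _ h h' => intro z; rw [smul_add, map_add]; exact W.add_mem (h z) (h' z)
    | smul t D _ h => intro z; rw [smul_smul]; exact h _
  rw [← one_smul ℂ D]
  exact key 1

theorem cxSpan_mem_gC {W : Submodule ℝ (Bil (gOf r))} {D : CC2} (hD : D ∈ cxSpan W) (X Y : SMat) :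
    D X Y ∈ gC r := by
  induction hD using Submodule.span_induction with
  | mem D h =>
    obtain ⟨c, hc, rfl⟩ := h
    exact cx2_mem_gC c X Y
  | zero => exact zero_mem _
  | add D D' _ _ h h' => exact add_mem h h'
  | smul t D _ h => exact (gC r).smul_mem t h

theorem cxSpan_le_coch {W : Submodule ℝ (Bil (gOf r))} (hW : ∀ c ∈ W, IsCochain (gOf r) c) :
    cxSpan W ≤ coch r :=
  Submodule.span_le.2 fun D hD => by
    obtain ⟨c, hc, rfl⟩ := hD
    exact cx2_mem (hW c hc)

/-- Descent from `ℂ` to `ℝ`: the real part of `c = dF + D` expresses `c` as a coboundary, which lies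
in `W` by `hW`, plus the real part of `D`, which lies in `W` because `D` is in its complex span. -/
theorem mem_of_d1mu_add {W : Submodule ℝ (Bil (gOf r))} (hW : B2 (gOf r) ≤ W) {c : Bil (gOf r)}
    {F : CC1} (hF : F ∈ coch1 r) {D : CC2} (hD : D ∈ cxSpan W)
    (h : ∀ k l m n, low k l = true → low m n = true →
      cx2 c (mu k l) (mu m n) = d1mu F k l m n + D (mu k l) (mu m n)) : c ∈ W := by
  have key : c - re2 r D ∈ W := hW ⟨re1 r F, fun p q x y hx hy => by
    have e := par₂_of_mu (r := r) (T := cx2 c - D - d1L F (ksgn p q : ℝ))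
      (fun k l m n hk hm hp hq => by
        rw [LinearMap.sub_apply, LinearMap.sub_apply, LinearMap.sub_apply, LinearMap.sub_apply,
          h k l m n hk hm, d1mu, ← coe_ksgn_par, hp, hq, d1L_apply, add_sub_cancel_right,
          sub_self]) x y hx hy
    rw [LinearMap.sub_apply, LinearMap.sub_apply, LinearMap.sub_apply, LinearMap.sub_apply, cx2_neg,
      d1L_apply, sub_eq_zero] at e
    rw [d1_re1 hF, ← e, map_sub, rp_of_cj (cj_of_mem (c x y).2), LinearMap.sub_apply,
      LinearMap.sub_apply, re2_apply, Submodule.coe_sub, coe_pr (cxSpan_mem_gC hD _ _)]⟩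
  rw [← sub_add_cancel c (re2 r D)]
  exact W.add_mem key (re2_mem_of_mem_cxSpan hD)

/-! ### The action -/

/-- The action of `h` on complex 2-cochains as a linear map. -/
def actL (h : SMat) (C : CC2) : CC2 := C.compr₂ (sbC h) - C.comp (sbC h) - C.compl₂ (sbC h)

theorem actL_apply (h : SMat) (C : CC2) (X Y : SMat) : actL h C X Y = actC h C X Y := rfl

/-- An element of degree 0 mixes only indices of the same block, and whether a position has negative
degree depends only on the blocks. -/
theorem lowP_sbC {h : SMat} (hh : HasDeg 0 h) (X : SMat) : lowP (sbC h X) = sbC h (lowP X) := by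
  have h1 : ∀ i k : Ix, ¬ i.bl = k.bl → h i.toIdx k.toIdx = 0 := fun i k hik => by
    refine hh _ _ ?_
    rw [eDeg, blk_toIdx, blk_toIdx]
    omega
  have h2 : ∀ i k j : Ix, i.bl = k.bl → low i j = low k j ∧ low j i = low j k := by
    intro i k j
    cases i <;> cases k <;> cases j <;> decide
  have e : ∀ (Y Z : SMat) (i j : Ix), SMat.at (Y * Z) i j =
      ∑ k : Ix, SMat.at Y i k * SMat.at Z k j := by
    intro Y Z i j
    rw [SMat.at, Matrix.mul_apply]
    refine (Fintype.sum_equiv ⟨Ix.toIdx, Ix.ofIdx, Ix.ofIdx_toIdx, fun a => ?_⟩ _ _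
      fun _ => rfl).symm
    obtain ⟨k, rfl⟩ := Ix.exists_toIdx a
    rw [Ix.ofIdx_toIdx]
  refine at_ext fun i j => ?_
  rw [at_lowP, sbC_apply, sbC_apply, sb_even (even_of_deg_zero hh), sb_even (even_of_deg_zero hh),
    at_sub, at_sub, e, e, e, e, ← Finset.sum_sub_distrib, ← Finset.sum_sub_distrib]
  have h3 : (if low i j = true then ∑ k : Ix, (SMat.at h i k * SMat.at X k j -
      SMat.at X i k * SMat.at h k j) else 0) = ∑ k : Ix, if low i j = true then
      (SMat.at h i k * SMat.at X k j - SMat.at X i k * SMat.at h k j) else 0 := by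
    split_ifs <;> simp
  rw [h3]
  refine Finset.sum_congr rfl fun k _ => ?_
  have h4 : SMat.at h i k * SMat.at (lowP X) k j =
      if low i j = true then SMat.at h i k * SMat.at X k j else 0 := by
    by_cases hk : i.bl = k.bl
    · rw [at_lowP, (h2 i k j hk).1, mul_ite, mul_zero]
    · rw [SMat.at, h1 i k hk, zero_mul, zero_mul, ite_self]
  have h5 : SMat.at (lowP X) i k * SMat.at h k j =
      if low i j = true then SMat.at X i k * SMat.at h k j else 0 := by
    by_cases hk : k.bl = j.bl
    · rw [at_lowP, (h2 k j i hk).2, ite_mul, zero_mul]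
    · rw [SMat.at.eq_1 h, h1 k j hk, mul_zero, mul_zero, ite_self]
  rw [h4, h5]
  split_ifs <;> simp

theorem cx2_act (h : ↥(piece (gOf r) 0)) (c : Bil (gOf r)) :
    cx2 (act (gOf r) h c) = actL h (cx2 c) := by
  have h0 : HasDeg 0 (h : SMat) := h.2.2
  refine cx2_ext (r := r) (cx2_lowP _) (cx2_lowP_right _) (fun X => ?_) (fun X Y => ?_)
    fun x y => ?_
  · ext Y : 1
    rw [actL_apply, actL_apply, actC, actC, ← lowP_sbC h0, cx2_lowP, cx2_lowP]
  · rw [actL_apply, actL_apply, actC, actC, ← lowP_sbC h0, cx2_lowP_right, cx2_lowP_right,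
      cx2_lowP_right]
  · have e1 : cx2 c (sbC (h : SMat) x) y = c (adN (gOf r) h x) y :=
      cx2_neg c (adN (gOf r) h x) y
    have e2 : cx2 c x (sbC (h : SMat) y) = c x (adN (gOf r) h y) :=
      cx2_neg c x (adN (gOf r) h y)
    rw [actL_apply, actC, e1, e2, cx2_neg, cx2_neg, act_apply]
    rfl

theorem actL_add (h h' : SMat) (C : CC2) : actL (h + h') C = actL h C + actL h' C := by
  refine LinearMap.ext₂ fun X Y => ?_
  rw [LinearMap.add_apply, LinearMap.add_apply, actL_apply, actL_apply, actL_apply, actC, actC, actC,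
    map_add sbC, LinearMap.add_apply, LinearMap.add_apply, LinearMap.add_apply, map_add C,
    LinearMap.add_apply, map_add (C X)]
  abel

theorem actL_smul (z : ℂ) (h : SMat) (C : CC2) : actL (z • h) C = z • actL h C := by
  refine LinearMap.ext₂ fun X Y => ?_
  rw [LinearMap.smul_apply, LinearMap.smul_apply, actL_apply, actL_apply, actC, actC,
    map_smul sbC, LinearMap.smul_apply, LinearMap.smul_apply, LinearMap.smul_apply, map_smul C,
    LinearMap.smul_apply, map_smul (C X), smul_sub, smul_sub]

theorem actL_add_right (h : SMat) (C D : CC2) : actL h (C + D) = actL h C + actL h D := by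
  refine LinearMap.ext₂ fun X Y => ?_
  rw [LinearMap.add_apply, LinearMap.add_apply, actL_apply, actL_apply, actL_apply, actC, actC, actC]
  simp only [LinearMap.add_apply]
  rw [map_add]
  abel

theorem actL_smul_right (z : ℂ) (h : SMat) (C : CC2) : actL h (z • C) = z • actL h C := by
  refine LinearMap.ext₂ fun X Y => ?_
  rw [LinearMap.smul_apply, LinearMap.smul_apply, actL_apply, actL_apply, actC, actC]
  simp only [LinearMap.smul_apply]
  rw [map_smul, smul_sub, smul_sub]

theorem rp_mem_piece {h : SMat} (hh : h ∈ gC r) {d : ℤ} (h0 : HasDeg d h) :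
    rp h ∈ piece (gOf r) d := by
  refine ⟨rp_mem hh, hasDeg_iff.2 fun i j hij => ?_⟩
  rw [hasDeg_iff] at h0
  rw [rp_apply, real_smul_eq, at_smul, at_add, at_cj, h0 i j hij, h0 j.flip i.flip]
  · simp
  · rwa [eDeg_flip]

theorem exists_decomp {h : SMat} (hh : h ∈ gC r) (h0 : HasDeg 0 h) :
    ∃ a b : ↥(piece (gOf r) 0), h = (a : SMat) + I • (b : SMat) := by
  refine ⟨⟨_, rp_mem_piece hh h0⟩, ⟨_, rp_mem_piece (neg_mem ((gC r).smul_mem I hh)) ?_⟩,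
    rp_decomp h⟩
  intro i j hij
  simp [h0 i j hij]

/-- Invariance under the real `g_0` becomes invariance under its complexification, which contains
single off-diagonal matrix units; these are not real themselves. -/
theorem actL_mem_cxSpan {W : Submodule ℝ (Bil (gOf r))}
    (hW : ∀ h : ↥(piece (gOf r) 0), ∀ c ∈ W, act (gOf r) h c ∈ W) {h : SMat} (hh : h ∈ gC r)
    (h0 : HasDeg 0 h) {D : CC2} (hD : D ∈ cxSpan W) : actL h D ∈ cxSpan W := by
  obtain ⟨a, b, rfl⟩ := exists_decomp hh h0
  induction hD using Submodule.span_induction with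
  | mem D h =>
    obtain ⟨c, hc, rfl⟩ := h
    rw [actL_add, actL_smul, ← cx2_act, ← cx2_act]
    exact add_mem (Submodule.subset_span ⟨_, hW a c hc, rfl⟩)
      ((cxSpan W).smul_mem _ (Submodule.subset_span ⟨_, hW b c hc, rfl⟩))
  | zero =>
    rw [← zero_smul ℂ (0 : CC2), actL_smul_right, zero_smul]
    exact zero_mem _
  | add D D' _ _ h h' => rw [actL_add_right]; exact add_mem h h'
  | smul t D _ h => rw [actL_smul_right]; exact (cxSpan W).smul_mem t h

/-- If the classes of a cocycle are annihilated by the real elements spanning `h`, the complex action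
of `h` gives a coboundary. -/
theorem exists_d1mu_of_act {c : Bil (gOf r)} {h : SMat} {a b : ↥(piece (gOf r) 0)}
    (hab : h = (a : SMat) + I • (b : SMat)) (ha : act (gOf r) a c ∈ B2 (gOf r))
    (hb : act (gOf r) b c ∈ B2 (gOf r)) : ∃ F ∈ coch1 r, ∀ k l m n, low k l = true →
      low m n = true → actC h (cx2 c) (mu k l) (mu m n) = d1mu F k l m n := by
  obtain ⟨F, hF, hF'⟩ := exists_d1mu_of_mem_B2 ha
  obtain ⟨G, hG, hG'⟩ := exists_d1mu_of_mem_B2 hb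
  refine ⟨F + I • G, add_mem hF ((coch1 r).smul_mem I hG), fun k l m n hk hm => ?_⟩
  rw [← actL_apply, hab, actL_add, actL_smul, ← cx2_act, ← cx2_act, LinearMap.add_apply,
    LinearMap.add_apply, hF' k l m n hk hm, LinearMap.smul_apply, LinearMap.smul_apply,
    hG' k l m n hk hm, d1mu, d1mu, d1mu, d1C, d1C, d1C]
  simp only [LinearMap.add_apply, LinearMap.smul_apply, map_add, map_smul, smul_add, smul_sub,
    smul_comm I]
  abel

/-! ## Solving the linear systems -/

theorem sgn_true : sgn true = -1 := rfl

theorem sgn_false : sgn false = 1 := rfl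

/-- The differential of a complex 1-cochain as a 2-cochain. -/
def d1M (F : CC1) : CC2 :=
  linExt fun k l => linExt fun m n => bif low k l && low m n then d1mu F k l m n else 0

theorem d1M_mu (F : CC1) {k l m n : Ix} (hk : low k l = true) (hm : low m n = true) :
    d1M F (mu k l) (mu m n) = d1mu F k l m n := by
  rw [d1M, linExt_mu, linExt_mu, hk, hm]
  rfl

theorem low_mem_gC {k l : Ix} (h : low k l = true) : mu k l ∈ gC r := by
  have e := lowP_mem r (mu k l)
  rwa [lowP_mu, if_pos h] at e

theorem sbC_mu_swap (k l m n : Ix) :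
    sbC (mu m n) (mu k l) = -((sgn (odd k l && odd m n) : ℂ) • sbC (mu k l) (mu m n)) := by
  have h := sgn_mul_self (odd k l && odd m n)
  rw [sb_mu_mu, sb_mu_mu, Bool.and_comm (odd m n), sgn_not]
  generalize ((sgn (odd k l && odd m n) : ℤ) : ℂ) = s at h
  by_cases h1 : n = k <;> by_cases h2 : l = m <;> simp [h1, h2, smul_smul, h]

theorem d1M_mem {F : CC1} (hF : F ∈ coch1 r) : d1M F ∈ coch r := by
  intro k l m n
  rw [d1M, linExt_mu, linExt_mu, linExt_mu, linExt_mu]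
  refine ⟨fun h => by rw [h]; rfl, ?_, ?_⟩
  · rw [Bool.and_comm (low m n)]
    cases low k l && low m n
    · simp
    · have h := sgn_mul_self (odd k l && odd m n)
      simp only [cond_true]
      rw [d1mu, d1mu, d1C, d1C, Bool.and_comm (odd m n), sbC_mu_swap k l m n, map_neg, map_smul,
        smul_sub, smul_sub, smul_smul, h, one_smul]
      abel
  · cases hk : low k l
    · exact zero_mem _
    cases hm : low m n
    · exact zero_mem _
    exact sub_mem (sub_mem (sbC_mem (coch1_mem_gC hF _) (low_mem_gC hm))
      ((gC r).smul_mem _ (sbC_mem (coch1_mem_gC hF _) (low_mem_gC hk)))) (coch1_mem_gC hF _)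

/-! ### Numbering of the variables and valuations. -/

/-- The index given by the last digit of a number to base 5. -/
def digit (n : ℕ) : Ix :=
  match n % 5 with
  | 0 => .u0
  | 1 => .u1
  | 2 => .mid
  | 3 => .v0
  | _ => .v1

theorem digit_num {n a : ℕ} {k : Ix} (h : n = 5 * a + k.num) : digit n = k := by
  have e : n % 5 = k.num := by
    have := k.num_lt
    omega
  rw [digit, e]
  cases k <;> rfl

/-- The valuation given by a complex 1-cochain. -/
def valF (F : CC1) (n : ℕ) : ℂ :=
  SMat.at (F (mu (digit (n / 125)) (digit (n / 25)))) (digit (n / 5)) (digit n)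

/-- The valuation given by a complex 2-cochain. -/
def valC (C : CC2) (n : ℕ) : ℂ :=
  SMat.at (C (mu (digit (n / 3125)) (digit (n / 625))) (mu (digit (n / 125)) (digit (n / 25))))
    (digit (n / 5)) (digit n)

theorem fcode_eq (o : ℕ) (k l i j : Ix) : fcode o k l i j =
    o + (((k.num * 5 + l.num) * 5 + i.num) * 5 + j.num) := rfl

theorem ccode_eq (o : ℕ) (k l m n i j : Ix) : ccode o k l m n i j =
    o + (((((k.num * 5 + l.num) * 5 + m.num) * 5 + n.num) * 5 + i.num) * 5 + j.num) := by
  have : ccode o k l m n i j = (k.num * 5 + l.num) * 625 +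
    (o + (((m.num * 5 + n.num) * 5 + i.num) * 5 + j.num)) := rfl
  omega

theorem fcode_lt (k l i j : Ix) : fcode 0 k l i j < 625 := by
  have h1 := k.num_lt
  have h2 := l.num_lt
  have h3 := i.num_lt
  have h4 := j.num_lt
  rw [fcode_eq]
  omega

theorem valF_fcode (F : CC1) (k l i j : Ix) :
    valF F (fcode 0 k l i j) = SMat.at (F (mu k l)) i j := by
  have h2 := l.num_lt
  have h3 := i.num_lt
  have h4 := j.num_lt
  rw [fcode_eq, valF, digit_num (k := k) (a := 0), digit_num (k := l) (a := k.num),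
    digit_num (k := i) (a := k.num * 5 + l.num),
    digit_num (k := j) (a := (k.num * 5 + l.num) * 5 + i.num)] <;> omega

theorem valC_ccode (C : CC2) (k l m n i j : Ix) :
    valC C (ccode 0 k l m n i j) = SMat.at (C (mu k l) (mu m n)) i j := by
  have h2 := l.num_lt
  have h3 := m.num_lt
  have h4 := n.num_lt
  have h5 := i.num_lt
  have h6 := j.num_lt
  rw [ccode_eq, valC, digit_num (k := k) (a := 0), digit_num (k := l) (a := k.num),
    digit_num (k := m) (a := k.num * 5 + l.num),
    digit_num (k := n) (a := (k.num * 5 + l.num) * 5 + m.num),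
    digit_num (k := i) (a := ((k.num * 5 + l.num) * 5 + m.num) * 5 + n.num),
    digit_num (k := j) (a := (((k.num * 5 + l.num) * 5 + m.num) * 5 + n.num) * 5 + i.num)] <;> omega

theorem ccode_inj {k l m n i j k' l' m' n' i' j' : Ix}
    (h : ccode 0 k l m n i j = ccode 0 k' l' m' n' i' j') :
    k = k' ∧ l = l' ∧ m = m' ∧ n = n' ∧ i = i' ∧ j = j' := by
  have h2 := l.num_lt
  have h3 := m.num_lt
  have h4 := n.num_lt
  have h5 := i.num_lt
  have h6 := j.num_lt
  have h2' := l'.num_lt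
  have h3' := m'.num_lt
  have h4' := n'.num_lt
  have h5' := i'.num_lt
  have h6' := j'.num_lt
  rw [ccode_eq, ccode_eq] at h
  refine ⟨Ix.num_inj ?_, Ix.num_inj ?_, Ix.num_inj ?_, Ix.num_inj ?_, Ix.num_inj ?_,
    Ix.num_inj ?_⟩ <;> omega

/-- The valuation of the variables in the linear systems by two 1-cochains and a 2-cochain. -/
def val (G H : CC1) (C : CC2) (n : ℕ) : ℂ :=
  if n < 700 then 0 else if n < 1325 then valF G (n - 700)
  else if n < 2000 then valF H (n - 1325) else valC C (n - 2000)

/-- Layout of the variables: a 1-cochain takes `5 ^ 4 = 625` numbers. The unknowns are the primitive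
from 0 and the coefficients of tables from 625, all below 700. The parameters are two 1-cochains
from 700 and from 1325, and a 2-cochain from 2000. -/
theorem val_ccode (G H : CC1) (C : CC2) (k l m n i j : Ix) :
    val G H C (ccode 2000 k l m n i j) = SMat.at (C (mu k l) (mu m n)) i j := by
  have e : ccode 2000 k l m n i j = 2000 + ccode 0 k l m n i j := by
    rw [ccode_eq, ccode_eq]
    omega
  rw [val, if_neg (by omega), if_neg (by omega), if_neg (by omega), e, Nat.add_sub_cancel_left,
    valC_ccode]

theorem val_fcode₁ (G H : CC1) (C : CC2) (k l i j : Ix) :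
    val G H C (fcode 700 k l i j) = SMat.at (G (mu k l)) i j := by
  have e : fcode 700 k l i j = 700 + fcode 0 k l i j := by
    rw [fcode_eq, fcode_eq]
    omega
  have := fcode_lt k l i j
  rw [val, if_neg (by omega), if_pos (by omega), e, Nat.add_sub_cancel_left, valF_fcode]

theorem val_fcode₂ (G H : CC1) (C : CC2) (k l i j : Ix) :
    val G H C (fcode 1325 k l i j) = SMat.at (H (mu k l)) i j := by
  have e : fcode 1325 k l i j = 1325 + fcode 0 k l i j := by
    rw [fcode_eq, fcode_eq]
    omega
  have := fcode_lt k l i j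
  rw [val, if_neg (by omega), if_neg (by omega), if_pos (by omega), e, Nat.add_sub_cancel_left,
    valF_fcode]

/-! ### Tables as cochains and the computation of the action on them. -/

/-- The 2-cochain given by a table. -/
def tabC (r : Bool) (T : LF) : CC2 := mkC r 0 fun n => (look T n : ℂ)

theorem evZ_eq (T l : LF) : (evZ T l : ℂ) = LF.ev (fun n => (look T n : ℂ)) l := by
  induction l with
  | nil => simp [evZ, LF.ev]
  | cons t l ih =>
    rw [LF.ev, ← ih]
    exact (Int.cast_add (t.2 * look T t.1) (evZ T l)).trans (by rw [Int.cast_mul])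

theorem look_cons (t : ℕ × ℤ) (T : LF) (n : ℕ) :
    look (t :: T) n = (if t.1 = n then t.2 else 0) + look T n := by
  have e : look (t :: T) n = bif Nat.beq t.1 n then Int.add t.2 (look T n) else look T n := rfl
  rw [e]
  by_cases h : t.1 = n
  · rw [if_pos h, h, show Nat.beq n n = true by simp]
    rfl
  · rw [if_neg h, show Nat.beq t.1 n = false by rw [← Bool.not_eq_true, Nat.beq_eq]; exact h, zero_add]
    rfl

theorem look_eq_ev (T : LF) (n : ℕ) : (look T n : ℂ) = LF.ev (fun m => if m = n then 1 else 0) T := by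
  induction T with
  | nil => simp [look, LF.ev]
  | cons t T ih =>
    rw [look_cons, LF.ev, ← ih]
    push_cast
    simp

theorem look_append (T T' : LF) (n : ℕ) : look (T ++ T') n = look T n + look T' n := by
  induction T with
  | nil => simp [look]
  | cons t T ih => rw [List.cons_append, look_cons, look_cons, ih, add_assoc]

theorem look_eq_zero {T : LF} {n : ℕ} (h : ∀ t ∈ T, t.1 ≠ n) : look T n = 0 := by
  induction T with
  | nil => rfl
  | cons t T ih =>
    rw [look_cons, if_neg (h t List.mem_cons_self),
      ih fun t ht => h t (List.mem_cons_of_mem _ ht), zero_add]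

/-- A coefficient of a form is its value at the indicator function of the variable (`look_eq_ev`),
and normalizing a form does not change its values. -/
theorem tabK_spec (T : LF) : ∃ T', (∀ n, look T' n = look T n) ∧
    ∀ (α : Type) (k : LF → α), tabK T k = k T' := by
  obtain ⟨T', h, h'⟩ := LF.addK_spec 1 [] T
  refine ⟨T', fun n => ?_, h'⟩
  have e : (look T' n : ℂ) = look T n := by
    rw [look_eq_ev, look_eq_ev, h]
    simp [LF.ev]
  exact_mod_cast e

theorem look_forLow {f : Ix → Ix → LF} {k l : Ix} {n : ℕ} (hk : low k l = true)
    (h : ∀ k' l', ¬ (k' = k ∧ l' = l) → look (f k' l') n = 0) :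
    look (forLow f) n = look (f k l) n := by
  have h' : ∀ k' l', look (f k' l') n = if k' = k ∧ l' = l then look (f k l) n else 0 := by
    intro k' l'
    split_ifs with e
    · rw [e.1, e.2]
    · exact h k' l' e
  generalize look (f k l) n = a at h'
  simp only [forLow, look_append, h']
  cases k <;> cases l <;> first | exact absurd hk (by decide) | simp

theorem look_forIx {f : Ix → LF} {k : Ix} {n : ℕ}
    (h : ∀ k', k' ≠ k → look (f k') n = 0) : look (forIx f) n = look (f k) n := by
  have h' : ∀ k', look (f k') n = if k' = k then look (f k) n else 0 := by
    intro k'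
    split_ifs with e
    · rw [e]
    · exact h k' e
  generalize look (f k) n = a at h'
  simp only [forIx, look_append, h']
  cases k <;> simp

theorem forIx_forall {α : Type} {f : Ix → List α} {P : α → Prop}
    (h : ∀ k, ∀ a ∈ f k, P a) : ∀ a ∈ forIx f, P a := by
  intro a ha
  simp only [forIx, List.mem_append] at ha
  rcases ha with ha | ha | ha | ha | ha <;> exact h _ a ha

/-- Different coordinates have different numbers, so exactly one item of the concatenated lists can
contribute to a given coefficient. -/
theorem look_actTab {d : ℕ} {P Q : Ix} {T : LF} {k l m n i j : Ix} (h : canon r k l m n i j) :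
    look (actTab r d P Q T) (ccode 0 k l m n i j) =
      if degOk d k l m n i j then evZ T (actT r 0 P Q k l m n false i j []) else 0 := by
  obtain ⟨h1, h2, h3, h4⟩ := h
  have key : ∀ k' l' m' n' i' j', ∀ t ∈ (bif degOk d k' l' m' n' i' j' then
      [(ccode 0 k' l' m' n' i' j', evZ T (actT r 0 P Q k' l' m' n' false i' j' []))] else []),
      t.1 = ccode 0 k' l' m' n' i' j' := by
    intro k' l' m' n' i' j' t ht
    cases hd : degOk d k' l' m' n' i' j'
    · simp [hd] at ht
    · rw [hd] at ht
      rw [List.mem_singleton.1 ht]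
  rw [actTab, look_forLow h1, look_forLow h2, show Nat.ble (rank k l) (rank m n) = true by
    rw [Nat.ble_eq]; exact h3, cond_true, forEnt, look_forIx (k := i), look_forIx (k := j), h4]
  · cases degOk d k l m n i j
    · rfl
    · simp [look]
  · intro j' hj
    cases indep r i j'
    · rfl
    · exact look_eq_zero fun t ht e => hj (ccode_inj ((key _ _ _ _ _ _ t ht).symm.trans e)).2.2.2.2.2
  · intro i' hi
    refine look_eq_zero (forIx_forall fun j' => ?_)
    cases indep r i' j'
    · simp
    · intro t ht e
      exact hi (ccode_inj ((key _ _ _ _ _ _ t ht).symm.trans e)).2.2.2.2.1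
  · intro m' n' hm
    cases Nat.ble (rank k l) (rank m' n')
    · rfl
    · refine look_eq_zero (forEnt_forall fun i' j' t ht e => hm ?_)
      have := ccode_inj ((key _ _ _ _ _ _ t ht).symm.trans e)
      tauto
  · intro k' l' hk
    refine look_eq_zero (forLow_forall fun m' n' _ => ?_)
    cases Nat.ble (rank k' l') (rank m' n')
    · simp
    · refine forEnt_forall fun i' j' t ht e => hk ?_
      have := ccode_inj ((key _ _ _ _ _ _ t ht).symm.trans e)
      tauto


/-! ### Tables and words -/

/-- A 2-cochain of degree `d`. -/
def HasDegC (d : ℕ) (C : CC2) : Prop :=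
  ∀ k l m n i j, degOk d k l m n i j = false → SMat.at (C (mu k l) (mu m n)) i j = 0

theorem degOk_iff {d : ℕ} {k l m n i j : Ix} :
    degOk d k l m n i j = true ↔ j.bl + (k.bl + m.bl) = d + (i.bl + (l.bl + n.bl)) := by
  rw [degOk, Nat.beq_eq]
  rfl

theorem degOk_false_iff {d : ℕ} {k l m n i j : Ix} :
    degOk d k l m n i j = false ↔ ¬ j.bl + (k.bl + m.bl) = d + (i.bl + (l.bl + n.bl)) := by
  rw [← degOk_iff, Bool.not_eq_true]

theorem hasDegC_actL {d : ℕ} {C : CC2} (hC : HasDegC d C) {P Q : Ix} (hPQ : P.bl = Q.bl)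
    (ho : odd P Q = false) : HasDegC d (actL (mu P Q) C) := by
  intro k l m n i j h
  rw [degOk_false_iff] at h
  have h0 : ∀ k l m n i j, ¬ j.bl + (k.bl + m.bl) = d + (i.bl + (l.bl + n.bl)) →
      SMat.at (C (mu k l) (mu m n)) i j = 0 := fun k l m n i j h =>
    hC k l m n i j (degOk_false_iff.2 h)
  have e1 : SMat.at (C (sbC (mu P Q) (mu k l)) (mu m n)) i j = 0 := by
    rw [sb_mu_mu, map_add, LinearMap.add_apply, at_add]
    by_cases h1 : Q = k <;> by_cases h2 : l = P <;>
      simp only [h1, h2, if_true, if_false, map_zero, LinearMap.zero_apply, map_smul,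
        LinearMap.smul_apply, at_smul, at_zero]
    · subst h1 h2
      rw [h0 _ _ _ _ _ _ (by omega), h0 _ _ _ _ _ _ (by omega)]
      ring
    · subst h1
      rw [h0 _ _ _ _ _ _ (by omega)]
      ring
    · subst h2
      rw [h0 _ _ _ _ _ _ (by omega)]
      ring
    · ring
  have e2 : SMat.at (C (mu k l) (sbC (mu P Q) (mu m n))) i j = 0 := by
    rw [sb_mu_mu, map_add, at_add]
    by_cases h1 : Q = m <;> by_cases h2 : n = P <;>
      simp only [h1, h2, if_true, if_false, map_zero, map_smul, at_smul, at_zero]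
    · subst h1 h2
      rw [h0 _ _ _ _ _ _ (by omega), h0 _ _ _ _ _ _ (by omega)]
      ring
    · subst h1
      rw [h0 _ _ _ _ _ _ (by omega)]
      ring
    · subst h2
      rw [h0 _ _ _ _ _ _ (by omega)]
      ring
    · ring
  rw [actL_apply, actC, at_sub, at_sub, e1, e2, at_sb_mu_left _ _ _ _ _ ho]
  by_cases h1 : i = P <;> by_cases h2 : j = Q <;> simp only [h1, h2, if_true, if_false]
  · subst h1 h2
    rw [h0 _ _ _ _ _ _ (by omega), h0 _ _ _ _ _ _ (by omega)]
    ring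
  · subst h1
    rw [h0 _ _ _ _ _ _ (by omega)]
    ring
  · subst h2
    rw [h0 _ _ _ _ _ _ (by omega)]
    ring
  · ring

/-- The new table contains only entries of degree `d`. The others vanish because the matrix unit
preserves the degree of a cochain. -/
theorem tabC_actTab {d : ℕ} {P Q : Ix} {T : LF} (hPQ : P.bl = Q.bl) (ho : odd P Q = false)
    (hT : HasDegC d (tabC r T)) (hm : actL (mu P Q) (tabC r T) ∈ coch r) :
    tabC r (actTab r d P Q T) = actL (mu P Q) (tabC r T) := by
  refine (eq_mkC hm fun k l m n i j h => ?_).symm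
  rw [look_actTab h]
  split_ifs with hd
  · rw [evZ_eq, emits_actT (C := tabC r T) (fun k l m n => emits_cT r 0 _ k l m n) ho]
    simp [sgn, LF.ev, actL_apply]
  · rw [hasDegC_actL hT hPQ ho k l m n i j (by simpa using hd), Int.cast_zero]

/-- A table of the given degree of an element of `S`. -/
def GoodTab (r : Bool) (S : Submodule ℂ CC2) (t : ℕ × LF) : Prop :=
  tabC r t.2 ∈ S ∧ HasDegC t.1 (tabC r t.2)

/-- A space of cochains stable under the lowering operators. -/
structure IsLowStable (r : Bool) (S : Submodule ℂ CC2) : Prop where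
  le : S ≤ coch r
  act₁ : ∀ C ∈ S, actL (mu .u1 .u0) C ∈ S
  act₂ : ∀ C ∈ S, actL (mu .v0 .v1) C ∈ S

/-- The list of words is not identified. It is enough that each result lies in the stable space `S`
and has the recorded degree, which is all that the continuation's verdict is combined with later. -/
theorem wordsK_spec {S : Submodule ℂ CC2} (hS : IsLowStable r S) (d : ℕ) (w : Word) (T : LF)
    (ws : List (ℕ × LF)) (k : List (ℕ × LF) → Bool) (h : wordsK r d w T ws k = true)
    (hT : GoodTab r S (d, T)) (hws : ∀ t ∈ ws, GoodTab r S t) :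
    ∃ ws', (∀ t ∈ ws', GoodTab r S t) ∧ k ws' = true := by
  induction w generalizing T ws k with
  | nil => exact ⟨ws, hws, h⟩
  | node w₁ w₂ ih₁ ih₂ =>
    obtain ⟨T', hT', e⟩ := tabK_spec T
    have h' : wordsK r d w₁ (actTab r d .u1 .u0 T') ((d, T') :: ws)
        (fun ws => wordsK r d w₂ (actTab r d .v0 .v1 T') ws k) = true :=
      (e Bool _).symm.trans h
    have eT : tabC r T' = tabC r T := by
      rw [tabC, tabC]
      congr 1
      funext n
      rw [hT']
    have hT1 : GoodTab r S (d, T') := by rwa [GoodTab, eT]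
    have hA : ∀ P Q : Ix, P.bl = Q.bl → odd P Q = false →
        (∀ C ∈ S, actL (mu P Q) C ∈ S) → GoodTab r S (d, actTab r d P Q T') := by
      intro P Q hPQ ho hs
      have e2 := tabC_actTab hPQ ho hT1.2 (hS.le (hs _ hT1.1))
      rw [GoodTab, e2]
      exact ⟨hs _ hT1.1, hasDegC_actL hT1.2 hPQ ho⟩
    obtain ⟨ws₁, h1, h2⟩ := ih₁ _ _ _ h' (hA .u1 .u0 rfl rfl hS.act₁) (by
      intro t ht
      rcases List.mem_cons.1 ht with rfl | ht
      exacts [hT1, hws t ht])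
    exact ih₂ _ _ _ h2 (hA .v0 .v1 rfl rfl hS.act₂) h1

theorem allWordsK_spec {S : Submodule ℂ CC2} (hS : IsLowStable r S) (l : List (ℕ × LF × Word))
    (ws : List (ℕ × LF)) (k : List (ℕ × LF) → Bool) (h : allWordsK r l ws k = true)
    (hl : ∀ t ∈ l, GoodTab r S (t.1, t.2.1)) (hws : ∀ t ∈ ws, GoodTab r S t) :
    ∃ ws', (∀ t ∈ ws', GoodTab r S t) ∧ k ws' = true := by
  induction l generalizing ws with
  | nil => exact ⟨ws, hws, h⟩
  | cons t l ih =>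
    obtain ⟨ws₁, h1, h2⟩ := wordsK_spec hS t.1 t.2.2 t.2.1 ws _ h (hl t List.mem_cons_self) hws
    exact ih ws₁ h2 (fun t ht => hl t (List.mem_cons_of_mem _ ht)) h1

/-- The linear combination of tables with coefficients from a valuation. -/
def combC (r : Bool) (w : ℕ → ℂ) : List (ℕ × LF) → ℕ → CC2
  | [], _ => 0
  | t :: ws, o => w o • tabC r t.2 + combC r w ws (o + 1)

theorem combC_mem {S : Submodule ℂ CC2} (w : ℕ → ℂ) {ws : List (ℕ × LF)}
    (h : ∀ t ∈ ws, GoodTab r S t) (o : ℕ) : combC r w ws o ∈ S := by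
  induction ws generalizing o with
  | nil => exact zero_mem _
  | cons t ws ih =>
    exact add_mem (S.smul_mem _ (h t List.mem_cons_self).1)
      (ih (fun t ht => h t (List.mem_cons_of_mem _ ht)) _)

theorem combC_mem_coch (w : ℕ → ℂ) (ws : List (ℕ × LF)) (o : ℕ) : combC r w ws o ∈ coch r := by
  induction ws generalizing o with
  | nil => exact zero_mem _
  | cons t ws ih => exact add_mem ((coch r).smul_mem _ (mkC_mem _ _ _)) (ih _)

/-- Tables of another degree are skipped at a given entry, and by hypothesis they vanish there. -/
theorem ev_combT (w : ℕ → ℂ) {ws : List (ℕ × LF)} (h : ∀ t ∈ ws, HasDegC t.1 (tabC r t.2))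
    (o : ℕ) (k l m n i j : Ix) : LF.ev w (combT r k l m n i j ws o) =
      SMat.at (combC r w ws o (mu k l) (mu m n)) i j := by
  induction ws generalizing o with
  | nil => rfl
  | cons t ws ih =>
    have e1 : (evZ t.2 (cT r 0 k l m n false i j []) : ℂ) =
        SMat.at (tabC r t.2 (mu k l) (mu m n)) i j := by
      rw [evZ_eq, emits_cT]
      simp [sgn, LF.ev, tabC]
    have e : combT r k l m n i j (t :: ws) o = bif degOk t.1 k l m n i j then
      (o, evZ t.2 (cT r 0 k l m n false i j [])) :: combT r k l m n i j ws (o + 1) else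
      combT r k l m n i j ws (o + 1) := rfl
    rw [e, combC, LinearMap.add_apply, LinearMap.add_apply, at_add, LinearMap.smul_apply,
      LinearMap.smul_apply, at_smul, ← ih fun t ht => h t (List.mem_cons_of_mem _ ht)]
    cases hd : degOk t.1 k l m n i j
    · rw [h t List.mem_cons_self k l m n i j hd, mul_zero, zero_add]
      rfl
    · rw [cond_true, LF.ev, e1]
      ring

/-! ### The consequences of the checks -/

/-- The rows are only part of the cocycle equations. They occur as hypotheses of solvability
statements, so leaving equations out makes the check harder to pass but not unsound. -/
theorem ev_d2rows {o : ℕ} {v : ℕ → ℂ} (h : ∀ k l m n p q, low k l = true → low m n = true →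
    low p q = true → d2mu (mkC r o v) k l m n p q = 0) :
    ∀ row ∈ d2rows r o, LF.ev v row = 0 := by
  refine forOdd_forall fun k l hk => forOdd_forall fun m n hm => ?_
  cases Nat.ble (rank k l) (rank m n)
  · simp
  rw [cond_true]
  refine forLow_forall fun p q hp => ?_
  cases !(odd p q) || Nat.ble (rank m n) (rank p q)
  · simp
  refine forEnt_forall fun i j row hrow => ?_
  rw [List.mem_singleton.1 hrow, emits_d2T (fun k l m n => emits_cT r o v k l m n)]
  exact congrArg (fun X => SMat.at X i j) (h k l m n p q hk hm hp)

theorem eq_of_spanRows {C : CC2} (hC : C ∈ coch r) {w : ℕ → ℂ} {ws : List (ℕ × LF)}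
    (hws : ∀ t ∈ ws, HasDegC t.1 (tabC r t.2)) (hw : C = mkC r 2000 w)
    (h : ∀ row ∈ spanRows r ws, LF.ev w row = 0) :
    C = d1M (mkF r 0 w) + combC r w ws 625 := by
  refine coch_ext hC (add_mem (d1M_mem (mkF_mem _ _ _)) (combC_mem_coch _ _ _))
    fun k l m n i j hc => ?_
  have e := h _ (mem_pairs hc)
  rw [emits_d1T (fun k l => emits_fT r 0 w k l), emits_cT, ev_combT w hws, ← hw] at e
  rw [LinearMap.add_apply, LinearMap.add_apply, at_add, d1M_mu _ hc.1 hc.2.1]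
  rw [sgn_true, sgn_false] at e
  push_cast at e
  linear_combination -e

/-- `C`, `G` and `H` enter as parameters. The solver keeps their values, and in its solution the
variables below 625 form the primitive `F`, while those from 625 on are the coefficients of the
combination `D`. -/
theorem exists_of_solvable {C : CC2} (hC : C ∈ coch r) {G H : CC1} {eqs : List LF}
    {ws : List (ℕ × LF)} (h : solvable 700 eqs (spanRows r ws) = true)
    {S : Submodule ℂ CC2} (hws : ∀ t ∈ ws, GoodTab r S t)
    (hv : ∀ row ∈ eqs, LF.ev (val G H C) row = 0) :
    ∃ F ∈ coch1 r, ∃ D ∈ S, C = d1M F + D := by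
  obtain ⟨w, hw, hrows⟩ := solvable_spec h (val G H C) hv
  have e : C = mkC r 2000 w := eq_mkC hC fun k l m n i j _ => by
    rw [hw, val_ccode]
    rw [ccode_eq]
    omega
  exact ⟨_, mkF_mem _ _ _, _, combC_mem w hws _,
    eq_of_spanRows hC (fun t ht => (hws t ht).2) e hrows⟩

theorem eq_mkC_val {C : CC2} (hC : C ∈ coch r) (G H : CC1) : C = mkC r 2000 (val G H C) :=
  eq_mkC hC fun k l m n i j _ => val_ccode G H C k l m n i j

theorem exists_of_checkSpan {l : List (ℕ × LF × Word)} (h : checkSpan r l = true)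
    {S : Submodule ℂ CC2} (hS : IsLowStable r S) (hl : ∀ t ∈ l, GoodTab r S (t.1, t.2.1))
    {C : CC2} (hC : C ∈ coch r) (hd : ∀ k l m n p q, low k l = true → low m n = true →
      low p q = true → d2mu C k l m n p q = 0) : ∃ F ∈ coch1 r, ∃ D ∈ S, C = d1M F + D := by
  obtain ⟨ws, hws, h'⟩ := allWordsK_spec hS l [] _ h hl (by simp)
  refine exists_of_solvable (G := 0) (H := 0) hC h' hws (ev_d2rows ?_)
  rwa [← eq_mkC_val hC]

theorem ev_actRows {o : ℕ} {v : ℕ → ℂ} {P Q : Ix} (ho : odd P Q = false)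
    (h : ∀ k l m n, low k l = true → low m n = true →
      actC (mu P Q) (mkC r 2000 v) (mu k l) (mu m n) = d1mu (mkF r o v) k l m n) :
    ∀ row ∈ actRows r o P Q, LF.ev v row = 0 := by
  refine pairs_forall fun k l m n i j hk hm => ?_
  rw [emits_d1T (fun k l => emits_fT r o v k l),
    emits_actT (fun k l m n => emits_cT r 2000 v k l m n) ho, h k l m n hk hm, sgn_true, sgn_false]
  simp [LF.ev]

/-- Exactness of the images under the raising operators is made linear by treating the primitives
`G` and `H` as parameters alongside `C`. -/
theorem exists_of_checkHW {ws : List (ℕ × LF)} (h : checkHW r ws = true)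
    {S : Submodule ℂ CC2} (hws : ∀ t ∈ ws, GoodTab r S t)
    {C : CC2} (hC : C ∈ coch r) (hd : ∀ k l m n p q, low k l = true → low m n = true →
      low p q = true → d2mu C k l m n p q = 0)
    {G H : CC1} (hG : G ∈ coch1 r) (hH : H ∈ coch1 r)
    (hGC : ∀ k l m n, low k l = true → low m n = true →
      actC (mu .u0 .u1) C (mu k l) (mu m n) = d1mu G k l m n)
    (hHC : ∀ k l m n, low k l = true → low m n = true →
      actC (mu .v1 .v0) C (mu k l) (mu m n) = d1mu H k l m n) :
    ∃ F ∈ coch1 r, ∃ D ∈ S, C = d1M F + D := by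
  have e := eq_mkC_val hC G H
  have e1 : G = mkF r 700 (val G H C) := eq_mkF hG fun k l i j _ _ => val_fcode₁ G H C k l i j
  have e2 : H = mkF r 1325 (val G H C) := eq_mkF hH fun k l i j _ _ => val_fcode₂ G H C k l i j
  refine exists_of_solvable (G := G) (H := H) hC h hws fun row hrow => ?_
  rcases List.mem_append.1 hrow with hrow | hrow
  · refine ev_actRows rfl ?_ row hrow
    rwa [← e, ← e1]
  rcases List.mem_append.1 hrow with hrow | hrow
  · refine ev_actRows rfl ?_ row hrow
    rwa [← e, ← e2]
  · refine ev_d2rows ?_ row hrow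
    rwa [← e]

theorem eq_zero_of_checkIndep {ws : List (ℕ × LF)} (h : checkIndep r ws = true)
    (hws : ∀ t ∈ ws, HasDegC t.1 (tabC r t.2)) {F : CC1} (hF : F ∈ coch1 r) {z : ℕ → ℂ}
    (hz : ∀ k l m n, low k l = true → low m n = true →
      d1mu F k l m n + combC r z ws 625 (mu k l) (mu m n) = 0) :
    ∀ i < ws.length, z (625 + i) = 0 := by
  intro i hi
  -- A single valuation that carries both the primitive and the coefficients of the relation.
  let v : ℕ → ℂ := fun n => if n < 625 then valF F n else z n
  have hv : ∀ n, 625 ≤ n → v n = z n := fun n hn => if_neg (by omega)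
  have e1 : F = mkF r 0 v := eq_mkF hF fun k l i j _ _ => by
    rw [← valF_fcode]
    exact if_pos (fcode_lt k l i j)
  have e2 : ∀ (ws : List (ℕ × LF)) (o : ℕ), 625 ≤ o → combC r v ws o = combC r z ws o := by
    intro ws
    induction ws with
    | nil => intro o _; rfl
    | cons t ws ih => intro o ho; rw [combC, combC, ih _ (by omega), hv _ ho]
  have key := implied_spec h (v := v) (pairs_forall fun k l m n i j hk hm => by
    rw [emits_d1T (fun k l => emits_fT r 0 v k l), ev_combT v hws, e2 _ _ le_rfl, ← e1]
    have := congrArg (fun X => SMat.at X i j) (hz k l m n hk hm)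
    simpa [sgn_false, at_add, at_zero] using this)
  have := key _ (List.mem_map.2 ⟨i, List.mem_range.2 hi, rfl⟩)
  rw [← hv _ (by omega)]
  simpa [LF.ev] using this

/-! ## The prolongs -/

theorem emits_fdT {d o : ℕ} {v : ℕ → ℂ} {F : CC1} (hF : F = mkF r o v)
    (hd : ∀ k l i j : Ix, ¬ j.bl + k.bl = i.bl + l.bl + d → SMat.at (F (mu k l)) i j = 0)
    (k l : Ix) : Emits v (fdT r d o k l) (SMat.at (F (mu k l))) := by
  intro s i j acc
  by_cases h : j.bl + k.bl = i.bl + l.bl + d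
  · have e : Nat.beq (Nat.add j.bl k.bl) (Nat.add (Nat.add i.bl l.bl) d) = true := by
      rw [Nat.beq_eq]
      exact h
    rw [fdT, e, cond_true, emits_fT, hF]
  · have e : Nat.beq (Nat.add j.bl k.bl) (Nat.add (Nat.add i.bl l.bl) d) = false := by
      rw [← Bool.not_eq_true, Nat.beq_eq]
      exact h
    rw [fdT, e, cond_false, hd k l i j h, mul_zero, zero_add]

/-- Derivations of positive degree are inner. -/
theorem exists_of_checkInner {d : ℕ} (hd : 0 < d) (h : checkInner r d = true) {F : CC1}
    (hF : F ∈ coch1 r)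
    (hFd : ∀ k l i j : Ix, ¬ j.bl + k.bl = i.bl + l.bl + d → SMat.at (F (mu k l)) i j = 0)
    (hF0 : ∀ k l m n, low k l = true → low m n = true → d1mu F k l m n = 0) :
    ∃ X ∈ gC r, (∀ i j : Ix, ¬ j.bl = i.bl + d → SMat.at X i j = 0) ∧
      ∀ k l, low k l = true → F (mu k l) = sbC X (mu k l) := by
  have e : ∀ w : ℕ → ℂ, (∀ n, 25 ≤ n → w n = valF F (n - 25)) → F = mkF r 25 w :=
    fun w hw => eq_mkF hF fun k l i j _ _ => by
      have e : fcode 25 k l i j = 25 + fcode 0 k l i j := by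
        rw [fcode_eq, fcode_eq]
        omega
      rw [hw _ (by omega), e, Nat.add_sub_cancel_left, valF_fcode]
  obtain ⟨w, hw, hrows⟩ := solvable_spec h (fun n => valF F (n - 25))
    (pairs_forall fun k l m n i j hk hm => by
      rw [emits_d1T (emits_fdT (e (fun n => valF F (n - 25)) fun _ _ => rfl) hFd)]
      have := congrArg (fun X => SMat.at X i j) (hF0 k l m n hk hm)
      simpa [sgn_false, at_add, at_zero, LF.ev] using this)
  -- The solution is cut down to degree `d`, as the equations contain no other entries of the inner
  -- derivation.
  let x : Ix → Ix → ℂ := fun i j => if j.bl = i.bl + d then fill r (fun i j => w (rank i j)) i j else 0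
  have hx : Emits w (fun s i j acc =>
      bif Nat.beq j.bl (Nat.add i.bl d) then entT r rank s i j acc else acc)
      (SMat.at (ofAt x)) := by
    intro s i j acc
    rw [at_ofAt]
    by_cases hij : j.bl = i.bl + d
    · have e : Nat.beq j.bl (Nat.add i.bl d) = true := by
        rw [Nat.beq_eq]
        exact hij
      simp only [e, cond_true]
      rw [emits_entT]
      simp only [x, if_pos hij]
    · have e : Nat.beq j.bl (Nat.add i.bl d) = false := by
        rw [← Bool.not_eq_true, Nat.beq_eq]
        exact hij
      simp only [x, e, cond_false, if_neg hij, mul_zero, zero_add]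
  refine ⟨ofAt x, ?_, fun i j hij => ?_, fun k l hk => at_ext fun i j => ?_⟩
  -- Since `d > 0`, the diagonal entries vanish and satisfy the trace conditions. In the reduced
  -- case `fill` also kills the entries of positive degree.
  · cases r
    · rw [mem_gC_false, at_ofAt]
      simp [x, hd.ne']
    · rw [mem_gC_true, at_ofAt]
      refine ⟨fun i j hij => ?_, by simp [x, hd.ne'], by simp [x, hd.ne'], by simp [x, hd.ne']⟩
      have e : Nat.blt i.bl j.bl = true := by rw [Nat.blt_eq]; exact hij
      simp [x, fill, e]
  · rw [at_ofAt]
    exact if_neg hij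
  · have e2 := hrows _ (mem_forLow hk (mem_forIx (k := i) (mem_forIx (k := j)
      (List.mem_singleton.2 rfl))))
    rw [hx.brT, emits_fdT (e w hw) hFd, sgn_true, sgn_false] at e2
    simp only [LF.ev] at e2
    push_cast at e2
    linear_combination -e2

theorem eq_zero_of_checkTransitive (h : checkTransitive r = true) {X : SMat} (hX : X ∈ gC r)
    (h0 : ∀ i j : Ix, j.bl < i.bl → SMat.at X i j = 0)
    (hc : ∀ k l, low k l = true → sbC X (mu k l) = 0) : X = 0 := by
  let v : ℕ → ℂ := fun n => SMat.at X (digit (n / 5)) (digit n)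
  have hv : ∀ i j, v (rank i j) = SMat.at X i j := fun i j => by
    have := j.num_lt
    have e := rank_eq i j
    simp only [v]
    rw [digit_num (k := i) (a := 0), digit_num (k := j) (a := i.num)] <;> omega
  have hx : Emits v (fun s i j acc =>
      bif Nat.ble i.bl j.bl then entT r rank s i j acc else acc) (SMat.at X) := by
    intro s i j acc
    by_cases hij : i.bl ≤ j.bl
    · have e : Nat.ble i.bl j.bl = true := by
        rw [Nat.ble_eq]
        exact hij
      simp only [e, cond_true]
      rw [emits_entT, hX i j]
      simp only [hv]
    · have e : Nat.ble i.bl j.bl = false := by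
        rw [← Bool.not_eq_true, Nat.ble_eq]
        exact hij
      simp only [e, cond_false]
      rw [h0 i j (by omega), mul_zero, zero_add]
  have key := implied_spec h (v := v) (forLow_forall fun k l hk => forIx_forall fun i =>
    forIx_forall fun j row hrow => by
      rw [List.mem_singleton.1 hrow, hx.brT, hc k l hk, at_zero, mul_zero, zero_add]
      rfl)
  refine gC_ext hX (zero_mem _) fun i j hi => ?_
  by_cases hij : i.bl ≤ j.bl
  · have e : Nat.ble i.bl j.bl = true := by
      rw [Nat.ble_eq]
      exact hij
    have := key [(rank i j, 1)] (mem_forEnt hi (by rw [e]; exact List.mem_singleton.2 rfl))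
    rw [at_zero, ← hv]
    simpa [LF.ev] using this
  · exact h0 i j (by omega)

theorem eDeg_toIdx (i j : Ix) : eDeg i.toIdx j.toIdx = j.bl - i.bl := by
  rw [eDeg, blk_toIdx, blk_toIdx]

/-- Only zero commutes with the negative part. -/
theorem eq_zero_of_sb_eq_zero (h : checkTransitive r = true) {z : SMat}
    (hz : z ∈ (gOf r).carrier) (h0 : ∀ i j : Ix, j.bl < i.bl → SMat.at z i j = 0)
    (hc : ∀ x : ↥(neg (gOf r)), sb z x = 0) : z = 0 :=
  eq_zero_of_checkTransitive h (gC_of_mem hz) h0 fun _ _ hk =>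
    mu_of_neg (r := r) (T := sbC z) (P := fun _ _ => True) (fun x _ => hc x) hk trivial trivial

theorem d1mu_of_d1 {f : C1 (gOf r)} (hf : ∀ (p q : ZMod 2) (x y : ↥(neg (gOf r))),
    HasPar p (x : SMat) → HasPar q (y : SMat) → d1 (gOf r) f p q x y = 0) {k l m n : Ix}
    (hk : low k l = true) (hm : low m n = true) : d1mu (cx1 f) k l m n = 0 := by
  rw [d1mu, ← coe_ksgn_par, ← d1L_apply]
  refine mu₂_of_par (r := r) (T := d1L (cx1 f) _) (fun x y hx hy => ?_) hk hm rfl rfl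
  rw [d1L_apply, d1C_neg, hf _ _ x y hx hy]

/-- Existence is obtained over `ℂ` and made real by taking a real part. Faithfulness of `g_0` and
uniqueness both come from the absence of elements commuting with the negative part. -/
theorem isProlong_gOf (ht : checkTransitive r = true)
    (hi : ∀ d < 5, 0 < d → checkInner r d = true) : IsProlong (gOf r) := by
  refine ⟨fun z hz hc => eq_zero_of_sb_eq_zero ht hz.1 (fun i j hij => hz.2 _ _ ?_) hc,
    fun k hk f hfd hf => ?_⟩
  · rw [eDeg_toIdx]
    omega
  obtain ⟨d, rfl⟩ := Int.eq_ofNat_of_zero_le hk.le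
  have hd : 0 < d := by exact_mod_cast hk
  have hu : ∀ z z' : SMat, z ∈ piece (gOf r) d → z' ∈ piece (gOf r) d →
      (∀ x : ↥(neg (gOf r)), sb z x = sb z' x) → z = z' := by
    intro z z' hz hz' h
    refine sub_eq_zero.1 (eq_zero_of_sb_eq_zero ht (Submodule.sub_mem _ hz.1 hz'.1)
      (fun i j hij => ?_) fun x => ?_)
    · have h1 : ¬ eDeg i.toIdx j.toIdx = d := by
        rw [eDeg_toIdx]
        omega
      rw [at_sub, SMat.at, SMat.at, hz.2 _ _ h1, hz'.2 _ _ h1, sub_zero]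
    · rw [map_sub, LinearMap.sub_apply, h, sub_self]
  have hFd : ∀ k l i j : Ix, ¬ j.bl + k.bl = i.bl + l.bl + d →
      SMat.at (cx1 f (mu k l)) i j = 0 := by
    intro k l i j hij
    cases hl : low k l
    · rw [(cx1_mem f k l).1 hl]
      rfl
    refine mu_of_neg (r := r) (T := atL i j ∘ₗ cx1 f)
      (P := fun k' l' => eDeg k'.toIdx l'.toIdx = eDeg k.toIdx l.toIdx) (fun x hx => ?_) hl rfl
      (eDeg_flip k l)
    rw [LinearMap.comp_apply, cx1_neg]
    refine hfd _ x (hasDeg_iff.2 hx) _ _ ?_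
    rw [eDeg_toIdx, eDeg_toIdx]
    omega
  have hex : ∃ X ∈ gC r, (∀ i j : Ix, ¬ j.bl = i.bl + d → SMat.at X i j = 0) ∧
      ∀ k l, low k l = true → cx1 f (mu k l) = sbC X (mu k l) := by
    rcases lt_or_ge d 5 with h5 | h5
    · exact exists_of_checkInner hd (hi d h5 hd) (cx1_mem f) hFd
        fun k l m n hk hm => d1mu_of_d1 hf hk hm
    -- All degrees lie between -2 and 2, so a map of degree at least 5 is zero.
    · refine ⟨0, zero_mem _, fun _ _ _ => rfl, fun k l hk => at_ext fun i j => ?_⟩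
      rw [map_zero, LinearMap.zero_apply, at_zero]
      have hb : ∀ i : Ix, i.bl ≤ 2 := fun i => by cases i <;> decide
      have := hb j
      have := hb k
      exact hFd k l i j (by omega)
  obtain ⟨X, hX, hXd, hFX⟩ := hex
  have hXd' : HasDeg d X := hasDeg_iff.2 fun i j hij => hXd i j fun e => hij (by
    rw [eDeg_toIdx]
    omega)
  -- The values of `f` are real, so the real part of the complex element induces the same derivation
  -- on real arguments.
  have hz : ∀ x : ↥(neg (gOf r)), (f x : SMat) = sb (rp X) x := fun x => by
    have e : cx1 f x = sbC X x := sub_eq_zero.1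
      (neg_of_mu (T := cx1 f - sbC X) (P := fun _ _ => True)
        (fun k l hk _ => by rw [LinearMap.sub_apply, hFX k l hk, sub_self]) x
        fun _ _ h => absurd trivial h)
    rw [← rp_sbC hX x.2.1, ← e, cx1_neg, rp_of_cj (cj_of_mem (f x).2)]
  exact ⟨rp X, ⟨rp_mem_piece hX hXd', hz⟩, fun z h =>
    hu _ _ h.1 (rp_mem_piece hX hXd') fun x => by rw [← h.2, hz]⟩

/-! ## Checks for single tables -/

/-- Whether `g` holds for all indices. -/
def ixCheck (g : Ix → Bool) : Bool :=
  bif g .u0 then bif g .u1 then bif g .mid then bif g .v0 then g .v1 else false else false else false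
  else false

/-- Whether `g` holds for all positions of negative degree. -/
def lowCheck (g : Ix → Ix → Bool) : Bool :=
  bif g .mid .u0 then bif g .mid .u1 then bif g .v0 .u0 then bif g .v0 .u1 then bif g .v0 .mid then
    bif g .v1 .u0 then bif g .v1 .u1 then g .v1 .mid else false else false else false else false
    else false else false else false

/-- Whether `g` holds for all pairs of basis elements and all entries. -/
def pairCheck (g : Ix → Ix → Ix → Ix → Ix → Ix → Bool) : Bool :=
  lowCheck fun k l => lowCheck fun m n => ixCheck fun i => ixCheck fun j => g k l m n i j

/-- Whether `g` holds for all triples of basis elements and all entries. -/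
def tripleCheck (g : Ix → Ix → Ix → Ix → Ix → Ix → Ix → Ix → Bool) : Bool :=
  lowCheck fun k l => lowCheck fun m n => lowCheck fun p q =>
    ixCheck fun i => ixCheck fun j => g k l m n p q i j

/-- Whether an entry of a value at a triple belongs to the part of degree `d` of a 3-cochain. -/
def degOk₃ (d : ℕ) (k l m n p q i j : Ix) : Bool :=
  Nat.beq (Nat.add j.bl (Nat.add k.bl (Nat.add m.bl p.bl)))
    (Nat.add d (Nat.add i.bl (Nat.add l.bl (Nat.add n.bl q.bl))))

/-- Whether a table has degree `d`. -/
def isOfDegree (r : Bool) (d : ℕ) (T : LF) : Bool :=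
  pairCheck fun k l m n i j =>
    degOk d k l m n i j || isZero (evZ T (cT r 0 k l m n false i j []))

/-- Whether a table of degree `d` is a cocycle. -/
def isCocycle (r : Bool) (d : ℕ) (T : LF) : Bool :=
  tripleCheck fun k l m n p q i j => bif degOk₃ d k l m n p q i j then
    isZero (evZ T (d2T r 0 k l m n p q i j)) else true

/-- Whether a table of degree `d` is annihilated by the matrix unit in position `(P, Q)`. -/
def isKilled (r : Bool) (d : ℕ) (P Q : Ix) (T : LF) : Bool :=
  pairCheck fun k l m n i j => bif degOk d k l m n i j then
    isZero (evZ T (actT r 0 P Q k l m n false i j [])) else true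

/-- Whether the difference of the diagonal matrix units in the positions `P` and `Q` acts on a table
of degree `d` by the integer `w`. -/
def isWeight (r : Bool) (d : ℕ) (P Q : Ix) (w : ℤ) (T : LF) : Bool :=
  pairCheck fun k l m n i j => bif degOk d k l m n i j then isZero (Int.sub
    (evZ T (actT r 0 P P k l m n false i j (actT r 0 Q Q k l m n true i j [])))
    (Int.mul w (evZ T (cT r 0 k l m n false i j [])))) else true

/-- Whether a table is a highest weight cocycle of degree `d` and weight `(w, w')`. -/
def isHWCocycle (r : Bool) (d : ℕ) (w w' : ℤ) (T : LF) : Bool :=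
  isOfDegree r d T && (isKilled r d .u0 .u1 T && (isKilled r d .v1 .v0 T &&
    (isWeight r d .u0 .v0 w T && (isWeight r d .u1 .v1 w' T && isCocycle r d T))))

theorem of_ixCheck {g : Ix → Bool} (h : ixCheck g = true) (i : Ix) : g i = true := by
  simp only [ixCheck, cond_eq_ite, Bool.if_false_right, Bool.decide_eq_true, Bool.and_eq_true] at h
  cases i <;> simp only [h]

theorem of_lowCheck {g : Ix → Ix → Bool} (h : lowCheck g = true) {k l : Ix}
    (hk : low k l = true) : g k l = true := by
  simp only [lowCheck, cond_eq_ite, Bool.if_false_right, Bool.decide_eq_true, Bool.and_eq_true] at h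
  cases k <;> cases l <;> first | exact absurd hk (by decide) | simp only [h]

theorem of_pairCheck {g : Ix → Ix → Ix → Ix → Ix → Ix → Bool} (h : pairCheck g = true)
    {k l m n : Ix} (hk : low k l = true) (hm : low m n = true) (i j : Ix) :
    g k l m n i j = true :=
  of_ixCheck (of_ixCheck (of_lowCheck (of_lowCheck h hk) hm) i) j

theorem of_tripleCheck {g : Ix → Ix → Ix → Ix → Ix → Ix → Ix → Ix → Bool}
    (h : tripleCheck g = true) {k l m n p q : Ix} (hk : low k l = true) (hm : low m n = true)
    (hp : low p q = true) (i j : Ix) : g k l m n p q i j = true :=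
  of_ixCheck (of_ixCheck (of_lowCheck (of_lowCheck (of_lowCheck h hk) hm) hp) i) j

theorem degOk₃_iff {d : ℕ} {k l m n p q i j : Ix} : degOk₃ d k l m n p q i j = true ↔
    j.bl + (k.bl + (m.bl + p.bl)) = d + (i.bl + (l.bl + (n.bl + q.bl))) := by
  rw [degOk₃, Nat.beq_eq]
  rfl

theorem evZ_cT (T : LF) (k l m n i j : Ix) (s : Bool) (acc : LF) :
    (evZ T (cT r 0 k l m n s i j acc) : ℂ) =
      sgn s * SMat.at (tabC r T (mu k l) (mu m n)) i j + evZ T acc := by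
  rw [evZ_eq, emits_cT, evZ_eq, tabC]

theorem evZ_actT (T : LF) {P Q : Ix} (h : odd P Q = false) (k l m n i j : Ix) (s : Bool)
    (acc : LF) : (evZ T (actT r 0 P Q k l m n s i j acc) : ℂ) =
      sgn s * SMat.at (actL (mu P Q) (tabC r T) (mu k l) (mu m n)) i j + evZ T acc := by
  rw [evZ_eq, emits_actT (C := tabC r T) (fun k l m n => emits_cT r 0 _ k l m n) h, evZ_eq]
  rfl

theorem evZ_nil (T : LF) : evZ T [] = 0 := rfl

theorem hasDegC_of_isOfDegree {d : ℕ} {T : LF} (h : isOfDegree r d T = true) :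
    HasDegC d (tabC r T) := by
  intro k l m n i j hd
  cases hk : low k l
  · rw [tabC, (mkC_mem _ _ _ k l m n).1 hk]
    rfl
  cases hm : low m n
  · rw [tabC, coch_right (mkC_mem _ _ _) hm]
    rfl
  have e := of_pairCheck h hk hm i j
  rw [hd, Bool.false_or, isZero_iff] at e
  have e' := evZ_cT (r := r) T k l m n i j false []
  rw [e, evZ_nil, sgn_false] at e'
  simpa using e'.symm

theorem at_dTC_eq_zero {d : ℕ} {C : CC2} (hC : HasDegC d C) {k l m n p q i j : Ix}
    (h : degOk₃ d k l m n p q i j = false) :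
    SMat.at (dTC C (mu k l) (mu m n) (mu p q)) i j = 0 := by
  rw [← Bool.not_eq_true, degOk₃_iff] at h
  have h0 : ∀ k l m n i j, ¬ j.bl + (k.bl + m.bl) = d + (i.bl + (l.bl + n.bl)) →
      SMat.at (C (mu k l) (mu m n)) i j = 0 := fun k l m n i j h =>
    hC k l m n i j (degOk_false_iff.2 h)
  have e1 : SMat.at (C (sbC (mu k l) (mu m n)) (mu p q)) i j = 0 := by
    rw [sb_mu_mu, map_add, LinearMap.add_apply, at_add]
    by_cases h1 : l = m <;> by_cases h2 : n = k <;>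
      simp only [h1, h2, if_true, if_false, map_zero, LinearMap.zero_apply, map_smul,
        LinearMap.smul_apply, at_smul, at_zero]
    · subst h1 h2
      rw [h0 _ _ _ _ _ _ (by omega), h0 _ _ _ _ _ _ (by omega)]
      ring
    · subst h1
      rw [h0 _ _ _ _ _ _ (by omega)]
      ring
    · subst h2
      rw [h0 _ _ _ _ _ _ (by omega)]
      ring
    · ring
  rw [dTC, at_add, e1, at_sb_mu]
  by_cases h1 : j = q <;> by_cases h2 : i = p <;> simp only [h1, h2, if_true, if_false]
  · subst h1 h2
    rw [h0 _ _ _ _ _ _ (by omega), h0 _ _ _ _ _ _ (by omega)]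
    ring
  · subst h1
    rw [h0 _ _ _ _ _ _ (by omega)]
    ring
  · subst h2
    rw [h0 _ _ _ _ _ _ (by omega)]
    ring
  · ring

/-- Only entries of total degree `d` have to be evaluated; at the others each of the three terms
vanishes by homogeneity. -/
theorem d2mu_of_isCocycle {d : ℕ} {T : LF} (hT : HasDegC d (tabC r T))
    (h : isCocycle r d T = true) {k l m n p q : Ix} (hk : low k l = true) (hm : low m n = true)
    (hp : low p q = true) : d2mu (tabC r T) k l m n p q = 0 := by
  refine at_ext fun i j => ?_
  rw [at_zero]
  cases hd : degOk₃ d k l m n p q i j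
  · have h1 : degOk₃ d k l p q m n i j = false := by
      rw [← Bool.not_eq_true, degOk₃_iff] at hd ⊢
      omega
    have h2 : degOk₃ d m n p q k l i j = false := by
      rw [← Bool.not_eq_true, degOk₃_iff] at hd ⊢
      omega
    rw [d2mu, d2C, at_add, at_sub, at_smul, at_smul, at_dTC_eq_zero hT hd, at_dTC_eq_zero hT h1,
      at_dTC_eq_zero hT h2]
    ring
  · have e := of_tripleCheck h hk hm hp i j
    rw [hd, cond_true, isZero_iff] at e
    rw [d2mu, tabC, ← emits_d2T (fun k l m n => emits_cT r 0 _ k l m n), ← evZ_eq, e,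
      Int.cast_zero]

theorem actL_of_isKilled {d : ℕ} {P Q : Ix} {T : LF} (hPQ : P.bl = Q.bl) (ho : odd P Q = false)
    (hT : HasDegC d (tabC r T)) (h : isKilled r d P Q T = true) {k l m n : Ix}
    (hk : low k l = true) (hm : low m n = true) :
    actL (mu P Q) (tabC r T) (mu k l) (mu m n) = 0 := by
  refine at_ext fun i j => ?_
  cases hd : degOk d k l m n i j
  · exact hasDegC_actL hT hPQ ho k l m n i j hd
  · have e := of_pairCheck h hk hm i j
    rw [hd, cond_true, isZero_iff] at e
    have e' := evZ_actT (r := r) T ho k l m n i j false []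
    rw [e, evZ_nil, sgn_false] at e'
    simpa [at_zero] using e'.symm

/-- A single diagonal matrix unit need not lie in the algebra, but the formula for the action makes
sense for every even supermatrix. The two parts of a split Cartan element can therefore be weighed
separately. -/
theorem actL_of_isWeight {d : ℕ} {P Q : Ix} {w : ℤ} {T : LF} (hP : odd P P = false)
    (hQ : odd Q Q = false) (hT : HasDegC d (tabC r T)) (h : isWeight r d P Q w T = true)
    {k l m n : Ix} (hk : low k l = true) (hm : low m n = true) :
    actL (mu P P) (tabC r T) (mu k l) (mu m n) - actL (mu Q Q) (tabC r T) (mu k l) (mu m n) =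
      (w : ℂ) • tabC r T (mu k l) (mu m n) := by
  refine at_ext fun i j => ?_
  rw [at_sub, at_smul]
  cases hd : degOk d k l m n i j
  · rw [hasDegC_actL hT rfl hP k l m n i j hd, hasDegC_actL hT rfl hQ k l m n i j hd,
      hT k l m n i j hd]
    ring
  · have e := of_pairCheck h hk hm i j
    rw [hd, cond_true, isZero_iff] at e
    have e' := congrArg (Int.cast : ℤ → ℂ) (sub_eq_zero.1 (show _ - _ = (0 : ℤ) from e))
    erw [Int.cast_mul] at e'
    rw [evZ_actT _ hP, evZ_actT _ hQ, evZ_cT, evZ_nil, sgn_false, sgn_true] at e'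
    push_cast at e'
    linear_combination e'

theorem bil_ext_mu {c c' : Bil (gOf r)} (h : ∀ k l m n, low k l = true → low m n = true →
    cx2 c (mu k l) (mu m n) = cx2 c' (mu k l) (mu m n)) : c = c' := by
  ext x y : 2
  refine Subtype.ext ?_
  rw [← cx2_neg, ← cx2_neg, ← sub_eq_zero]
  refine neg_of_mu (r := r) (T := cx2 c x - cx2 c' x) (P := fun _ _ => True)
    (fun m n hm _ => ?_) y fun _ _ h => absurd trivial h
  refine neg_of_mu (r := r) (T := cx2 c - cx2 c' |>.flip (mu m n)) (P := fun _ _ => True)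
    (fun k l hk _ => ?_) x fun _ _ h => absurd trivial h
  exact sub_eq_zero.2 (h k l m n hk hm)

/-! ## Highest weight vectors -/

theorem at_of_mem_piece {h : SMat} (hh : h ∈ piece (gOf r) 0) {i j : Ix} (hij : i.bl ≠ j.bl) :
    SMat.at h i j = 0 := hh.2 _ _ (by rw [eDeg_toIdx]; omega)

theorem at_flip_of_mem_piece {h : SMat} (hh : h ∈ piece (gOf r) 0) (i j : Ix) :
    SMat.at h i j = sgn (csgn i j) * star (SMat.at h j.flip i.flip) := by
  rw [← at_cj, cj_of_mem hh.1]

theorem at_mid_of_mem_gC {h : SMat} (hh : h ∈ gC r) (h0 : SMat.at h .u0 .u0 + SMat.at h .u1 .u1 +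
    SMat.at h .v0 .v0 + SMat.at h .v1 .v1 = 0) : SMat.at h .mid .mid = 0 := by
  cases r
  · rw [mem_gC_false.1 hh, h0]
  · exact (mem_gC_true.1 hh).2.1

/-- Conjugation determines the last block from `A`, so besides `A₁₂` only its mirror entry remains.
The middle entry vanishes because the diagonal does. -/
theorem eq_of_isRaising {h : SMat} (hh : h ∈ piece (gOf r) 0) (hr : IsRaising h) :
    h = SMat.at h .u0 .u1 • mu .u0 .u1 + SMat.at h .v1 .v0 • mu .v1 .v0 := by
  have e00 : SMat.at h .u0 .u0 = 0 := hr 0 0 (by decide)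
  have e10 : SMat.at h .u1 .u0 = 0 := hr 1 0 (by decide)
  have e11 : SMat.at h .u1 .u1 = 0 := hr 1 1 (by decide)
  have f00 : SMat.at h .v0 .v0 = 0 := by
    rw [at_flip_of_mem_piece hh, show Ix.v0.flip = .u0 from rfl, e00, star_zero, mul_zero]
  have f01 : SMat.at h .v0 .v1 = 0 := by
    rw [at_flip_of_mem_piece hh, show Ix.v0.flip = .u0 from rfl, show Ix.v1.flip = .u1 from rfl, e10,
      star_zero, mul_zero]
  have f11 : SMat.at h .v1 .v1 = 0 := by
    rw [at_flip_of_mem_piece hh, show Ix.v1.flip = .u1 from rfl, e11, star_zero, mul_zero]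
  have em : SMat.at h .mid .mid = 0 :=
    at_mid_of_mem_gC (gC_of_mem hh.1) (by rw [e00, e11, f00, f11]; ring)
  refine at_ext fun i j => ?_
  rw [at_add, at_smul, at_smul, at_mu, at_mu]
  by_cases hij : i.bl = j.bl
  · cases i <;> cases j <;> first | exact absurd hij (by decide) | simp [*]
  · rw [at_of_mem_piece hh hij]
    cases i <;> cases j <;> first | exact absurd rfl hij | simp

/-- For real diagonal `A` the last block is `-A`, and the contributions of the two blocks to the
middle entry cancel. -/
theorem eq_of_isSplitCartan {h : SMat} (hh : h ∈ piece (gOf r) 0) (hr : IsSplitCartan h) :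
    h = SMat.at h .u0 .u0 • mu .u0 .u0 + SMat.at h .u1 .u1 • mu .u1 .u1 +
      ((-SMat.at h .u0 .u0) • mu .v0 .v0 + (-SMat.at h .u1 .u1) • mu .v1 .v1) := by
  have e01 : SMat.at h .u0 .u1 = 0 := hr.1 0 1 (by decide)
  have e10 : SMat.at h .u1 .u0 = 0 := hr.1 1 0 (by decide)
  have s0 : star (SMat.at h .u0 .u0) = SMat.at h .u0 .u0 := Complex.conj_eq_iff_im.2 (hr.2 0)
  have s1 : star (SMat.at h .u1 .u1) = SMat.at h .u1 .u1 := Complex.conj_eq_iff_im.2 (hr.2 1)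
  have f00 : SMat.at h .v0 .v0 = -SMat.at h .u0 .u0 := by
    rw [at_flip_of_mem_piece hh, show Ix.v0.flip = .u0 from rfl, s0]
    simp [csgn, sgn]
  have f01 : SMat.at h .v0 .v1 = 0 := by
    rw [at_flip_of_mem_piece hh, show Ix.v0.flip = .u0 from rfl, show Ix.v1.flip = .u1 from rfl, e10,
      star_zero, mul_zero]
  have f10 : SMat.at h .v1 .v0 = 0 := by
    rw [at_flip_of_mem_piece hh, show Ix.v0.flip = .u0 from rfl, show Ix.v1.flip = .u1 from rfl, e01,
      star_zero, mul_zero]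
  have f11 : SMat.at h .v1 .v1 = -SMat.at h .u1 .u1 := by
    rw [at_flip_of_mem_piece hh, show Ix.v1.flip = .u1 from rfl, s1]
    simp [csgn, sgn]
  have em : SMat.at h .mid .mid = 0 :=
    at_mid_of_mem_gC (gC_of_mem hh.1) (by rw [f00, f11]; ring)
  refine at_ext fun i j => ?_
  rw [at_add, at_add, at_add, at_smul, at_smul, at_smul, at_smul, at_mu, at_mu, at_mu, at_mu]
  by_cases hij : i.bl = j.bl
  · cases i <;> cases j <;> first | exact absurd hij (by decide) | simp [*]
  · rw [at_of_mem_piece hh hij]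
    cases i <;> cases j <;> first | exact absurd rfl hij | simp

theorem mu_mem_gC {P Q : Ix} (hPQ : P ≠ Q) (hb : P.bl = Q.bl) : mu P Q ∈ gC r := by
  cases r
  · rw [mem_gC_false]
    cases P <;> cases Q <;> first | exact absurd rfl hPQ | simp [at_mu]
  · rw [mem_gC_true]
    refine ⟨fun i j hij => ?_, ?_⟩
    · rw [at_mu, if_neg]
      rintro ⟨rfl, rfl⟩
      omega
    · cases P <;> cases Q <;> first | exact absurd rfl hPQ | simp [at_mu]

theorem mu_hasDeg {P Q : Ix} (hb : P.bl = Q.bl) : HasDeg 0 (mu P Q) :=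
  hasDeg_iff.2 fun i j hij => by
    rw [at_mu, if_neg]
    rintro ⟨rfl, rfl⟩
    rw [eDeg_toIdx] at hij
    omega

/-- The real and imaginary part of a raising matrix unit are raising elements. -/
theorem exists_decomp_raising {P Q : Ix} (h : P = .u0 ∧ Q = .u1 ∨ P = .v1 ∧ Q = .v0) :
    ∃ a b : ↥(piece (gOf r) 0), mu P Q = (a : SMat) + I • (b : SMat) ∧
      IsRaising (a : SMat) ∧ IsRaising (b : SMat) := by
  have hb : P.bl = Q.bl := by rcases h with ⟨rfl, rfl⟩ | ⟨rfl, rfl⟩ <;> rfl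
  have hPQ : P ≠ Q := by rcases h with ⟨rfl, rfl⟩ | ⟨rfl, rfl⟩ <;> decide
  have hm : mu P Q ∈ gC r := mu_mem_gC hPQ hb
  have key : ∀ z : ℂ, IsRaising (rp (z • mu P Q)) := by
    intro z a b hab
    have e : ∀ i j : Ix, i = .u0 ∧ j = .u0 ∨ i = .u1 ∧ j = .u0 ∨ i = .u1 ∧ j = .u1 →
        SMat.at (rp (z • mu P Q)) i j = 0 := by
      intro i j hij
      rw [rp_apply, real_smul_eq, at_smul, at_add, at_cj, at_smul, at_smul, at_mu, at_mu]
      rcases h with ⟨rfl, rfl⟩ | ⟨rfl, rfl⟩ <;>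
        rcases hij with ⟨rfl, rfl⟩ | ⟨rfl, rfl⟩ | ⟨rfl, rfl⟩ <;> simp [Ix.flip]
    fin_cases a <;> fin_cases b
    · exact e .u0 .u0 (by simp)
    · exact absurd (by decide) hab
    · exact e .u1 .u0 (by simp)
    · exact e .u1 .u1 (by simp)
  have k1 := key 1
  have k2 := key (-I)
  rw [one_smul] at k1
  rw [neg_smul] at k2
  exact ⟨⟨_, rp_mem_piece hm (mu_hasDeg hb)⟩,
    ⟨_, rp_mem_piece (neg_mem ((gC r).smul_mem I hm)) fun i j hij => by
      simp [mu_hasDeg hb i j hij]⟩, rp_decomp _, k1, k2⟩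

theorem hasCochainDeg_of {d : ℕ} {c : Bil (gOf r)} (hc : HasDegC d (cx2 c)) :
    HasCochainDeg (gOf r) d c := by
  intro a b x y hx hy
  refine hasDeg_iff.2 fun i j hij => ?_
  rw [← cx2_neg]
  refine neg_of_mu (r := r) (T := atL i j ∘ₗ cx2 c x) (P := fun m n => eDeg m.toIdx n.toIdx = b)
    (fun m n hm hb => ?_) y (hasDeg_iff.1 hy)
  refine neg_of_mu (r := r) (T := atL i j ∘ₗ (cx2 c).flip (mu m n))
    (P := fun k l => eDeg k.toIdx l.toIdx = a) (fun k l hk ha => ?_) x (hasDeg_iff.1 hx)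
  refine hc k l m n i j (degOk_false_iff.2 fun e => hij ?_)
  rw [eDeg_toIdx] at ha hb ⊢
  omega

/-! ## The cohomology -/

/-- The cocycles with classes in `W`. -/
def pull (g : GSub) (W : Submodule ℝ (H2 g)) : Submodule ℝ (Bil g) :=
  (W.comap (cls g)).map (Z2 g).subtype

theorem mem_pull {g : GSub} {W : Submodule ℝ (H2 g)} {c : Bil g} :
    c ∈ pull g W ↔ ∃ hc : c ∈ Z2 g, cls g ⟨c, hc⟩ ∈ W := by
  constructor
  · rintro ⟨⟨c, hc⟩, h, rfl⟩
    exact ⟨hc, h⟩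
  · rintro ⟨hc, h⟩
    exact ⟨⟨c, hc⟩, h, rfl⟩

theorem cls_eq_zero {g : GSub} {c : ↥(Z2 g)} : cls g c = 0 ↔ (c : Bil g) ∈ B2 g := by
  rw [cls, Submodule.mkQ_apply, Submodule.Quotient.mk_eq_zero]
  rfl

theorem actH_cls {g : GSub} (h : ↥(piece g 0)) {c : Bil g} (hc : c ∈ Z2 g) :
    actH g h (cls g ⟨c, hc⟩) = cls g ⟨act g h c, act_mem_Z2 g h hc⟩ := rfl

theorem act_mem_pull {g : GSub} {W : Submodule ℝ (H2 g)} (hW : ∀ h, ∀ ξ ∈ W, actH g h ξ ∈ W)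
    (h : ↥(piece g 0)) {c : Bil g} (hc : c ∈ pull g W) : act g h c ∈ pull g W := by
  obtain ⟨hc, hcW⟩ := mem_pull.1 hc
  exact mem_pull.2 ⟨act_mem_Z2 g h hc, hW h _ hcW⟩

theorem combC_eq_sum (z : ℕ → ℂ) (ws : List (ℕ × LF)) (o : ℕ) :
    combC r z ws o = ∑ i : Fin ws.length, z (o + i) • tabC r (ws.get i).2 := by
  induction ws generalizing o with
  | nil => rfl
  | cons t ws ih =>
    rw [combC, ih]
    simp only [List.length_cons]
    rw [Fin.sum_univ_succ]
    simp [add_assoc, add_comm 1]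

theorem cx2_sum {ι : Type*} (s : Finset ι) (c : ι → Bil (gOf r)) :
    cx2 (∑ i ∈ s, c i) = ∑ i ∈ s, cx2 (c i) := by
  classical
  induction s using Finset.induction_on with
  | empty =>
    rw [Finset.sum_empty, Finset.sum_empty]
    have := cx2_smul (r := r) 0 0
    rwa [zero_smul, Complex.ofReal_zero, zero_smul] at this
  | insert i s hi ih => rw [Finset.sum_insert hi, Finset.sum_insert hi, cx2_add, ih]

/-- The descent lemma is applied to the sum of the coboundaries and the cocycles with class in `W`,
and the coboundary summand does not affect the class. -/
theorem cls_mem_of_eq {W : Submodule ℝ (H2 (gOf r))} {c : Bil (gOf r)} (hc : c ∈ Z2 (gOf r))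
    {F : CC1} (hF : F ∈ coch1 r) {D : CC2} (hD : D ∈ cxSpan (pull (gOf r) W))
    (h : cx2 c = d1M F + D) : cls (gOf r) ⟨c, hc⟩ ∈ W := by
  have key : c ∈ B2 (gOf r) ⊔ pull (gOf r) W :=
    mem_of_d1mu_add le_sup_left hF
      (Submodule.span_mono (Set.image_mono (le_sup_right (a := B2 (gOf r)))) hD)
      fun k l m n hk hm => by
        rw [h, LinearMap.add_apply, LinearMap.add_apply, d1M_mu F hk hm]
  obtain ⟨b, hb, e, he, rfl⟩ := Submodule.mem_sup.1 key
  obtain ⟨he, heW⟩ := mem_pull.1 he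
  have hb' : b ∈ Z2 (gOf r) := by
    have := (Z2 (gOf r)).sub_mem hc he
    rwa [add_sub_cancel_right] at this
  have e0 : (⟨b + e, hc⟩ : ↥(Z2 (gOf r))) = ⟨b, hb'⟩ + ⟨e, he⟩ := rfl
  rw [e0, map_add, cls_eq_zero.2 hb, zero_add]
  exact heW

theorem isCochain_of_mem_Z2 {g : GSub} {c : Bil g} (hc : c ∈ Z2 g) : IsCochain g c := hc.1

theorem isCochain_of_mem_pull {g : GSub} {W : Submodule ℝ (H2 g)} {c : Bil g}
    (hc : c ∈ pull g W) : IsCochain g c := by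
  obtain ⟨h, -⟩ := mem_pull.1 hc
  exact isCochain_of_mem_Z2 h

theorem actL_mu_mem_cxSpan {W : Submodule ℝ (H2 (gOf r))}
    (hW : ∀ h, ∀ ξ ∈ W, actH (gOf r) h ξ ∈ W) {P Q : Ix} (hPQ : P ≠ Q) (hb : P.bl = Q.bl) {C : CC2}
    (hC : C ∈ cxSpan (pull (gOf r) W)) : actL (mu P Q) C ∈ cxSpan (pull (gOf r) W) :=
  actL_mem_cxSpan (fun h _ hc => act_mem_pull hW h hc) (mu_mem_gC hPQ hb) (mu_hasDeg hb) hC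

theorem isLowStable_cxSpan {W : Submodule ℝ (H2 (gOf r))}
    (hW : ∀ h, ∀ ξ ∈ W, actH (gOf r) h ξ ∈ W) : IsLowStable r (cxSpan (pull (gOf r) W)) := by
  refine ⟨cxSpan_le_coch fun c hc => isCochain_of_mem_pull hc, fun C hC => ?_, fun C hC => ?_⟩
  · exact actL_mu_mem_cxSpan (P := .u1) (Q := .u0) hW (by decide) rfl hC
  · exact actL_mu_mem_cxSpan (P := .v0) (Q := .v1) hW (by decide) rfl hC

theorem d2mu_smul (u : ℂ) (C : CC2) (k l m n p q : Ix) :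
    d2mu (u • C) k l m n p q = u • d2mu C k l m n p q := by
  simp only [d2mu, d2C, dTC, LinearMap.smul_apply, map_smul, smul_add, smul_sub, smul_comm u]

/-! ### From tables of highest weight cocycles to the cohomology. -/

/-- Bilinear maps whose complexifications are multiples of tables of highest weight cocycles. -/
structure IsTable {l : List (ℕ × LF × Word)} (c : Fin l.length → Bil (gOf r))
    (u : Fin l.length → ℂ) : Prop where
  ne_zero : ∀ i, u i ≠ 0
  cx2_eq : ∀ i, cx2 (c i) = u i • tabC r (l.get i).2.1
  check : ∀ i, ∃ w w', isHWCocycle r (l.get i).1 w w' (l.get i).2.1 = true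

/-- A list of tables without the words. -/
def tables (l : List (ℕ × LF × Word)) : List (ℕ × LF) := l.map fun t => (t.1, t.2.1)

namespace IsTable

variable {l : List (ℕ × LF × Word)} {c : Fin l.length → Bil (gOf r)} {u : Fin l.length → ℂ}

theorem hasDegC (h : IsTable c u) (i : Fin l.length) :
    HasDegC (l.get i).1 (tabC r (l.get i).2.1) := by
  obtain ⟨w, w', hc⟩ := h.check i
  simp only [isHWCocycle, Bool.and_eq_true] at hc
  exact hasDegC_of_isOfDegree hc.1

theorem cocycle (h : IsTable c u) (i : Fin l.length) : c i ∈ Z2 (gOf r) := by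
  obtain ⟨w, w', hc⟩ := h.check i
  simp only [isHWCocycle, Bool.and_eq_true] at hc
  refine mem_Z2_of_d2mu ?_ fun k l m n p q hk hm hp => ?_
  · rw [h.cx2_eq]
    exact (coch r).smul_mem _ (mkC_mem _ _ _)
  · rw [h.cx2_eq, d2mu_smul, d2mu_of_isCocycle (h.hasDegC i) hc.2.2.2.2.2 hk hm hp, smul_zero]

theorem degree (h : IsTable c u) (i : Fin l.length) :
    HasCochainDeg (gOf r) ((l.get i).1 : ℤ) (c i) := by
  refine hasCochainDeg_of fun k l m n a b hd => ?_
  rw [h.cx2_eq, LinearMap.smul_apply, LinearMap.smul_apply, at_smul, h.hasDegC i k l m n a b hd,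
    mul_zero]

theorem act_eq_zero (h : IsTable c u) (i : Fin l.length) (a : ↥(piece (gOf r) 0))
    (ha : IsRaising (a : SMat)) : act (gOf r) a (c i) = 0 := by
  obtain ⟨w, w', hc⟩ := h.check i
  simp only [isHWCocycle, Bool.and_eq_true] at hc
  refine bil_ext_mu fun k l m n hk hm => ?_
  have e : cx2 (0 : Bil (gOf r)) = 0 := by
    have := cx2_sum (r := r) (∅ : Finset ℕ) fun _ => 0
    rwa [Finset.sum_empty, Finset.sum_empty] at this
  rw [e, cx2_act, eq_of_isRaising a.2 ha, h.cx2_eq]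
  simp only [actL_add, actL_smul, actL_smul_right]
  simp only [LinearMap.add_apply, LinearMap.smul_apply, LinearMap.zero_apply]
  rw [actL_of_isKilled (P := .u0) (Q := .u1) rfl rfl (h.hasDegC i) hc.2.1 hk hm,
    actL_of_isKilled (P := .v1) (Q := .v0) rfl rfl (h.hasDegC i) hc.2.2.1 hk hm]
  simp

/-- The weight of a vector with weights `w` and `w'` for the two diagonal entries. -/
def weight (r : Bool) (w w' : ℝ) : ↥(piece (gOf r) 0) →ₗ[ℝ] ℝ where
  toFun a := w * (SMat.at (a : SMat) .u0 .u0).re + w' * (SMat.at (a : SMat) .u1 .u1).re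
  map_add' a b := by
    simp only [Submodule.coe_add, at_add, Complex.add_re]
    ring
  map_smul' t a := by
    simp only [Submodule.coe_smul, real_smul_eq, at_smul, Complex.re_ofReal_mul, RingHom.id_apply,
      smul_eq_mul]
    ring

theorem act_eq_smul (h : IsTable c u) (i : Fin l.length) :
    ∃ w : ↥(piece (gOf r) 0) →ₗ[ℝ] ℝ, ∀ a : ↥(piece (gOf r) 0), IsSplitCartan (a : SMat) →
      act (gOf r) a (c i) = w a • c i := by
  obtain ⟨w, w', hc⟩ := h.check i
  simp only [isHWCocycle, Bool.and_eq_true] at hc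
  -- The functional is `w` times the first plus `w'` times the second diagonal entry of `A`. In the
  -- reduced case the entries are opposite, so only `w - w'` matters.
  refine ⟨weight r w w', fun a ha => bil_ext_mu fun k l m n hk hm => ?_⟩
  have e0 : ((SMat.at (a : SMat) .u0 .u0).re : ℂ) = SMat.at (a : SMat) .u0 .u0 :=
    Complex.ext rfl (ha.2 0).symm
  have e1 : ((SMat.at (a : SMat) .u1 .u1).re : ℂ) = SMat.at (a : SMat) .u1 .u1 :=
    Complex.ext rfl (ha.2 1).symm
  have h0 := actL_of_isWeight (P := .u0) (Q := .v0) rfl rfl (h.hasDegC i) hc.2.2.2.1 hk hm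
  have h1 := actL_of_isWeight (P := .u1) (Q := .v1) rfl rfl (h.hasDegC i) hc.2.2.2.2.1 hk hm
  have ew : ((weight r w w' a : ℝ) : ℂ) =
      w * SMat.at (a : SMat) .u0 .u0 + w' * SMat.at (a : SMat) .u1 .u1 := by
    rw [← e0, ← e1]
    simp [weight]
  rw [cx2_smul, cx2_act, eq_of_isSplitCartan a.2 ha, h.cx2_eq, ew]
  simp only [actL_add, actL_smul, actL_smul_right, LinearMap.add_apply, LinearMap.smul_apply]
  rw [sub_eq_iff_eq_add] at h0 h1
  rw [h0, h1]
  module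

theorem mem_cxSpan (h : IsTable c u) {W : Submodule ℝ (H2 (gOf r))}
    (hW : ∀ i, cls (gOf r) ⟨c i, h.cocycle i⟩ ∈ W) (i : Fin l.length) :
    GoodTab r (cxSpan (pull (gOf r) W)) ((l.get i).1, (l.get i).2.1) := by
  refine ⟨?_, h.hasDegC i⟩
  have e : tabC r (l.get i).2.1 = (u i)⁻¹ • cx2 (c i) := by
    rw [h.cx2_eq, smul_smul, inv_mul_cancel₀ (h.ne_zero i), one_smul]
  rw [e]
  exact (cxSpan _).smul_mem _ (Submodule.subset_span ⟨_, mem_pull.2 ⟨h.cocycle i, hW i⟩, rfl⟩)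

theorem goodTab (h : IsTable c u) {W : Submodule ℝ (H2 (gOf r))}
    (hW : ∀ i, cls (gOf r) ⟨c i, h.cocycle i⟩ ∈ W) :
    ∀ t ∈ tables l, GoodTab r (cxSpan (pull (gOf r) W)) t := by
  intro t ht
  obtain ⟨s, hs, rfl⟩ := List.mem_map.1 ht
  obtain ⟨i, rfl⟩ := List.mem_iff_get.1 hs
  exact h.mem_cxSpan hW i

theorem linearIndependent (h : IsTable c u) (hI : checkIndep r (tables l) = true) :
    LinearIndependent ℝ fun i => cls (gOf r) ⟨c i, h.cocycle i⟩ := by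
  rw [Fintype.linearIndependent_iff]
  intro g hg i
  have hB : ∑ i, g i • c i ∈ B2 (gOf r) := by
    have e : ((∑ i, g i • (⟨c i, h.cocycle i⟩ : ↥(Z2 (gOf r)))) : ↥(Z2 (gOf r))).1 =
        ∑ i, g i • c i := by
      rw [Submodule.coe_sum]
      rfl
    rw [← e, ← cls_eq_zero, map_sum]
    simpa only [map_smul] using hg
  obtain ⟨F, hF, hF'⟩ := exists_d1mu_of_mem_B2 hB
  -- The check concerns tables rather than cochains, so the scalars `u i` are absorbed into the
  -- coefficients; being nonzero, they can be removed at the end.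
  let z : ℕ → ℂ := fun n => if hn : n - 625 < l.length then
    (g ⟨n - 625, hn⟩ : ℂ) * u ⟨n - 625, hn⟩ else 0
  have hz : ∀ i : Fin l.length, z (625 + i) = g i * u i := fun i => by
    simp only [z, Nat.add_sub_cancel_left, i.2, dif_pos]
  have hlen : (tables l).length = l.length := List.length_map _
  have hcomb : combC r z (tables l) 625 = cx2 (∑ i, g i • c i) := by
    rw [combC_eq_sum, cx2_sum]
    refine Fintype.sum_equiv (finCongr hlen) _ _ fun i => ?_
    have e : ((tables l).get i).2 = (l.get (finCongr hlen i)).2.1 :=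
      congrArg Prod.snd (List.getElem_map _)
    rw [cx2_smul, h.cx2_eq, smul_smul, ← hz, e, finCongr_apply, Fin.val_cast]
  have key := eq_zero_of_checkIndep hI (fun t ht => by
    obtain ⟨s, hs, rfl⟩ := List.mem_map.1 ht
    obtain ⟨i, rfl⟩ := List.mem_iff_get.1 hs
    exact h.hasDegC i) (neg_mem hF) (z := z) fun k l m n hk hm => by
      rw [hcomb, hF' k l m n hk hm, d1mu, d1mu, d1C, d1C]
      simp only [LinearMap.neg_apply, map_neg, smul_neg]
      abel
  have := key i (by rw [hlen]; exact i.2)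
  rw [hz] at this
  exact_mod_cast (mul_eq_zero.1 this).resolve_right (h.ne_zero i)

theorem span_eq (h : IsTable c u) (hH : checkHW r (tables l) = true) :
    Submodule.span ℝ (Set.range fun i => cls (gOf r) ⟨c i, h.cocycle i⟩) = hwSpace (gOf r) := by
  refine le_antisymm (Submodule.span_le.2 ?_) fun ξ hξ => ?_
  · rintro _ ⟨i, rfl⟩
    refine Submodule.mem_iInf _ |>.2 fun a => LinearMap.mem_ker.2 ?_
    rw [actH_cls]
    refine cls_eq_zero.2 ?_
    rw [Submodule.coe_mk, h.act_eq_zero i a.1 a.2]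
    exact zero_mem _
  · obtain ⟨⟨e, he⟩, rfl⟩ := Submodule.mkQ_surjective _ ξ
    have hact : ∀ a : ↥(piece (gOf r) 0), IsRaising (a : SMat) → act (gOf r) a e ∈ B2 (gOf r) := by
      intro a ha
      have := LinearMap.mem_ker.1 (Submodule.mem_iInf _ |>.1 hξ ⟨a, ha⟩)
      exact cls_eq_zero.1 this
    -- The raising matrix units of the two blocks are complex combinations of real raising elements,
    -- so they also map the cocycle to coboundaries.
    obtain ⟨a, b, hab, ha, hb⟩ := exists_decomp_raising (r := r) (.inl ⟨rfl, rfl⟩)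
    obtain ⟨a', b', hab', ha', hb'⟩ := exists_decomp_raising (r := r) (.inr ⟨rfl, rfl⟩)
    obtain ⟨G, hG, hG'⟩ := exists_d1mu_of_act hab (hact a ha) (hact b hb)
    obtain ⟨H, hH', hH''⟩ := exists_d1mu_of_act hab' (hact a' ha') (hact b' hb')
    obtain ⟨F, hF, D, hD, hFD⟩ := exists_of_checkHW hH
      (h.goodTab (W := Submodule.span ℝ (Set.range fun i => cls (gOf r) ⟨c i, h.cocycle i⟩))
        fun i => Submodule.subset_span ⟨i, rfl⟩) (cx2_mem (isCochain_of_mem_Z2 he))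
      (fun k l m n p q hk hm hp => d2mu_of_mem_Z2 he hk hm hp) hG hH' hG' hH''
    exact cls_mem_of_eq he hF hD hFD

/-- The complex span of the cocycles with class in `W` contains the tables and is stable under
lowering operators, hence it contains all words. Modulo coboundaries the words span the complexified
cocycles. -/
theorem generate (h : IsTable c u) (hS : checkSpan r l = true) (W : Submodule ℝ (H2 (gOf r)))
    (hW : ∀ h, ∀ ξ ∈ W, actH (gOf r) h ξ ∈ W)
    (hcW : ∀ i, cls (gOf r) ⟨c i, h.cocycle i⟩ ∈ W) : W = ⊤ := by
  refine eq_top_iff.2 fun ξ _ => ?_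
  obtain ⟨⟨e, he⟩, rfl⟩ := Submodule.mkQ_surjective _ ξ
  obtain ⟨F, hF, D, hD, hFD⟩ := exists_of_checkSpan hS (isLowStable_cxSpan hW) (fun t ht => by
    obtain ⟨i, rfl⟩ := List.mem_iff_get.1 ht
    exact h.mem_cxSpan hcW i) (cx2_mem (isCochain_of_mem_Z2 he))
    (fun k l m n p q hk hm hp => d2mu_of_mem_Z2 he hk hm hp)
  exact cls_mem_of_eq he hF hD hFD

theorem representH2 (h : IsTable c u) (hI : checkIndep r (tables l) = true)
    (hH : checkHW r (tables l) = true) (hS : checkSpan r l = true) :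
    RepresentH2 (gOf r) (fun i => ((l.get i).1 : ℤ)) c where
  cocycle := h.cocycle
  degree := h.degree
  -- The cochain is nonzero because its class is, by linear independence.
  highestWeight i := ⟨fun e => (h.linearIndependent hI).ne_zero i (by
    rw [cls_eq_zero]
    simp only [e]
    exact zero_mem _), h.act_eq_zero i, h.act_eq_smul i⟩
  linearIndependent := h.linearIndependent hI
  span_eq := h.span_eq hH
  generate W hW hcW := h.generate hS W hW hcW

end IsTable

/-! ## The cocycles in coordinates -/

/-- The complex number with given integral real and imaginary part. -/
def gauss (z : ℤ × ℤ) : ℂ := z.1 + z.2 * I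

/-- Products of Gaussian integers. -/
def gmul (z w : ℤ × ℤ) : ℤ × ℤ :=
  bif isZero z.1 && isZero z.2 then (0, 0) else
    (Int.sub (Int.mul z.1 w.1) (Int.mul z.2 w.2), Int.add (Int.mul z.1 w.2) (Int.mul z.2 w.1))

/-- Sums of Gaussian integers. -/
def gadd (z w : ℤ × ℤ) : ℤ × ℤ :=
  bif isZero w.1 && isZero w.2 then z else (Int.add z.1 w.1, Int.add z.2 w.2)

/-- Negatives of Gaussian integers. -/
def gneg (z : ℤ × ℤ) : ℤ × ℤ := (Int.neg z.1, Int.neg z.2)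

/-- Conjugates of Gaussian integers. -/
def gconj (z : ℤ × ℤ) : ℤ × ℤ := (z.1, Int.neg z.2)

theorem gauss_mul (z w : ℤ × ℤ) : gauss (gmul z w) = gauss z * gauss w := by
  rw [gmul]
  cases h : isZero z.1 && isZero z.2
  · have e : gauss (z.1 * w.1 - z.2 * w.2, z.1 * w.2 + z.2 * w.1) = gauss z * gauss w := by
      simp only [gauss]
      push_cast
      linear_combination -(z.2 * w.2 : ℂ) * Complex.I_mul_I
    exact e
  · rw [Bool.and_eq_true, isZero_iff, isZero_iff] at h
    simp [gauss, h]

theorem gauss_add (z w : ℤ × ℤ) : gauss (gadd z w) = gauss z + gauss w := by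
  rw [gadd]
  cases h : isZero w.1 && isZero w.2
  · have e : gauss (z.1 + w.1, z.2 + w.2) = gauss z + gauss w := by
      simp only [gauss]
      push_cast
      ring
    exact e
  · rw [Bool.and_eq_true, isZero_iff, isZero_iff] at h
    simp [gauss, h]

theorem gauss_neg (z : ℤ × ℤ) : gauss (gneg z) = -gauss z := by
  have e : gauss (-z.1, -z.2) = -gauss z := by
    simp only [gauss]
    push_cast
    ring
  exact e

theorem gauss_conj (z : ℤ × ℤ) : gauss (gconj z) = star (gauss z) := by
  have e : gauss (z.1, -z.2) = star (gauss z) := by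
    simp [gauss]
  exact e

theorem gauss_zero : gauss (0, 0) = 0 := by simp [gauss]

theorem gauss_one : gauss (1, 0) = 1 := by simp [gauss]

theorem gauss_I : gauss (0, 1) = I := by simp [gauss]

/-! ### Values of tensors on matrix units as Gaussian integers. -/

/-- The supermatrix `X` has the entries `x`. -/
def HasEntries (X : (gOf r).Sp) (x : Ix → Ix → ℤ × ℤ) : Prop :=
  ∀ i j, SMat.at (X : SMat) i j = gauss (x i j)

/-- The complexification of the covector `α` has half of the coefficients `a`. -/
def HasCoeffs (α : ↥(neg (gOf r)) →ₗ[ℝ] ℝ) (a : Ix → Ix → ℤ × ℤ) : Prop :=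
  ∃ L : SMat →ₗ[ℂ] ℂ, (∀ X, L (lowP X) = L X) ∧ (∀ x : ↥(neg (gOf r)), L x = α x) ∧
    ∀ k l, 2 * L (mu k l) = gauss (a k l)

/-- The linear combination of the functions in a list with the given coefficients. -/
def evTens (l : List ((ℤ × ℤ) × (Ix → Ix → ℤ × ℤ))) (i j : Ix) : ℤ × ℤ :=
  List.rec (0, 0) (fun t _ ih => gadd ih (gmul (t.2 i j) t.1)) l

/-- The list with one entry with the given coefficient. -/
def oneTens (z : ℤ × ℤ) (x : Ix → Ix → ℤ × ℤ) : List ((ℤ × ℤ) × (Ix → Ix → ℤ × ℤ)) :=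
  bif isZero z.1 && isZero z.2 then [] else [(z, x)]

/-- Multiplication of all coefficients by a Gaussian integer. -/
def smulTens (z : ℤ × ℤ) (l : List ((ℤ × ℤ) × (Ix → Ix → ℤ × ℤ))) :
    List ((ℤ × ℤ) × (Ix → Ix → ℤ × ℤ)) := l.map fun t => (gmul z t.1, t.2)

theorem gauss_evTens_cons (t : (ℤ × ℤ) × (Ix → Ix → ℤ × ℤ))
    (l : List ((ℤ × ℤ) × (Ix → Ix → ℤ × ℤ))) (i j : Ix) :
    gauss (evTens (t :: l) i j) = gauss (evTens l i j) + gauss (t.2 i j) * gauss t.1 := by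
  rw [← gauss_mul, ← gauss_add]
  rfl

theorem gauss_evTens_append (l l' : List ((ℤ × ℤ) × (Ix → Ix → ℤ × ℤ))) (i j : Ix) :
    gauss (evTens (l ++ l') i j) = gauss (evTens l i j) + gauss (evTens l' i j) := by
  induction l with
  | nil => simp [evTens, gauss_zero]
  | cons t l ih =>
    rw [List.cons_append, gauss_evTens_cons, gauss_evTens_cons, ih]
    ring

theorem gauss_evTens_smul (z : ℤ × ℤ) (l : List ((ℤ × ℤ) × (Ix → Ix → ℤ × ℤ))) (i j : Ix) :
    gauss (evTens (smulTens z l) i j) = gauss z * gauss (evTens l i j) := by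
  induction l with
  | nil => simp [smulTens, evTens, gauss_zero]
  | cons t l ih =>
    rw [smulTens] at ih
    rw [smulTens, List.map_cons, gauss_evTens_cons, gauss_evTens_cons, ih, gauss_mul]
    ring

theorem gauss_evTens_one (z : ℤ × ℤ) (x : Ix → Ix → ℤ × ℤ) (i j : Ix) :
    gauss (evTens (oneTens z x) i j) = gauss z * gauss (x i j) := by
  rw [oneTens]
  cases h : isZero z.1 && isZero z.2
  · rw [cond_false, gauss_evTens_cons]
    simp [evTens, gauss_zero, mul_comm]
  · rw [Bool.and_eq_true, isZero_iff, isZero_iff] at h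
    simp [evTens, gauss, h]

/-- The complexification of the bilinear map `c` has a quarter of the entries given by `f`. -/
structure HasValues (c : Bil (gOf r))
    (f : Ix → Ix → Ix → Ix → List ((ℤ × ℤ) × (Ix → Ix → ℤ × ℤ))) : Prop where
  at_cx2 : ∀ k l m n i j, 4 * SMat.at (cx2 c (mu k l) (mu m n)) i j = gauss (evTens (f k l m n) i j)

namespace HasValues

variable {c c' : Bil (gOf r)} {f f' : Ix → Ix → Ix → Ix → List ((ℤ × ℤ) × (Ix → Ix → ℤ × ℤ))}

theorem add (h : HasValues c f) (h' : HasValues c' f') :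
    HasValues (c + c') fun k l m n => f' k l m n ++ f k l m n := by
  refine ⟨fun k l m n i j => ?_⟩
  rw [gauss_evTens_append, ← h.at_cx2, ← h'.at_cx2, cx2_add, LinearMap.add_apply, LinearMap.add_apply, at_add]
  ring

theorem smul (h : HasValues c f) {t : ℝ} {z : ℤ} (ht : t = z) :
    HasValues (t • c) fun k l m n => smulTens (z, 0) (f k l m n) := by
  refine ⟨fun k l m n i j => ?_⟩
  rw [gauss_evTens_smul, ← h.at_cx2, cx2_smul, LinearMap.smul_apply, LinearMap.smul_apply, at_smul, ht]
  simp [gauss]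
  ring

theorem neg (h : HasValues c f) : HasValues (-c) fun k l m n => smulTens (-1, 0) (f k l m n) := by
  rw [← one_smul ℝ c, ← neg_smul]
  exact h.smul (by simp)

theorem sub (h : HasValues c f) (h' : HasValues c' f') :
    HasValues (c - c') fun k l m n => smulTens (-1, 0) (f' k l m n) ++ f k l m n := by
  rw [sub_eq_add_neg]
  exact h.add h'.neg

theorem two_smul (h : HasValues c f) :
    HasValues ((2 : ℝ) • c) fun k l m n => smulTens (2, 0) (f k l m n) := h.smul (by norm_num)

theorem three_smul (h : HasValues c f) :
    HasValues ((3 : ℝ) • c) fun k l m n => smulTens (3, 0) (f k l m n) := h.smul (by norm_num)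

theorem four_smul (h : HasValues c f) :
    HasValues ((4 : ℝ) • c) fun k l m n => smulTens (4, 0) (f k l m n) := h.smul (by norm_num)

variable {X : (gOf r).Sp} {x : Ix → Ix → ℤ × ℤ} {α β : ↥(MinkowskiSuper.neg (gOf r)) →ₗ[ℝ] ℝ}
  {a b : Ix → Ix → ℤ × ℤ}

/-- Each complexified covector has coefficients with denominator 2, and the factor 4 clears both
denominators. -/
theorem at_tens_mulForm (hX : HasEntries X x) (hα : HasCoeffs α a) (hβ : HasCoeffs β b)
    (k l m n i j : Ix) : 4 * SMat.at (cx2 (tens X (mulForm α β)) (mu k l) (mu m n)) i j =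
      gauss (a k l) * gauss (b m n) * gauss (x i j) := by
  obtain ⟨L, hL, hL', hL''⟩ := hα
  obtain ⟨M, hM, hM', hM''⟩ := hβ
  have e : cx2 (tens X (mulForm α β)) = L.smulRight (M.smulRight (X : SMat)) := by
    refine cx2_ext (r := r) (cx2_lowP _) (cx2_lowP_right _) (fun Y => ?_) (fun Y Z => ?_)
      fun y z => ?_
    · rw [LinearMap.smulRight_apply, LinearMap.smulRight_apply, hL]
    · rw [LinearMap.smulRight_apply, LinearMap.smul_apply, LinearMap.smul_apply,
        LinearMap.smulRight_apply, LinearMap.smulRight_apply, hM]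
    · rw [cx2_neg, LinearMap.smulRight_apply, LinearMap.smul_apply, LinearMap.smulRight_apply, hL',
        hM', smul_smul, ← Complex.ofReal_mul, ← real_smul_eq]
      rfl
  rw [← hL'', ← hM'', ← hX, e, LinearMap.smulRight_apply, LinearMap.smul_apply,
    LinearMap.smulRight_apply, at_smul, at_smul]
  ring

theorem tens_add (X : (gOf r).Sp) (ω ω' : ↥(MinkowskiSuper.neg (gOf r)) →ₗ[ℝ]
    ↥(MinkowskiSuper.neg (gOf r)) →ₗ[ℝ] ℝ) : tens X (ω + ω') = tens X ω + tens X ω' := by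
  ext y z : 2
  exact add_smul (ω y z) (ω' y z) X

theorem tens_sub (X : (gOf r).Sp) (ω ω' : ↥(MinkowskiSuper.neg (gOf r)) →ₗ[ℝ]
    ↥(MinkowskiSuper.neg (gOf r)) →ₗ[ℝ] ℝ) : tens X (ω - ω') = tens X ω - tens X ω' := by
  ext y z : 2
  exact sub_smul (ω y z) (ω' y z) X

theorem tens_wQQ (hX : HasEntries X x) (hα : HasCoeffs α a) (hβ : HasCoeffs β b) :
    HasValues (tens X (wQQ α β)) fun k l m n =>
      oneTens (gadd (gmul (a k l) (b m n)) (gmul (b k l) (a m n))) x := by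
  refine ⟨fun k l m n i j => ?_⟩
  rw [wQQ, tens_add, cx2_add, LinearMap.add_apply, LinearMap.add_apply, at_add, mul_add,
    at_tens_mulForm hX hα hβ, at_tens_mulForm hX hβ hα, gauss_evTens_one, gauss_add, gauss_mul,
    gauss_mul]
  ring

theorem cx2_sub (c c' : Bil (gOf r)) : cx2 (c - c') = cx2 c - cx2 c' := by
  rw [eq_sub_iff_add_eq, ← cx2_add, sub_add_cancel]

theorem tens_wTT (hX : HasEntries X x) (hα : HasCoeffs α a) (hβ : HasCoeffs β b) :
    HasValues (tens X (wTT α β)) fun k l m n =>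
      oneTens (gadd (gmul (a k l) (b m n)) (gneg (gmul (b k l) (a m n)))) x := by
  refine ⟨fun k l m n i j => ?_⟩
  rw [wTT, tens_sub, cx2_sub, LinearMap.sub_apply, LinearMap.sub_apply, at_sub, mul_sub,
    at_tens_mulForm hX hα hβ, at_tens_mulForm hX hβ hα, gauss_evTens_one, gauss_add, gauss_neg,
    gauss_mul, gauss_mul]
  ring

/-- The sign convention for a mixed product makes it the antisymmetric product of the factors in the
opposite order. -/
theorem tens_wQT (hX : HasEntries X x) (hα : HasCoeffs α a) (hβ : HasCoeffs β b) :
    HasValues (tens X (wQT α β)) fun k l m n =>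
      oneTens (gadd (gmul (b k l) (a m n)) (gneg (gmul (a k l) (b m n)))) x :=
  tens_wTT hX hβ hα

end HasValues

/-! ### Covectors -/

/-- The coefficients of twice the real part of an entry. -/
def coeffRe (i j : Ix) (s : Bool) (k l : Ix) : ℤ × ℤ :=
  gadd (bif k.eq i && l.eq j then (1, 0) else (0, 0))
    (bif k.eq j.flip && l.eq i.flip then (sgn s, 0) else (0, 0))

/-- The coefficients of twice the imaginary part of an entry. -/
def coeffIm (i j : Ix) (s : Bool) (k l : Ix) : ℤ × ℤ :=
  gadd (bif k.eq i && l.eq j then (0, -1) else (0, 0))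
    (bif k.eq j.flip && l.eq i.flip then (0, sgn s) else (0, 0))

theorem at_flip_neg (x : ↥(neg (gOf r))) (i j : Ix) :
    star (SMat.at (x : SMat) i j) = sgn (csgn i j) * SMat.at (x : SMat) j.flip i.flip := by
  have e : SMat.at (x : SMat) j.flip i.flip = sgn (csgn i j) * star (SMat.at (x : SMat) i j) := by
    rw [← cj_neg x, at_cj, csgn_flip, Ix.flip_flip, Ix.flip_flip, cj_neg x]
  rw [e, ← mul_assoc, sgn_mul_self, one_mul]

theorem at_mu_eq (i j k l : Ix) : SMat.at (mu k l) i j =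
    gauss (bif k.eq i && l.eq j then (1, 0) else (0, 0)) := by
  rw [at_mu, Ix.eq_eq, Ix.eq_eq]
  by_cases h : i = k ∧ j = l
  · obtain ⟨rfl, rfl⟩ := h
    simp [gauss]
  · rw [if_neg h]
    have : (decide (k = i) && decide (l = j)) = false := by
      rw [Bool.and_eq_false_iff, decide_eq_false_iff_not, decide_eq_false_iff_not]
      by_contra! h'
      exact h ⟨h'.1.symm, h'.2.symm⟩
    rw [this, cond_false, gauss_zero]

/-- On real elements the conjugate of an entry is, up to a fixed sign, the entry at the flipped
position. So the real part is half a sum of two entries and extends complex linearly. -/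
theorem hasCoeffs_entryRe {i j : Ix} (h : low i j = true) :
    HasCoeffs (entryRe i.toIdx j.toIdx : ↥(neg (gOf r)) →ₗ[ℝ] ℝ) (coeffRe i j (csgn i j)) := by
  refine ⟨(1 / 2 : ℂ) • (atL i j + (sgn (csgn i j) : ℂ) • atL j.flip i.flip), fun X => ?_,
    fun x => ?_, fun k l => ?_⟩
  · simp only [LinearMap.smul_apply, LinearMap.add_apply, atL_apply, at_lowP, low_flip, h, if_true]
  · simp only [LinearMap.smul_apply, LinearMap.add_apply, atL_apply, smul_eq_mul]
    rw [← at_flip_neg, RCLike.star_def, Complex.add_conj]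
    have e : entryRe i.toIdx j.toIdx x = (SMat.at (x : SMat) i j).re := rfl
    rw [e]
    push_cast
    ring
  · simp only [LinearMap.smul_apply, LinearMap.add_apply, atL_apply, smul_eq_mul]
    rw [coeffRe, gauss_add, at_mu_eq, at_mu_eq]
    have e : ∀ b : Bool, gauss (bif b then (sgn (csgn i j), 0) else (0, 0)) =
        sgn (csgn i j) * gauss (bif b then (1, 0) else (0, 0)) := by
      intro b
      cases b <;> simp [gauss]
    rw [e]
    ring

/-- As for the real part, with the difference of the two entries divided by `2i`. -/
theorem hasCoeffs_entryIm {i j : Ix} (h : low i j = true) :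
    HasCoeffs (entryIm i.toIdx j.toIdx : ↥(neg (gOf r)) →ₗ[ℝ] ℝ) (coeffIm i j (csgn i j)) := by
  refine ⟨(-I / 2 : ℂ) • (atL i j - (sgn (csgn i j) : ℂ) • atL j.flip i.flip), fun X => ?_,
    fun x => ?_, fun k l => ?_⟩
  · simp only [LinearMap.smul_apply, LinearMap.sub_apply, atL_apply, at_lowP, low_flip, h, if_true]
  · simp only [LinearMap.smul_apply, LinearMap.sub_apply, atL_apply, smul_eq_mul]
    rw [← at_flip_neg, RCLike.star_def, Complex.sub_conj]
    have e : entryIm i.toIdx j.toIdx x = (SMat.at (x : SMat) i j).im := rfl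
    rw [e]
    push_cast
    linear_combination (-(SMat.at (x : SMat) i j).im : ℂ) * Complex.I_mul_I
  · simp only [LinearMap.smul_apply, LinearMap.sub_apply, atL_apply, smul_eq_mul]
    rw [coeffIm, gauss_add, at_mu_eq, at_mu_eq]
    have e : ∀ b : Bool, gauss (bif b then (0, sgn (csgn i j)) else (0, 0)) =
        sgn (csgn i j) * I * gauss (bif b then (1, 0) else (0, 0)) := by
      intro b
      cases b <;> simp [gauss]
    have e' : ∀ b : Bool, gauss (bif b then (0, -1) else (0, 0)) =
        -I * gauss (bif b then (1, 0) else (0, 0)) := by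
      intro b
      cases b <;> simp [gauss]
    rw [e, e']
    ring

theorem hasCoeffs_q0 : HasCoeffs (r := r) (q 0) (coeffRe .mid .u0 true) :=
  hasCoeffs_entryRe (i := .mid) (j := .u0) rfl

theorem hasCoeffs_q1 : HasCoeffs (r := r) (q 1) (coeffRe .mid .u1 true) :=
  hasCoeffs_entryRe (i := .mid) (j := .u1) rfl

theorem hasCoeffs_iq0 : HasCoeffs (r := r) (iq 0) (coeffIm .mid .u0 true) :=
  hasCoeffs_entryIm (i := .mid) (j := .u0) rfl

theorem hasCoeffs_iq1 : HasCoeffs (r := r) (iq 1) (coeffIm .mid .u1 true) :=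
  hasCoeffs_entryIm (i := .mid) (j := .u1) rfl

theorem hasCoeffs_t11 : HasCoeffs (r := r) t11 (coeffRe .v0 .u0 false) :=
  hasCoeffs_entryRe (i := .v0) (j := .u0) rfl

theorem hasCoeffs_t22 : HasCoeffs (r := r) t22 (coeffRe .v1 .u1 false) :=
  hasCoeffs_entryRe (i := .v1) (j := .u1) rfl

theorem hasCoeffs_tS : HasCoeffs (r := r) tS (coeffRe .v0 .u1 false) :=
  hasCoeffs_entryRe (i := .v0) (j := .u1) rfl

theorem hasCoeffs_tK : HasCoeffs (r := r) tK (coeffIm .v0 .u1 false) :=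
  hasCoeffs_entryIm (i := .v0) (j := .u1) rfl

/-! ### Elements -/

/-- The entries of `z (A₁₁ - A₂₂)`. -/
def entH (z : ℤ × ℤ) : Ix → Ix → ℤ × ℤ
  | .u0, .u0 => z
  | .u1, .u1 => gneg z
  | .v0, .v0 => gneg (gconj z)
  | .v1, .v1 => gconj z
  | _, _ => (0, 0)

/-- The entries of `z (A₁₁ + A₂₂)`. -/
def entI (z : ℤ × ℤ) : Ix → Ix → ℤ × ℤ
  | .u0, .u0 => z
  | .u1, .u1 => z
  | .mid, .mid => (0, Int.mul 4 z.2)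
  | .v0, .v0 => gneg (gconj z)
  | .v1, .v1 => gneg (gconj z)
  | _, _ => (0, 0)

/-- The entries of `z A₁₂`. -/
def entE (z : ℤ × ℤ) : Ix → Ix → ℤ × ℤ
  | .u0, .u1 => z
  | .v1, .v0 => gneg (gconj z)
  | _, _ => (0, 0)

/-- The entries of `z A₂₁`. -/
def entF (z : ℤ × ℤ) : Ix → Ix → ℤ × ℤ
  | .u1, .u0 => z
  | .v0, .v1 => gneg (gconj z)
  | _, _ => (0, 0)

/-- The entries of `z Q_{1,1}`. -/
def entQ0 (z : ℤ × ℤ) : Ix → Ix → ℤ × ℤ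
  | .mid, .u0 => z
  | .v0, .mid => gneg (gconj z)
  | _, _ => (0, 0)

/-- The entries of `z Q_{1,2}`. -/
def entQ1 (z : ℤ × ℤ) : Ix → Ix → ℤ × ℤ
  | .mid, .u1 => z
  | .v1, .mid => gneg (gconj z)
  | _, _ => (0, 0)

/-- The entries of `z R_{1,1}`. -/
def entR0 (z : ℤ × ℤ) : Ix → Ix → ℤ × ℤ
  | .mid, .v0 => z
  | .u0, .mid => gconj z
  | _, _ => (0, 0)

/-- The entries of `T₂₂`. -/
def entT22 : Ix → Ix → ℤ × ℤ
  | .v1, .u1 => (1, 0)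
  | _, _ => (0, 0)

variable {z : ℂ} {p : ℤ × ℤ}

theorem hasEntries_cH (h : gauss p = z) : HasEntries (r := false) (cH z) (entH p) := by
  intro i j
  cases i <;> cases j <;>
    simp [entH, cH, cA, mH, sm, SMat.at, Ix.toIdx, gauss_neg, gauss_conj, h, gauss_zero,
      Matrix.trace]

theorem hasEntries_cI (h : gauss p = z) : HasEntries (r := false) (cI z) (entI p) := by
  intro i j
  -- The middle entry is the trace of `A` minus its conjugate transpose, which is `4i` times the
  -- imaginary part of the scalar.
  have e : gauss (0, 4 * p.2) = z + z - (star z + star z) := by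
    rw [← h]
    simp [gauss]
    ring
  cases i <;> cases j <;>
    simp [entI, cI, cA, mI, sm, SMat.at, Ix.toIdx, gauss_neg, gauss_conj, h, gauss_zero,
      Matrix.trace, e]

theorem hasEntries_cE (h : gauss p = z) : HasEntries (r := false) (cE z) (entE p) := by
  intro i j
  cases i <;> cases j <;>
    simp [entE, cE, cA, mE, sm, SMat.at, Ix.toIdx, gauss_neg, gauss_conj, h, gauss_zero,
      Matrix.trace]

theorem hasEntries_cQ1 (h : gauss p = z) : HasEntries (r := false) (cQ 1 z) (entQ1 p) := by
  intro i j
  cases i <;> cases j <;>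
    simp [entQ1, cQ, sm, SMat.at, Ix.toIdx, gauss_neg, gauss_conj, h, gauss_zero, Pi.single_apply]

theorem hasEntries_cR0 (h : gauss p = z) : HasEntries (r := false) (cR 0 z) (entR0 p) := by
  intro i j
  cases i <;> cases j <;>
    simp [entR0, cR, sm, SMat.at, Ix.toIdx, gauss_conj, h, gauss_zero, Pi.single_apply]

theorem hasEntries_cT22 : HasEntries (r := false) cT22 entT22 := by
  intro i j
  cases i <;> cases j <;> simp [entT22, cT22, mT22, sm, SMat.at, Ix.toIdx, gauss_zero, gauss_one]

theorem hasEntries_rH (h : gauss p = z) : HasEntries (r := true) (rH z) (entH p) := by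
  intro i j
  cases i <;> cases j <;>
    simp [entH, rH, rA, mH, sm, SMat.at, Ix.toIdx, gauss_neg, gauss_conj, h, gauss_zero]

theorem hasEntries_rE (h : gauss p = z) : HasEntries (r := true) (rE z) (entE p) := by
  intro i j
  cases i <;> cases j <;>
    simp [entE, rE, rA, mE, sm, SMat.at, Ix.toIdx, gauss_neg, gauss_conj, h, gauss_zero]

theorem hasEntries_rF (h : gauss p = z) : HasEntries (r := true) (rF z) (entF p) := by
  intro i j
  cases i <;> cases j <;>
    simp [entF, rF, rA, mF, sm, SMat.at, Ix.toIdx, gauss_neg, gauss_conj, h, gauss_zero]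

theorem hasEntries_rQ0 (h : gauss p = z) : HasEntries (r := true) (rQ 0 z) (entQ0 p) := by
  intro i j
  cases i <;> cases j <;>
    simp [entQ0, rQ, sm, SMat.at, Ix.toIdx, gauss_neg, gauss_conj, h, gauss_zero, Pi.single_apply]

theorem hasEntries_rQ1 (h : gauss p = z) : HasEntries (r := true) (rQ 1 z) (entQ1 p) := by
  intro i j
  cases i <;> cases j <;>
    simp [entQ1, rQ, sm, SMat.at, Ix.toIdx, gauss_neg, gauss_conj, h, gauss_zero, Pi.single_apply]

theorem hasEntries_rT22 : HasEntries (r := true) rT22 entT22 := by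
  intro i j
  cases i <;> cases j <;> simp [entT22, rT22, mT22, sm, SMat.at, Ix.toIdx, gauss_zero, gauss_one]

/-- Whether `f` gives the multiple of a table by the Gaussian integer `u`. -/
def isMultiple (r : Bool) (u : ℤ × ℤ) (T : LF)
    (f : Ix → Ix → Ix → Ix → List ((ℤ × ℤ) × (Ix → Ix → ℤ × ℤ))) : Bool :=
  pairCheck fun k l m n i j =>
    isZero (Int.sub (evTens (f k l m n) i j).1
      (Int.mul u.1 (evZ T (cT r 0 k l m n false i j [])))) &&
    isZero (Int.sub (evTens (f k l m n) i j).2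
      (Int.mul u.2 (evZ T (cT r 0 k l m n false i j []))))

/-- The table is integral, so equality with a Gaussian multiple is tested separately on real and
imaginary parts, at finitely many entries. The 4 is the common denominator from `HasValues`. -/
theorem cx2_eq_of_isMultiple {c : Bil (gOf r)}
    {f : Ix → Ix → Ix → Ix → List ((ℤ × ℤ) × (Ix → Ix → ℤ × ℤ))}
    (h : HasValues c f) {u : ℤ × ℤ} {T : LF} (hf : isMultiple r u T f = true) :
    cx2 c = (gauss u / 4) • tabC r T := by
  refine hom₂_ext_mu fun k l m n => ?_
  cases hk : low k l
  · rw [← cx2_lowP, lowP_mu, hk, if_neg Bool.false_ne_true, map_zero, LinearMap.zero_apply,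
      LinearMap.smul_apply, LinearMap.smul_apply, tabC, (mkC_mem _ _ _ k l m n).1 hk, smul_zero]
  cases hm : low m n
  · rw [← cx2_lowP_right, lowP_mu, hm, if_neg Bool.false_ne_true, map_zero,
      LinearMap.smul_apply, LinearMap.smul_apply, tabC, coch_right (mkC_mem _ _ _) hm, smul_zero]
  refine at_ext fun i j => ?_
  have e := of_pairCheck hf hk hm i j
  rw [Bool.and_eq_true, isZero_iff, isZero_iff] at e
  obtain ⟨e1, e2⟩ := e
  have e1' : (evTens (f k l m n) i j).1 = u.1 * evZ T (cT r 0 k l m n false i j []) := sub_eq_zero.1 e1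
  have e2' : (evTens (f k l m n) i j).2 = u.2 * evZ T (cT r 0 k l m n false i j []) := sub_eq_zero.1 e2
  have e3 := evZ_cT (r := r) T k l m n i j false []
  rw [evZ_nil, sgn_false] at e3
  have e4 := h.at_cx2 k l m n i j
  rw [gauss, e1', e2'] at e4
  push_cast [e3] at e4
  rw [LinearMap.smul_apply, LinearMap.smul_apply, at_smul, gauss]
  linear_combination e4 / 4

/-! ### The tables of the cocycles -/

/-- The table of `conf1`. -/
def conf1Tab : LF :=
  [(6521, 1), (6696, -1), (11071, 1)]

/-- The table of `conf2`. -/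
def conf2Tab : LF :=
  [(6521, -1), (11071, 1)]

/-- The table of `conf8`. -/
def conf8Tab : LF :=
  [(6513, -2), (6625, -1), (6643, -1), (6651, 1), (6673, -2), (6677, -1), (6688, -1), (6773, -1),
  (7251, -2), (7273, 2), (9786, 2), (9797, -2), (9800, 1), (9818, 1), (9886, 2), (9897, -2),
  (9926, -2), (9948, 2), (10426, 1), (11052, -2), (11126, -2), (11148, 1)]

/-- The table of `conf9`. -/
def conf9Tab : LF :=
  [(6513, 2), (6625, 1), (6643, 1), (6651, -1), (6673, 2), (6677, 1), (6688, -1), (6773, 1),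
  (7251, 2), (7273, -2), (9786, 2), (9797, 2), (9800, 1), (9818, 1), (9886, 2), (9897, 2), (9926,
  -2), (9948, 2), (10426, 1), (11052, -2), (11126, -2), (11148, 1)]

/-- The table of `red1`. -/
def red1Tab : LF :=
  [(6521, 1), (6696, -1), (11071, 1)]

/-- The table of `red2`. -/
def red2Tab : LF :=
  [(6521, -1), (11071, 1)]

/-- The table of `red3`. -/
def red3Tab : LF :=
  [(6510, 2), (6536, 1), (6685, -1), (6692, -1), (6822, -1), (7311, -1), (11067, 2), (11197, 1)]

/-- The table of `red4`. -/
def red4Tab : LF :=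
  [(6510, 2), (6536, 1), (6685, 1), (6692, -1), (6822, -1), (7311, 1), (11067, -2), (11197, -1)]

/-- The table of `red5`. -/
def red5Tab : LF :=
  [(6635, -1), (6661, 2), (6675, 1), (6693, 1), (6823, 2), (7261, -3), (7301, 2), (9817, -1),
  (9947, -3), (11147, -2)]

/-- The table of `red6`. -/
def red6Tab : LF :=
  [(6505, -2), (6525, 1), (6667, 1), (6797, 1), (7151, 2), (7267, -1), (7397, -1), (9935, 1),
  (10561, 1), (11069, 2), (11135, 1), (11161, 1), (11193, -1), (14323, -2)]

/-- The table of `red7`. -/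
def red7Tab : LF :=
  [(6505, -2), (6525, 1), (6667, 1), (6797, 1), (7151, 2), (7267, -1), (7397, -1), (9935, -1),
  (10561, -1), (11069, -2), (11135, -1), (11161, -1), (11193, 1), (14323, 2)]

/-- The table of `red8`. -/
def red8Tab : LF :=
  [(6673, 1), (7273, -1), (9797, 1), (9886, 1), (9926, -1), (11126, -1)]

/-- The table of `red9`. -/
def red9Tab : LF :=
  [(6673, 1), (7273, -1), (9797, 1), (9886, -1), (9926, 1), (11126, 1)]

/-- As in the analogous statements below, the term follows the expression for the cochain summand by
summand, and the kernel compares the resulting entries with the table. -/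
theorem cx2_conf1 : cx2 (r := false) conf1 = (gauss (2, 0) / 4) • tabC false conf1Tab :=
  cx2_eq_of_isMultiple (
    .tens_wQQ hasEntries_cT22 hasCoeffs_q0 hasCoeffs_q0)
    (by decide +kernel)

theorem cx2_conf2 : cx2 (r := false) conf2 = (gauss (0, 2) / 4) • tabC false conf2Tab :=
  cx2_eq_of_isMultiple (
    .tens_wQQ hasEntries_cT22 hasCoeffs_q0 hasCoeffs_iq0)
    (by decide +kernel)

theorem cx2_conf8 : cx2 (r := false) conf8 = (gauss (4, 0) / 4) • tabC false conf8Tab :=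
  cx2_eq_of_isMultiple (
    .add (.sub (.add (.add (.add (.sub (.add (.add (.four_smul (.tens_wTT (hasEntries_cQ1
    gauss_one) hasCoeffs_t11 hasCoeffs_tS)) (.tens_wQT (hasEntries_cH gauss_I) hasCoeffs_iq0
    hasCoeffs_t11)) (.tens_wQT (hasEntries_cI gauss_I) hasCoeffs_iq0 hasCoeffs_t11)) (.four_smul
    (.tens_wQT (hasEntries_cE gauss_one) hasCoeffs_q0 hasCoeffs_tS))) (.two_smul (.tens_wQT
    (hasEntries_cE gauss_one) hasCoeffs_iq0 hasCoeffs_tK))) (.four_smul (.tens_wQT (hasEntries_cE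
    gauss_one) hasCoeffs_q1 hasCoeffs_t11))) (.two_smul (.tens_wQT (hasEntries_cE gauss_I)
    hasCoeffs_iq0 hasCoeffs_tS))) (.two_smul (.tens_wQQ (hasEntries_cR0 gauss_I) hasCoeffs_q0
    hasCoeffs_iq0))) (.two_smul (.tens_wQQ (hasEntries_cR0 gauss_one) hasCoeffs_iq0
    hasCoeffs_iq0)))
    (by decide +kernel)

theorem cx2_conf9 : cx2 (r := false) conf9 = (gauss (0, 4) / 4) • tabC false conf9Tab :=
  cx2_eq_of_isMultiple (
    .sub (.add (.sub (.add (.sub (.sub (.sub (.sub (.four_smul (.tens_wTT (hasEntries_cQ1 gauss_I)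
    hasCoeffs_t11 hasCoeffs_tS)) (.tens_wQT (hasEntries_cH gauss_I) hasCoeffs_q0 hasCoeffs_t11))
    (.tens_wQT (hasEntries_cI gauss_I) hasCoeffs_q0 hasCoeffs_t11)) (.two_smul (.tens_wQT
    (hasEntries_cE gauss_one) hasCoeffs_q0 hasCoeffs_tK))) (.four_smul (.tens_wQT (hasEntries_cE
    gauss_one) hasCoeffs_iq0 hasCoeffs_tS))) (.four_smul (.tens_wQT (hasEntries_cE gauss_one)
    hasCoeffs_iq1 hasCoeffs_t11))) (.two_smul (.tens_wQT (hasEntries_cE gauss_I) hasCoeffs_q0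
    hasCoeffs_tS))) (.two_smul (.tens_wQQ (hasEntries_cR0 gauss_I) hasCoeffs_q0 hasCoeffs_q0)))
    (.two_smul (.tens_wQQ (hasEntries_cR0 gauss_one) hasCoeffs_q0 hasCoeffs_iq0)))
    (by decide +kernel)

theorem cx2_red1 : cx2 (r := true) red1 = (gauss (2, 0) / 4) • tabC true red1Tab :=
  cx2_eq_of_isMultiple (
    .tens_wQQ hasEntries_rT22 hasCoeffs_q0 hasCoeffs_q0)
    (by decide +kernel)

theorem cx2_red2 : cx2 (r := true) red2 = (gauss (0, 2) / 4) • tabC true red2Tab :=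
  cx2_eq_of_isMultiple (
    .tens_wQQ hasEntries_rT22 hasCoeffs_q0 hasCoeffs_iq0)
    (by decide +kernel)

theorem cx2_red3 : cx2 (r := true) red3 = (gauss (0, 2) / 4) • tabC true red3Tab :=
  cx2_eq_of_isMultiple (
    .add (.sub (.add (.neg (.tens_wQQ (hasEntries_rQ0 gauss_one) hasCoeffs_q0 hasCoeffs_iq0))
    (.tens_wQQ (hasEntries_rQ0 gauss_I) hasCoeffs_q0 hasCoeffs_q0)) (.tens_wQQ (hasEntries_rQ1
    gauss_one) hasCoeffs_q0 hasCoeffs_iq1)) (.tens_wQQ (hasEntries_rQ1 gauss_I) hasCoeffs_q0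
    hasCoeffs_q1))
    (by decide +kernel)

theorem cx2_red4 : cx2 (r := true) red4 = (gauss (2, 0) / 4) • tabC true red4Tab :=
  cx2_eq_of_isMultiple (
    .add (.sub (.add (.neg (.tens_wQQ (hasEntries_rQ0 gauss_one) hasCoeffs_iq0 hasCoeffs_iq0))
    (.tens_wQQ (hasEntries_rQ0 gauss_I) hasCoeffs_q0 hasCoeffs_iq0)) (.tens_wQQ (hasEntries_rQ1
    gauss_one) hasCoeffs_iq0 hasCoeffs_iq1)) (.tens_wQQ (hasEntries_rQ1 gauss_I) hasCoeffs_iq0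
    hasCoeffs_q1))
    (by decide +kernel)

theorem cx2_red5 : cx2 (r := true) red5 = (gauss (0, 4) / 4) • tabC true red5Tab :=
  cx2_eq_of_isMultiple (
    .add (.add (.sub (.sub (.add (.add (.add (.sub (.sub (.sub (.sub (.add (.sub (.neg (.tens_wQQ
    (hasEntries_rH gauss_I) hasCoeffs_q0 hasCoeffs_q0)) (.tens_wQQ (hasEntries_rH gauss_I)
    hasCoeffs_iq0 hasCoeffs_iq0)) (.two_smul (.tens_wQQ (hasEntries_rE gauss_one) hasCoeffs_q0
    hasCoeffs_iq1))) (.two_smul (.tens_wQQ (hasEntries_rE gauss_one) hasCoeffs_iq0 hasCoeffs_q1)))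
    (.two_smul (.tens_wQQ (hasEntries_rE gauss_I) hasCoeffs_q0 hasCoeffs_q1))) (.two_smul
    (.tens_wQQ (hasEntries_rE gauss_I) hasCoeffs_iq0 hasCoeffs_iq1))) (.tens_wQT (hasEntries_rQ0
    gauss_one) hasCoeffs_iq0 hasCoeffs_t11)) (.tens_wQT (hasEntries_rQ0 gauss_I) hasCoeffs_q0
    hasCoeffs_t11)) (.two_smul (.tens_wQT (hasEntries_rQ1 gauss_one) hasCoeffs_q0 hasCoeffs_tK)))
    (.two_smul (.tens_wQT (hasEntries_rQ1 gauss_one) hasCoeffs_iq0 hasCoeffs_tS))) (.three_smul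
    (.tens_wQT (hasEntries_rQ1 gauss_one) hasCoeffs_iq1 hasCoeffs_t11))) (.two_smul (.tens_wQT
    (hasEntries_rQ1 gauss_I) hasCoeffs_q0 hasCoeffs_tS))) (.two_smul (.tens_wQT (hasEntries_rQ1
    gauss_I) hasCoeffs_iq0 hasCoeffs_tK))) (.three_smul (.tens_wQT (hasEntries_rQ1 gauss_I)
    hasCoeffs_q1 hasCoeffs_t11)))
    (by decide +kernel)

theorem cx2_red6 : cx2 (r := true) red6 = (gauss (4, 0) / 4) • tabC true red6Tab :=
  cx2_eq_of_isMultiple (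
    .add (.sub (.sub (.sub (.sub (.add (.add (.sub (.sub (.sub (.sub (.add (.sub (.add (.sub (.add
    (.sub (.add (.add (.add (.sub (.tens_wQQ (hasEntries_rH gauss_one) hasCoeffs_q0 hasCoeffs_q1)
    (.tens_wQQ (hasEntries_rH gauss_one) hasCoeffs_iq0 hasCoeffs_iq1)) (.tens_wQQ (hasEntries_rH
    gauss_I) hasCoeffs_q0 hasCoeffs_iq1)) (.tens_wQQ (hasEntries_rH gauss_I) hasCoeffs_iq0
    hasCoeffs_q1)) (.tens_wQQ (hasEntries_rE gauss_one) hasCoeffs_q1 hasCoeffs_q1)) (.tens_wQQ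
    (hasEntries_rE gauss_one) hasCoeffs_iq1 hasCoeffs_iq1)) (.two_smul (.tens_wQQ (hasEntries_rE
    gauss_I) hasCoeffs_q1 hasCoeffs_iq1))) (.tens_wQQ (hasEntries_rF gauss_one) hasCoeffs_q0
    hasCoeffs_q0)) (.tens_wQQ (hasEntries_rF gauss_one) hasCoeffs_iq0 hasCoeffs_iq0)) (.two_smul
    (.tens_wQQ (hasEntries_rF gauss_I) hasCoeffs_q0 hasCoeffs_iq0))) (.tens_wQT (hasEntries_rQ0
    gauss_one) hasCoeffs_q0 hasCoeffs_tS)) (.tens_wQT (hasEntries_rQ0 gauss_one) hasCoeffs_iq0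
    hasCoeffs_tK)) (.tens_wQT (hasEntries_rQ0 gauss_one) hasCoeffs_q1 hasCoeffs_t11)) (.tens_wQT
    (hasEntries_rQ0 gauss_I) hasCoeffs_q0 hasCoeffs_tK)) (.tens_wQT (hasEntries_rQ0 gauss_I)
    hasCoeffs_iq0 hasCoeffs_tS)) (.tens_wQT (hasEntries_rQ0 gauss_I) hasCoeffs_iq1 hasCoeffs_t11))
    (.tens_wQT (hasEntries_rQ1 gauss_one) hasCoeffs_q0 hasCoeffs_t22)) (.tens_wQT (hasEntries_rQ1
    gauss_one) hasCoeffs_q1 hasCoeffs_tS)) (.tens_wQT (hasEntries_rQ1 gauss_one) hasCoeffs_iq1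
    hasCoeffs_tK)) (.tens_wQT (hasEntries_rQ1 gauss_I) hasCoeffs_iq0 hasCoeffs_t22)) (.tens_wQT
    (hasEntries_rQ1 gauss_I) hasCoeffs_q1 hasCoeffs_tK)) (.tens_wQT (hasEntries_rQ1 gauss_I)
    hasCoeffs_iq1 hasCoeffs_tS))
    (by decide +kernel)

theorem cx2_red7 : cx2 (r := true) red7 = (gauss (0, 4) / 4) • tabC true red7Tab :=
  cx2_eq_of_isMultiple (
    .add (.add (.sub (.add (.sub (.sub (.add (.add (.sub (.add (.sub (.sub (.add (.sub (.add (.sub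
    (.add (.sub (.sub (.add (.sub (.neg (.tens_wQQ (hasEntries_rH gauss_one) hasCoeffs_q0
    hasCoeffs_iq1)) (.tens_wQQ (hasEntries_rH gauss_one) hasCoeffs_iq0 hasCoeffs_q1)) (.tens_wQQ
    (hasEntries_rH gauss_I) hasCoeffs_q0 hasCoeffs_q1)) (.tens_wQQ (hasEntries_rH gauss_I)
    hasCoeffs_iq0 hasCoeffs_iq1)) (.two_smul (.tens_wQQ (hasEntries_rE gauss_one) hasCoeffs_q1
    hasCoeffs_iq1))) (.tens_wQQ (hasEntries_rE gauss_I) hasCoeffs_q1 hasCoeffs_q1)) (.tens_wQQ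
    (hasEntries_rE gauss_I) hasCoeffs_iq1 hasCoeffs_iq1)) (.two_smul (.tens_wQQ (hasEntries_rF
    gauss_one) hasCoeffs_q0 hasCoeffs_iq0))) (.tens_wQQ (hasEntries_rF gauss_I) hasCoeffs_q0
    hasCoeffs_q0)) (.tens_wQQ (hasEntries_rF gauss_I) hasCoeffs_iq0 hasCoeffs_iq0)) (.tens_wQT
    (hasEntries_rQ0 gauss_one) hasCoeffs_q0 hasCoeffs_tK)) (.tens_wQT (hasEntries_rQ0 gauss_one)
    hasCoeffs_iq0 hasCoeffs_tS)) (.tens_wQT (hasEntries_rQ0 gauss_one) hasCoeffs_iq1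
    hasCoeffs_t11)) (.tens_wQT (hasEntries_rQ0 gauss_I) hasCoeffs_q0 hasCoeffs_tS)) (.tens_wQT
    (hasEntries_rQ0 gauss_I) hasCoeffs_iq0 hasCoeffs_tK)) (.tens_wQT (hasEntries_rQ0 gauss_I)
    hasCoeffs_q1 hasCoeffs_t11)) (.tens_wQT (hasEntries_rQ1 gauss_one) hasCoeffs_iq0
    hasCoeffs_t22)) (.tens_wQT (hasEntries_rQ1 gauss_one) hasCoeffs_q1 hasCoeffs_tK)) (.tens_wQT
    (hasEntries_rQ1 gauss_one) hasCoeffs_iq1 hasCoeffs_tS)) (.tens_wQT (hasEntries_rQ1 gauss_I)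
    hasCoeffs_q0 hasCoeffs_t22)) (.tens_wQT (hasEntries_rQ1 gauss_I) hasCoeffs_q1 hasCoeffs_tS))
    (.tens_wQT (hasEntries_rQ1 gauss_I) hasCoeffs_iq1 hasCoeffs_tK))
    (by decide +kernel)

theorem cx2_red8 : cx2 (r := true) red8 = (gauss (0, 4) / 4) • tabC true red8Tab :=
  cx2_eq_of_isMultiple (
    .add (.add (.add (.add (.sub (.add (.sub (.neg (.tens_wQT (hasEntries_rE gauss_one)
    hasCoeffs_q0 hasCoeffs_tK)) (.tens_wQT (hasEntries_rE gauss_one) hasCoeffs_iq0 hasCoeffs_tS))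
    (.tens_wQT (hasEntries_rE gauss_one) hasCoeffs_iq1 hasCoeffs_t11)) (.tens_wQT (hasEntries_rE
    gauss_I) hasCoeffs_q0 hasCoeffs_tS)) (.tens_wQT (hasEntries_rE gauss_I) hasCoeffs_iq0
    hasCoeffs_tK)) (.tens_wQT (hasEntries_rE gauss_I) hasCoeffs_q1 hasCoeffs_t11)) (.tens_wTT
    (hasEntries_rQ1 gauss_one) hasCoeffs_t11 hasCoeffs_tK)) (.tens_wTT (hasEntries_rQ1 gauss_I)
    hasCoeffs_t11 hasCoeffs_tS))
    (by decide +kernel)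

theorem cx2_red9 : cx2 (r := true) red9 = (gauss (4, 0) / 4) • tabC true red9Tab :=
  cx2_eq_of_isMultiple (
    .add (.sub (.add (.sub (.sub (.sub (.sub (.tens_wQT (hasEntries_rE gauss_one) hasCoeffs_q0
    hasCoeffs_tS) (.tens_wQT (hasEntries_rE gauss_one) hasCoeffs_iq0 hasCoeffs_tK)) (.tens_wQT
    (hasEntries_rE gauss_one) hasCoeffs_q1 hasCoeffs_t11)) (.tens_wQT (hasEntries_rE gauss_I)
    hasCoeffs_q0 hasCoeffs_tK)) (.tens_wQT (hasEntries_rE gauss_I) hasCoeffs_iq0 hasCoeffs_tS))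
    (.tens_wQT (hasEntries_rE gauss_I) hasCoeffs_iq1 hasCoeffs_t11)) (.tens_wTT (hasEntries_rQ1
    gauss_one) hasCoeffs_t11 hasCoeffs_tS)) (.tens_wTT (hasEntries_rQ1 gauss_I) hasCoeffs_t11
    hasCoeffs_tK))
    (by decide +kernel)

/-! ## The main theorem -/

/-- The tables of the conformal case with their degrees and words which generate the cohomology. -/
def confData : List (ℕ × LF × Word) :=
  -- A word applies powers `a` and `b` of the lowering operators of the first and the last block.
  -- For `conf1Tab` the exponents run over `a ≤ 3, b ≤ 1` and `a ≤ 1, b ≤ 3`, the shapes of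
  -- irreducible modules of highest weights `(3, 1)` and `(1, 3)`. The 4 exponents common to both
  -- recur for `conf2Tab`. The last two tables use the shapes `(3, 0)` and `(0, 3)` in the same way.
  -- This gives 24 words, well below the 75 numbers reserved for their coefficients.
  [(0, conf1Tab, .node (.chain 2) (.node (.chain 2) (.node (.chain 0) (.node (.chain 0) .nil)))),
    (0, conf2Tab, .node (.chain 0) (.node (.chain 0) .nil)),
    (3, conf8Tab, .node (.chain 2) (.node .nil (.node .nil (.node .nil .nil)))),
    (3, conf9Tab, .chain 0)]

/-- The tables of the reduced case with their degrees and words which generate the cohomology. -/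
def redData : List (ℕ × LF × Word) :=
  -- The shapes are as in the conformal case in degrees 0 and 3; in degree 1 they are those of `(1,
  -- 0)` and `(0, 1)`. In degree 2 there is one shape `(1, 1)` and two trivial ones. There are 34
  -- words.
  [(0, red1Tab, .node (.chain 2) (.node (.chain 2) (.node (.chain 0) (.node (.chain 0) .nil)))),
    (0, red2Tab, .node (.chain 0) (.node (.chain 0) .nil)),
    (1, red3Tab, .node (.chain 0) (.node .nil .nil)),
    (1, red4Tab, .chain 0),
    (2, red5Tab, .node (.chain 0) (.node (.chain 0) .nil)),
    (2, red6Tab, .chain 0),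
    (2, red7Tab, .chain 0),
    (3, red8Tab, .node (.chain 2) (.node .nil (.node .nil (.node .nil .nil)))),
    (3, red9Tab, .chain 0)]

theorem gauss_ne_zero {u : ℤ × ℤ} (h : (isZero u.1 && isZero u.2) = false) : gauss u / 4 ≠ 0 := by
  intro e
  have e' : gauss u = 0 := by simpa using e
  have h1 : u.1 = 0 := by simpa [gauss] using congrArg Complex.re e'
  have h2 : u.2 = 0 := by simpa [gauss] using congrArg Complex.im e'
  rw [h1, h2] at h
  exact absurd h (by decide)

theorem isTable_conf : IsTable (r := false) (l := confData) confCocycles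
    fun i => gauss ((![(2, 0), (0, 2), (4, 0), (0, 4)] : Fin 4 → ℤ × ℤ) i) / 4 where
  ne_zero i := gauss_ne_zero (by revert i; decide)
  cx2_eq i := match i with
    | ⟨0, _⟩ => cx2_conf1
    | ⟨1, _⟩ => cx2_conf2
    | ⟨2, _⟩ => cx2_conf8
    | ⟨3, _⟩ => cx2_conf9
  -- Weights with respect to the two diagonal entries of `A`. For instance `T₂₂` has weight `(0,
  -- -2)` and the covectors dual to `Q₁₁` and `i Q₁₁` have weight `(1, 0)`, so the first two
  -- cocycles have weight `(2, -2)`.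
  check i := ⟨(![2, 2, 3, 3] : Fin 4 → ℤ) i, (![-2, -2, 0, 0] : Fin 4 → ℤ) i, by
    revert i
    decide +kernel⟩

theorem isTable_red : IsTable (r := true) (l := redData) redCocycles
    fun i => gauss ((![(2, 0), (0, 2), (0, 2), (2, 0), (0, 4), (4, 0), (0, 4), (0, 4), (4, 0)] :
      Fin 9 → ℤ × ℤ) i) / 4 where
  ne_zero i := gauss_ne_zero (by revert i; decide)
  cx2_eq i := match i with
    | ⟨0, _⟩ => cx2_red1
    | ⟨1, _⟩ => cx2_red2
    | ⟨2, _⟩ => cx2_red3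
    | ⟨3, _⟩ => cx2_red4
    | ⟨4, _⟩ => cx2_red5
    | ⟨5, _⟩ => cx2_red6
    | ⟨6, _⟩ => cx2_red7
    | ⟨7, _⟩ => cx2_red8
    | ⟨8, _⟩ => cx2_red9
  check i := ⟨(![2, 2, 1, 1, 2, 1, 1, 3, 3] : Fin 9 → ℤ) i, (![-2, -2, 0, 0, 0, 1, 1, 0, 0] : Fin 9 → ℤ) i, by
    revert i
    decide +kernel⟩

set_option maxRecDepth 100000 in
theorem isProlong_conf : IsProlong conf :=
  isProlong_gOf (r := false) (by decide +kernel) (by decide +kernel)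

set_option maxRecDepth 100000 in
theorem isProlong_red : IsProlong red :=
  isProlong_gOf (r := true) (by decide +kernel) (by decide +kernel)

set_option maxRecDepth 100000 in
theorem representH2_conf : RepresentH2 conf ![0, 0, 3, 3] confCocycles := by
  have e : (![0, 0, 3, 3] : Fin 4 → ℤ) = fun i => ((confData.get i).1 : ℤ) := by
    funext i
    fin_cases i <;> rfl
  rw [e]
  -- The three evaluations concern independence, the highest weight space and generation, in this
  -- order.
  exact isTable_conf.representH2 (by decide +kernel) (by decide +kernel) (by decide +kernel)

set_option maxRecDepth 100000 in
theorem representH2_red : RepresentH2 red ![0, 0, 1, 1, 2, 2, 2, 3, 3] redCocycles := by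
  have e : (![0, 0, 1, 1, 2, 2, 2, 3, 3] : Fin 9 → ℤ) = fun i => ((redData.get i).1 : ℤ) := by
    funext i
    fin_cases i <;> rfl
  rw [e]
  exact isTable_red.representH2 (by decide +kernel) (by decide +kernel) (by decide +kernel)

end MinkowskiSuper

end

theorem theorem3p3 :
    (MinkowskiSuper.IsProlong MinkowskiSuper.conf ∧
      MinkowskiSuper.RepresentH2 MinkowskiSuper.conf ![0, 0, 3, 3] MinkowskiSuper.confCocycles) ∧
    (MinkowskiSuper.IsProlong MinkowskiSuper.red ∧
      MinkowskiSuper.RepresentH2 MinkowskiSuper.red ![0, 0, 1, 1, 2, 2, 2, 3, 3]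
        MinkowskiSuper.redCocycles) :=
  ⟨⟨MinkowskiSuper.isProlong_conf, MinkowskiSuper.representH2_conf⟩,
    MinkowskiSuper.isProlong_red, MinkowskiSuper.representH2_red⟩
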